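/- Let $X$ be a smooth $n$-dimensional manifold. Let $\mathcal A_{2n}$ be the Weyl algebra of polynomials in $p_1,\dots,p_n$ whose coefficients are formal power series in $y^1,\dots,y^n$ over $\mathbb R[[\hbar]]$, with the Moyal--Weyl product $f*g=f\exp\!\big[\tfrac\hbar2\big(\overleftarrow{\partial}_{y^a}\overrightarrow{\partial}_{p_a}-\overleftarrow{\partial}_{p_a}\overrightarrow{\partial}_{y^a}\big)\big]g$. Give it the Fedosov degree $\deg y=\deg p=1$, $\deg\hbar=2$, and let $\hat{\mathcal A}_{2n}=\mathbb R[[y,p,\hbar]]$ be its completion. Let $W(X)\subset\hat W(X)$ be the bundles over $X$ with fibres $\mathcal A_{2n}\subset\hat{\mathcal A}_{2n}$ associated with $TX\oplus T^*X$ (with $y^a$ the linear coordinates on $T_xX$ and $p_a$ those on $T^*_xX$); sections of $W(X)$ are smooth and locally of bounded degree in $p$. Then $\Gamma(S(TX))\subset\Gamma(W(X))$ consists of the sections independent of $y$ and $\hbar$. Let $\mathcal D$ be a connection on $W(X)$, locally $\mathcal D=d+\tfrac1\hbar[\varpi,-]_*$ with an $\mathcal A_{2n}$-valued connection $1$-form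 $\varpi$ (in the local frames of $TX$ given by coordinates, $\varpi$ changes under a coordinate change with Jacobian $J$ by the fibrewise linear action together with the inhomogeneous term $(J^{-1}dJ)^d{}_b\,y^bp_d$). Assume that the part of $\varpi$ of Fedosov degree $1$ is $\varpi_{(1)}=dx^\mu e^a_\mu(x)\,p_a$ with $e^a_\mu(x)$ invertible at every point. A connection with $1$-form $A$ is called flat if $dA+\tfrac1{2\hbar}[A,A]_*=0$. Then: 1. There is a $1$-form $w\in\Omega^1(X)\otimes\Gamma(\hat W(X))$ with no component of Fedosov degree $0$, whose component of degree $1$ is independent of $p$, such that $w$ has only components of Fedosov degree $\ge2$ if $\varpi_{(0)}=0$, such that $\mathcal D+\tfrac1\hbar[w,-]_*$ is flat, and such that for every $f\in\Gamma(S(TX))$ there is a unique $F\in\Gamma(W(X))$ with $\mathcal D F+\tfrac1\hbar[w,F]_*=0$ and $F|_{y=0}=f$. 2. For every $1$-form $w\in\Omega^1(X)\otimes\Gamma(\hat W(X))$ with no component of Fedosov degree $0$ and with component of degree $1$ independent of $p$ (in particular, for every $w$ of Fedosov degree $\ge2$) such that $\mathcal D+\tfrac1\hbar[w,-]_*$ is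 flat, every $f\in\Gamma(S(TX))$ has a unique $F\in\Gamma(\hat W(X))$ with $\mathcal D F+\tfrac1\hbar[w,F]_*=0$ and $F|_{y=0}=f$. -/

import Mathlib

open scoped Manifold ContDiff

noncomputable section

namespace WeylBundle

/-! ## The formal Weyl algebra -/

/-- The coordinate space `ℝⁿ`. -/
abbrev E (n : ℕ) : Type := EuclideanSpace ℝ (Fin n)

/-- The fibre variables: `Sum.inl a` is `y^a` and `Sum.inr a` is `p_a`. -/
abbrev Var (n : ℕ) : Type := Fin n ⊕ Fin n

/-- The underlying space of the completed Weyl algebra: formal power series in `ħ` whose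
coefficients are formal power series in the variables `y^a`, `p_a`. -/
abbrev WeylHat (n : ℕ) : Type := PowerSeries (MvPowerSeries (Var n) ℝ)

/-- The coefficient of the monomial `ħ^k (y,p)^α`. -/
def wcoeff {n : ℕ} (α : Var n →₀ ℕ) (k : ℕ) (F : WeylHat n) : ℝ :=
  MvPowerSeries.coeff α (PowerSeries.coeff k F)

/-- The degree in `y` of the monomial `(y,p)^α`. -/
def yDeg {n : ℕ} (α : Var n →₀ ℕ) : ℕ := ∑ a, α (Sum.inl a)

/-- The degree in `p` of the monomial `(y,p)^α`. -/
def pDeg {n : ℕ} (α : Var n →₀ ℕ) : ℕ := ∑ a, α (Sum.inr a)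

/-- The Fedosov degree of `ħ^k (y,p)^α`: `deg y = deg p = 1` and `deg ħ = 2`. -/
def fedosovDeg {n : ℕ} (α : Var n →₀ ℕ) (k : ℕ) : ℕ := yDeg α + pDeg α + 2 * k

/-- The `k`-th power of the bidifferential operator
`∂_{y^a} ⊗ ∂_{p_a} - ∂_{p_a} ⊗ ∂_{y^a}` (sum over `a`), followed by multiplication. -/
def bidiff {n : ℕ} :
    ℕ → MvPowerSeries (Var n) ℝ → MvPowerSeries (Var n) ℝ → MvPowerSeries (Var n) ℝ
  | 0, f, g => f * g
  | k + 1, f, g => ∑ a : Fin n,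
      (bidiff k (MvPowerSeries.pderiv ℝ (Sum.inl a) f) (MvPowerSeries.pderiv ℝ (Sum.inr a) g)
        - bidiff k (MvPowerSeries.pderiv ℝ (Sum.inr a) f) (MvPowerSeries.pderiv ℝ (Sum.inl a) g))

/-- The Moyal--Weyl product
`f ∗ g = f exp((ħ/2)(←∂_{y^a} →∂_{p_a} - ←∂_{p_a} →∂_{y^a})) g`,
extended `ħ`-bilinearly. -/
def moyal {n : ℕ} (f g : WeylHat n) : WeylHat n :=
  PowerSeries.mk fun m =>
    ∑ x ∈ Finset.HasAntidiagonal.antidiagonal m, ∑ z ∈ Finset.HasAntidiagonal.antidiagonal x.2,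
      ((1 : ℝ) / (2 ^ x.1 * (Nat.factorial x.1 : ℝ))) •
        bidiff x.1 (PowerSeries.coeff z.1 f) (PowerSeries.coeff z.2 g)

/-- The bracket `(1/ħ) [f, g]_∗`. -/
def bracket {n : ℕ} (f g : WeylHat n) : WeylHat n :=
  PowerSeries.mk fun m => PowerSeries.coeff (m + 1) (moyal f g - moyal g f)

/-- The star-commutator is divisible by `ħ`, with quotient `bracket f g`. -/
theorem hbar_mul_bracket {n : ℕ} (f g : WeylHat n) :
    (PowerSeries.X : WeylHat n) * bracket f g = moyal f g - moyal g f := by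
  ext1 m
  cases m with
  | zero =>
    simp [moyal, bidiff, mul_comm]
  | succ m =>
    rw [PowerSeries.coeff_succ_X_mul, bracket, PowerSeries.coeff_mk]

/-! ## Changes of coordinates -/

/-- The Jacobian matrix `J^a_b = ∂φ^a/∂u^b`. -/
def jacobian {n : ℕ} (φ : E n → E n) (u : E n) : Matrix (Fin n) (Fin n) ℝ :=
  Matrix.of fun a b => fderiv ℝ φ u (EuclideanSpace.single b 1) a

/-- The images of the fibre variables under the linear substitution
`y^a ↦ J^a_b y^b`, `p_a ↦ K^b_a p_b`. -/
def linearSubst {n : ℕ} (J K : Matrix (Fin n) (Fin n) ℝ) : Var n → MvPowerSeries (Var n) ℝ :=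
  Sum.elim
    (fun a => ∑ b, J a b • (MvPowerSeries.X (Sum.inl b) : MvPowerSeries (Var n) ℝ))
    (fun a => ∑ b, K b a • (MvPowerSeries.X (Sum.inr b) : MvPowerSeries (Var n) ℝ))

/-- The linear substitution is admissible for power series. -/
theorem hasSubst_linearSubst {n : ℕ} (J K : Matrix (Fin n) (Fin n) ℝ) :
    MvPowerSeries.HasSubst (linearSubst J K) := by
  refine MvPowerSeries.hasSubst_of_constantCoeff_zero ?_
  rintro (a | a)
  · simp [linearSubst, MvPowerSeries.smul_eq_C_mul]
  · simp [linearSubst, MvPowerSeries.smul_eq_C_mul]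

/-- The linear substitution acting on the completed Weyl algebra. -/
def fibreChange {n : ℕ} (J K : Matrix (Fin n) (Fin n) ℝ) (F : WeylHat n) : WeylHat n :=
  PowerSeries.mk fun k => MvPowerSeries.subst (linearSubst J K) (PowerSeries.coeff k F)

theorem fibreChange_add {n : ℕ} (J K : Matrix (Fin n) (Fin n) ℝ) (F G : WeylHat n) :
    fibreChange J K (F + G) = fibreChange J K F + fibreChange J K G := by
  ext1 k
  simp [fibreChange, MvPowerSeries.subst_add (hasSubst_linearSubst J K)]

/-- The partial derivative `∂/∂u^μ`, coefficient by coefficient, of a function with values in the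
completed Weyl algebra. -/
def partialDeriv {n : ℕ} (μ : Fin n) (F : E n → WeylHat n) (u : E n) : WeylHat n :=
  PowerSeries.mk fun k => (fun α : Var n →₀ ℕ =>
    fderiv ℝ (fun v => wcoeff α k (F v)) u (EuclideanSpace.single μ 1) :
      MvPowerSeries (Var n) ℝ)

/-- The element `M^d_b y^b p_d` of the Weyl algebra. -/
def glElement {n : ℕ} (M : Matrix (Fin n) (Fin n) ℝ) : WeylHat n :=
  PowerSeries.C (∑ d, ∑ b, M d b •
    ((MvPowerSeries.X (Sum.inl b) : MvPowerSeries (Var n) ℝ) * MvPowerSeries.X (Sum.inr d)))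

variable {n : ℕ} {X : Type*} [TopologicalSpace X] [ChartedSpace (E n) X]

/-- The coordinate change from the chart `c` to the chart `c'`. -/
def transition (c c' : atlas (E n) X) : OpenPartialHomeomorph (E n) (E n) :=
  c.1.symm.trans c'.1

/-- The Jacobian `J^a_b = ∂u'^a/∂u^b` of the coordinate change `u' = transition c c' u`. -/
def transJac (c c' : atlas (E n) X) (u : E n) : Matrix (Fin n) (Fin n) ℝ :=
  jacobian (transition c c') u

/-- The Jacobian `∂u^b/∂u'^a` of the inverse coordinate change, at the point corresponding to the
point with coordinates `u` in the chart `c`. -/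
def transJacInv (c c' : atlas (E n) X) (u : E n) : Matrix (Fin n) (Fin n) ℝ :=
  jacobian (transition c' c) (transition c c' u)

/-- Fibre of the bundle associated with `T_xX ⊕ T*_xX`: an element expressed through the fibre
coordinates of `c'` is rewritten through those of `c`, by `y'^a = (∂u'^a/∂u^b) y^b` and
`p'_a = (∂u^b/∂u'^a) p_b`. -/
def transFibre (c c' : atlas (E n) X) (u : E n) (F : WeylHat n) : WeylHat n :=
  fibreChange (transJac c c' u) (transJacInv c c' u) F

/-- The matrix `(M_μ)^d_b = (∂u^d/∂u'^a) ∂²u'^a/∂u^μ∂u^b`. -/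
def inhomMatrix (c c' : atlas (E n) X) (u : E n) (μ : Fin n) : Matrix (Fin n) (Fin n) ℝ :=
  transJacInv c c' u * Matrix.of fun a b =>
    fderiv ℝ (fun v => transJac c c' v a b) u (EuclideanSpace.single μ 1)

/-! ## Sections, one-forms and connections -/

variable (n X) in
/-- A smooth section of the completed Weyl bundle over `X`, given by its local expressions in
the charts of the atlas (extended by zero outside the chart domain).  A power-series-valued
function is smooth if all of its coefficients are. -/
@[ext]
structure WeylSection where
  /-- the expression in the chart `c`, at the point with coordinates `u` -/
  toFun : atlas (E n) X → E n → WeylHat n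
  smooth : ∀ (c : atlas (E n) X) (α : Var n →₀ ℕ) (k : ℕ),
    ContDiffOn ℝ ∞ (fun u => wcoeff α k (toFun c u)) c.1.target
  compat : ∀ (c c' : atlas (E n) X), ∀ u ∈ (transition c c').source,
    toFun c u = transFibre c c' u (toFun c' (transition c c' u))
  zero_off : ∀ (c : atlas (E n) X), ∀ u ∉ c.1.target, toFun c u = 0

variable (n X) in
/-- A smooth one-form on `X` with values in the completed Weyl bundle, given by its components
`w_μ` in the charts of the atlas. -/
structure WeylOneForm where
  /-- the component `μ` in the chart `c`, at the point with coordinates `u` -/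
  toFun : atlas (E n) X → E n → Fin n → WeylHat n
  smooth : ∀ (c : atlas (E n) X) (μ : Fin n) (α : Var n →₀ ℕ) (k : ℕ),
    ContDiffOn ℝ ∞ (fun u => wcoeff α k (toFun c u μ)) c.1.target
  compat : ∀ (c c' : atlas (E n) X), ∀ u ∈ (transition c c').source, ∀ μ : Fin n,
    toFun c u μ = ∑ ν : Fin n,
      transJac c c' u ν μ • transFibre c c' u (toFun c' (transition c c' u) ν)

variable (n X) in
/-- A connection `D = d + (1/ħ)[ϖ, -]_∗` on the completed Weyl bundle, given by the components
`ϖ_μ` of its connection one-form in the charts of the atlas.  The fibre coordinates used over a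
chart are those of its coordinate frame, so on overlaps `ϖ` changes tensorially up to the
inhomogeneous term `(M_μ)^d_b y^b p_d`, which represents `J⁻¹ dJ` in the Weyl algebra. -/
structure WeylConnection where
  /-- the component `μ` in the chart `c`, at the point with coordinates `u` -/
  toFun : atlas (E n) X → E n → Fin n → WeylHat n
  smooth : ∀ (c : atlas (E n) X) (μ : Fin n) (α : Var n →₀ ℕ) (k : ℕ),
    ContDiffOn ℝ ∞ (fun u => wcoeff α k (toFun c u μ)) c.1.target
  compat : ∀ (c c' : atlas (E n) X), ∀ u ∈ (transition c c').source, ∀ μ : Fin n,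
    toFun c u μ = (∑ ν : Fin n,
      transJac c c' u ν μ • transFibre c c' u (toFun c' (transition c c' u) ν))
        + glElement (inhomMatrix c c' u μ)

namespace WeylSection

/-- `F` is a section of the Weyl bundle itself, whose fibres are the polynomials in `p` with
coefficients in the formal power series in `y` over `ℝ[[ħ]]`: locally on `X`, the degree in `p`
is bounded. -/
def IsPolynomial (F : WeylSection n X) : Prop :=
  ∀ (c : atlas (E n) X), ∀ u ∈ c.1.target, ∃ N : ℕ, ∀ᶠ v in nhds u,
    ∀ (α : Var n →₀ ℕ) (k : ℕ), N < pDeg α → wcoeff α k (F.toFun c v) = 0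

/-- `f` is a section of `S(TX)`: polynomial in `p`, independent of `y` and of `ħ`. -/
def IsSymbol (f : WeylSection n X) : Prop :=
  f.IsPolynomial ∧ ∀ (c : atlas (E n) X), ∀ u ∈ c.1.target,
    ∀ (α : Var n →₀ ℕ) (k : ℕ), (yDeg α ≠ 0 ∨ k ≠ 0) → wcoeff α k (f.toFun c u) = 0

/-- `F|_{y=0} = f|_{y=0}`. -/
def EqAtYZero (F f : WeylSection n X) : Prop :=
  ∀ (c : atlas (E n) X), ∀ u ∈ c.1.target, ∀ (α : Var n →₀ ℕ) (k : ℕ), yDeg α = 0 →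
    wcoeff α k (F.toFun c u) = wcoeff α k (f.toFun c u)

end WeylSection

namespace WeylOneForm

/-- All components of `w` of Fedosov degree less than `d` vanish. -/
def FedosovGE (w : WeylOneForm n X) (d : ℕ) : Prop :=
  ∀ (c : atlas (E n) X), ∀ u ∈ c.1.target, ∀ (μ : Fin n) (α : Var n →₀ ℕ) (k : ℕ),
    fedosovDeg α k < d → wcoeff α k (w.toFun c u μ) = 0

/-- The Fedosov-degree-one part of `w` does not depend on `p`. -/
def DegOnePFree (w : WeylOneForm n X) : Prop :=
  ∀ (c : atlas (E n) X), ∀ u ∈ c.1.target, ∀ μ a : Fin n,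
    wcoeff (Finsupp.single (Sum.inr a) 1) 0 (w.toFun c u μ) = 0

end WeylOneForm

namespace WeylConnection

/-- The connection `D + (1/ħ)[w, -]_∗`, whose connection one-form is `ϖ + w`. -/
def addForm (D : WeylConnection n X) (w : WeylOneForm n X) : WeylConnection n X where
  toFun c u μ := D.toFun c u μ + w.toFun c u μ
  smooth c μ α k := by
    have h : (fun u => wcoeff α k (D.toFun c u μ + w.toFun c u μ))
        = fun u => wcoeff α k (D.toFun c u μ) + wcoeff α k (w.toFun c u μ) := by
      funext u
      simp [wcoeff]
    rw [h]
    exact (D.smooth c μ α k).add (w.smooth c μ α k)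
  compat c c' u hu μ := by
    rw [D.compat c c' u hu μ, w.compat c c' u hu μ]
    simp only [transFibre, fibreChange_add, smul_add, Finset.sum_add_distrib]
    abel

/-- The connection one-form is valued in the Weyl algebra: locally on `X`, the degree in `p` is
bounded. -/
def IsPolynomial (D : WeylConnection n X) : Prop :=
  ∀ (c : atlas (E n) X), ∀ u ∈ c.1.target, ∃ N : ℕ, ∀ᶠ v in nhds u,
    ∀ (μ : Fin n) (α : Var n →₀ ℕ) (k : ℕ), N < pDeg α → wcoeff α k (D.toFun c v μ) = 0

/-- The coefficients `e^a_μ` of `p_a` in the connection one-form. -/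
def vielbein (D : WeylConnection n X) (c : atlas (E n) X) (u : E n) :
    Matrix (Fin n) (Fin n) ℝ :=
  Matrix.of fun a μ => wcoeff (Finsupp.single (Sum.inr a) 1) 0 (D.toFun c u μ)

/-- The Fedosov-degree-one part of the connection one-form is `dx^μ e^a_μ p_a` with `e^a_μ`
invertible. -/
def HasInvertibleVielbein (D : WeylConnection n X) : Prop :=
  ∀ (c : atlas (E n) X), ∀ u ∈ c.1.target,
    (∀ μ a : Fin n, wcoeff (Finsupp.single (Sum.inl a) 1) 0 (D.toFun c u μ) = 0) ∧
      IsUnit (D.vielbein c u).det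

/-- The Fedosov-degree-zero part of the connection one-form vanishes. -/
def DegZeroVanishes (D : WeylConnection n X) : Prop :=
  ∀ (c : atlas (E n) X), ∀ u ∈ c.1.target, ∀ μ : Fin n, wcoeff 0 0 (D.toFun c u μ) = 0

/-- The components `(DF)_μ = ∂_μ F + (1/ħ)[ϖ_μ, F]_∗` of the covariant derivative. -/
def covDeriv (D : WeylConnection n X) (F : WeylSection n X)
    (c : atlas (E n) X) (u : E n) (μ : Fin n) : WeylHat n :=
  partialDeriv μ (F.toFun c) u + bracket (D.toFun c u μ) (F.toFun c u)

/-- `F` is covariantly constant. -/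
def IsConstant (D : WeylConnection n X) (F : WeylSection n X) : Prop :=
  ∀ (c : atlas (E n) X), ∀ u ∈ c.1.target, ∀ μ : Fin n, D.covDeriv F c u μ = 0

/-- The components `∂_μ ϖ_ν - ∂_ν ϖ_μ + (1/ħ)[ϖ_μ, ϖ_ν]_∗` of the curvature two-form
`dϖ + (1/2ħ)[ϖ, ϖ]_∗`. -/
def curvature (D : WeylConnection n X) (c : atlas (E n) X) (u : E n) (μ ν : Fin n) :
    WeylHat n :=
  partialDeriv μ (fun v => D.toFun c v ν) u - partialDeriv ν (fun v => D.toFun c v μ) u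
    + bracket (D.toFun c u μ) (D.toFun c u ν)

/-- The connection is flat: its curvature two-form vanishes. -/
def IsFlat (D : WeylConnection n X) : Prop :=
  ∀ (c : atlas (E n) X), ∀ u ∈ c.1.target, ∀ μ ν : Fin n, D.curvature c u μ ν = 0

end WeylConnection

end WeylBundle

end

noncomputable section

namespace WeylBundle

/-! ## Derivations and bidifferential operators on the completed Weyl algebra -/

section Algebra

variable {n : ℕ}

/-! This is Fedosov's iteration for the Koszul-type operator `e^a_μ ∂/∂y^a`, which is what the term
`e^a_μ p_a` of `ϖ` contributes (with a minus sign) to the covariant derivative. Multiplying by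
`(e⁻¹)^μ_a y^a` and summing over `μ` turns this operator into the Euler operator in `y`. The Euler
operator is inverted degree by degree, with `1` or `2` added to it on one-forms and two-forms.

Convergence is measured by the weights `2, 1, 3` of `y, p, ħ`. The bracket lowers weight by at most
`3`, constants are central, and `e^a_μ p_a` is the only other term of `ϖ` of weight below `2`. All
remaining terms lower weight by at most `1`, while contraction with the frame raises it by `2`, so
every equation becomes a fixed-point equation for a map that gains one unit of weight
(`exists_fixedPoint`, `eqOn_of_contracting`). Fedosov degree would not do: a term linear in `y`,
which the hypotheses on `w` allow, gains nothing after contraction with the frame. Since the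
degree-one part of `w` is free of `p`, adding `w` leaves the vielbein unchanged.

A covariantly constant `F` satisfies `F = F|_{y=0} + (inverse Euler)(contraction of the remaining
terms)`, which gives uniqueness. Conversely, if `F` solves this equation, then `∇F` has zero
contraction with the frame. Flatness makes it closed, and such a one-form vanishes
(`exists_nabla_eq_zero`). Flat extensions arise in the same way: the contracted curvature equation
is solved by iteration, and the Bianchi identity kills what is left of the curvature
(`exists_curv_add_eq_zero`). Both the Bianchi identity and closedness rest on the Jacobi identity,
hence on associativity of the Moyal product.

Solutions are local but unique once normalized, and the equations are covariant under coordinate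
changes (`nabla_transport`, `curv_transport`), so they glue. No partition of unity is needed.

For the first assertion, `w` cancels the part of `ϖ` that is nonlinear in `p` and adds Fedosov's
correction `r` to what is left. The sum is affine in `p`, and bracketing with such an element does
not raise the degree in `p`. Hence the lift of a polynomial symbol stays polynomial. -/

theorem weylHat_ext {F G : WeylHat n} (h : ∀ α k, wcoeff α k F = wcoeff α k G) : F = G := by
  ext1 k
  ext α
  exact h α k

/-- `wcoeff` as a linear map. -/
def wcoeffL (α : Var n →₀ ℕ) (k : ℕ) : WeylHat n →ₗ[ℝ] ℝ where
  toFun := wcoeff α k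
  map_add' F G := by simp [wcoeff]
  map_smul' r F := by simp [wcoeff]

@[simp] theorem wcoeffL_apply (α : Var n →₀ ℕ) (k : ℕ) (F : WeylHat n) :
    wcoeffL α k F = wcoeff α k F := rfl

@[simp] theorem wcoeff_zero (α : Var n →₀ ℕ) (k : ℕ) : wcoeff α k (0 : WeylHat n) = 0 :=
  map_zero (wcoeffL α k)

@[simp] theorem wcoeff_add (α : Var n →₀ ℕ) (k : ℕ) (F G : WeylHat n) :
    wcoeff α k (F + G) = wcoeff α k F + wcoeff α k G := map_add (wcoeffL α k) F G

@[simp] theorem wcoeff_sub (α : Var n →₀ ℕ) (k : ℕ) (F G : WeylHat n) :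
    wcoeff α k (F - G) = wcoeff α k F - wcoeff α k G := map_sub (wcoeffL α k) F G

@[simp] theorem wcoeff_neg (α : Var n →₀ ℕ) (k : ℕ) (F : WeylHat n) :
    wcoeff α k (-F) = -wcoeff α k F := map_neg (wcoeffL α k) F

@[simp] theorem wcoeff_smul (α : Var n →₀ ℕ) (k : ℕ) (r : ℝ) (F : WeylHat n) :
    wcoeff α k (r • F) = r * wcoeff α k F := map_smul (wcoeffL α k) r F

@[simp] theorem wcoeff_sum {ι : Type*} (s : Finset ι) (α : Var n →₀ ℕ) (k : ℕ)
    (F : ι → WeylHat n) : wcoeff α k (∑ i ∈ s, F i) = ∑ i ∈ s, wcoeff α k (F i) :=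
  map_sum (wcoeffL α k) F s

theorem coeff_real_smul (k : ℕ) (r : ℝ) (F : WeylHat n) :
    PowerSeries.coeff k (r • F) = r • PowerSeries.coeff k F := rfl

theorem wcoeff_mul (α : Var n →₀ ℕ) (k : ℕ) (F G : WeylHat n) :
    wcoeff α k (F * G) = ∑ x ∈ Finset.HasAntidiagonal.antidiagonal k,
      ∑ y ∈ Finset.HasAntidiagonal.antidiagonal α, wcoeff y.1 x.1 F * wcoeff y.2 x.2 G := by
  classical
  simp [wcoeff, PowerSeries.coeff_mul, MvPowerSeries.coeff_mul]

/-- The partial derivative with respect to a fibre variable. -/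
def wd (s : Var n) : Derivation ℝ (WeylHat n) (WeylHat n) :=
  Derivation.mk'
    { toFun := fun F => PowerSeries.mk fun k => MvPowerSeries.pderiv ℝ s (PowerSeries.coeff k F)
      map_add' := fun F G => by ext1 k; simp
      map_smul' := fun r F => by ext1 k; simp }
    (fun F G => by
      ext1 k
      simp only [LinearMap.coe_mk, AddHom.coe_mk, PowerSeries.coeff_mk, PowerSeries.coeff_mul,
        map_sum, Derivation.leibniz, map_add, smul_eq_mul, Finset.sum_add_distrib]
      congr 1
      rw [← Finset.Nat.sum_antidiagonal_swap]
      simp)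

@[simp] theorem coeff_wd (s : Var n) (k : ℕ) (F : WeylHat n) :
    PowerSeries.coeff k (wd s F) = MvPowerSeries.pderiv ℝ s (PowerSeries.coeff k F) := by
  simp [wd]

theorem wcoeff_wd (s : Var n) (α : Var n →₀ ℕ) (k : ℕ) (F : WeylHat n) :
    wcoeff α k (wd s F) = wcoeff (α + Finsupp.single s 1) k F * (α s + 1) := by
  simp [wcoeff, MvPowerSeries.coeff_pderiv]

theorem wd_comm (s t : Var n) (F : WeylHat n) : wd s (wd t F) = wd t (wd s F) := by
  classical
  refine weylHat_ext fun α k => ?_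
  rw [wcoeff_wd, wcoeff_wd, wcoeff_wd, wcoeff_wd]
  rcases eq_or_ne s t with rfl | h
  · rfl
  · rw [add_right_comm]
    simp [h, h.symm]
    ring

/-- The operators `bidiff k` on the completed Weyl algebra, as bilinear maps. -/
def bidiffL : ℕ → WeylHat n →ₗ[ℝ] WeylHat n →ₗ[ℝ] WeylHat n
  | 0 => LinearMap.mul ℝ (WeylHat n)
  | k + 1 => ∑ a : Fin n,
      ((bidiffL k).compl₁₂ (wd (Sum.inl a)).toLinearMap (wd (Sum.inr a)).toLinearMap
        - (bidiffL k).compl₁₂ (wd (Sum.inr a)).toLinearMap (wd (Sum.inl a)).toLinearMap)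

@[simp] theorem bidiffL_zero (F G : WeylHat n) : bidiffL 0 F G = F * G := rfl

theorem bidiffL_succ (k : ℕ) (F G : WeylHat n) :
    bidiffL (k + 1) F G = ∑ a : Fin n,
      (bidiffL k (wd (Sum.inl a) F) (wd (Sum.inr a) G)
        - bidiffL k (wd (Sum.inr a) F) (wd (Sum.inl a) G)) := by
  simp [bidiffL]

theorem coeff_bidiffL (k m : ℕ) (F G : WeylHat n) :
    PowerSeries.coeff m (bidiffL k F G) = ∑ z ∈ Finset.HasAntidiagonal.antidiagonal m,
      bidiff k (PowerSeries.coeff z.1 F) (PowerSeries.coeff z.2 G) := by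
  induction k generalizing F G with
  | zero => simp [bidiff, PowerSeries.coeff_mul]
  | succ k ih =>
    simp only [bidiffL_succ, map_sum, map_sub, ih, bidiff, coeff_wd, ← Finset.sum_sub_distrib]
    rw [Finset.sum_comm]

/-- Each Poisson contraction is antisymmetric. Hence only odd orders survive in the commutator, and
the order-zero term drops out. -/
theorem bidiffL_swap (k : ℕ) (F G : WeylHat n) :
    bidiffL k G F = (-1 : ℝ) ^ k • bidiffL k F G := by
  induction k generalizing F G with
  | zero => simp [mul_comm]
  | succ k ih =>
    simp only [bidiffL_succ, Finset.smul_sum]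
    refine Finset.sum_congr rfl fun a _ => ?_
    rw [ih (wd (Sum.inr a) F), ih (wd (Sum.inl a) F)]
    simp only [pow_succ, smul_sub, mul_neg, mul_one, neg_smul]
    abel

theorem wd_bidiffL (s : Var n) (k : ℕ) (F G : WeylHat n) :
    wd s (bidiffL k F G) = bidiffL k (wd s F) G + bidiffL k F (wd s G) := by
  induction k generalizing F G with
  | zero => simp [mul_comm, add_comm]
  | succ k ih =>
    simp only [bidiffL_succ, map_sum, map_sub, ih, ← Finset.sum_add_distrib]
    refine Finset.sum_congr rfl fun a _ => ?_
    rw [wd_comm s (Sum.inl a), wd_comm s (Sum.inr a), wd_comm s (Sum.inl a), wd_comm s (Sum.inr a)]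
    abel

/-! ### The Moyal product and its commutator as series of bidifferential operators -/

/-- The coefficients of the exponential series in the Moyal product. -/
def moyalCoeff (k : ℕ) : ℝ := 1 / (2 ^ k * (Nat.factorial k : ℝ))

theorem coeff_moyal (m : ℕ) (F G : WeylHat n) :
    PowerSeries.coeff m (moyal F G) = ∑ x ∈ Finset.HasAntidiagonal.antidiagonal m,
      moyalCoeff x.1 • PowerSeries.coeff x.2 (bidiffL x.1 F G) := by
  simp only [moyal, PowerSeries.coeff_mk, coeff_bidiffL, Finset.smul_sum, moyalCoeff]

/-- The coefficients of the series of bidifferential operators which defines the bracket. -/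
def bracketCoeff (k : ℕ) : ℝ := (1 - (-1) ^ k) * moyalCoeff k

@[simp] theorem bracketCoeff_zero : bracketCoeff 0 = 0 := by simp [bracketCoeff]

@[simp] theorem bracketCoeff_one : bracketCoeff 1 = 1 := by
  norm_num [bracketCoeff, moyalCoeff]

@[simp] theorem bracketCoeff_two : bracketCoeff 2 = 0 := by simp [bracketCoeff]

theorem coeff_bracket (m : ℕ) (F G : WeylHat n) :
    PowerSeries.coeff m (bracket F G) = ∑ x ∈ Finset.HasAntidiagonal.antidiagonal (m + 1),
      bracketCoeff x.1 • PowerSeries.coeff x.2 (bidiffL x.1 F G) := by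
  simp only [bracket, PowerSeries.coeff_mk, map_sub, coeff_moyal, ← Finset.sum_sub_distrib]
  refine Finset.sum_congr rfl fun x _ => ?_
  rw [bidiffL_swap x.1 F G, bracketCoeff]
  simp only [coeff_real_smul, smul_smul, sub_smul, sub_mul, one_mul]
  rw [mul_comm]

theorem wcoeff_bracket (α : Var n →₀ ℕ) (m : ℕ) (F G : WeylHat n) :
    wcoeff α m (bracket F G) = ∑ x ∈ Finset.HasAntidiagonal.antidiagonal (m + 1),
      bracketCoeff x.1 * wcoeff α x.2 (bidiffL x.1 F G) := by
  simp [wcoeff, coeff_bracket]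

/-- The bracket as a bilinear map. -/
def bracketL : WeylHat n →ₗ[ℝ] WeylHat n →ₗ[ℝ] WeylHat n :=
  LinearMap.mk₂ ℝ bracket
    (fun F F' G => weylHat_ext fun α m => by
      simp [wcoeff_bracket, mul_add, Finset.sum_add_distrib])
    (fun r F G => weylHat_ext fun α m => by
      simp [wcoeff_bracket, Finset.mul_sum, mul_left_comm])
    (fun F G G' => weylHat_ext fun α m => by
      simp [wcoeff_bracket, mul_add, Finset.sum_add_distrib])
    (fun r F G => weylHat_ext fun α m => by
      simp [wcoeff_bracket, Finset.mul_sum, mul_left_comm])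

theorem bracketL_apply (F G : WeylHat n) : bracketL F G = bracket F G := rfl

theorem bracketL_swap (F G : WeylHat n) : bracketL G F = -bracketL F G := by
  refine PowerSeries.ext fun m => ?_
  simp [bracketL_apply, bracket]

/-! ## Associativity of the Moyal product -/

/-- The action of `∂_{y^a} ⊗ ∂_{p_a} - ∂_{p_a} ⊗ ∂_{y^a}` in the first two arguments. -/
def poisson₁₂ : Module.End ℝ (WeylHat n → WeylHat n → WeylHat n → WeylHat n) where
  toFun φ F G H := ∑ a : Fin n, (φ (wd (Sum.inl a) F) (wd (Sum.inr a) G) H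
    - φ (wd (Sum.inr a) F) (wd (Sum.inl a) G) H)
  map_add' φ ψ := by
    funext F G H
    simp only [Pi.add_apply, ← Finset.sum_add_distrib]
    exact Finset.sum_congr rfl fun a _ => by abel
  map_smul' r φ := by funext F G H; simp [Finset.smul_sum, smul_sub]

/-- The action of `∂_{y^a} ⊗ ∂_{p_a} - ∂_{p_a} ⊗ ∂_{y^a}` in the outer arguments. -/
def poisson₁₃ : Module.End ℝ (WeylHat n → WeylHat n → WeylHat n → WeylHat n) where
  toFun φ F G H := ∑ a : Fin n, (φ (wd (Sum.inl a) F) G (wd (Sum.inr a) H)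
    - φ (wd (Sum.inr a) F) G (wd (Sum.inl a) H))
  map_add' φ ψ := by
    funext F G H
    simp only [Pi.add_apply, ← Finset.sum_add_distrib]
    exact Finset.sum_congr rfl fun a _ => by abel
  map_smul' r φ := by funext F G H; simp [Finset.smul_sum, smul_sub]

/-- The action of `∂_{y^a} ⊗ ∂_{p_a} - ∂_{p_a} ⊗ ∂_{y^a}` in the last two arguments. -/
def poisson₂₃ : Module.End ℝ (WeylHat n → WeylHat n → WeylHat n → WeylHat n) where
  toFun φ F G H := ∑ a : Fin n, (φ F (wd (Sum.inl a) G) (wd (Sum.inr a) H)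
    - φ F (wd (Sum.inr a) G) (wd (Sum.inl a) H))
  map_add' φ ψ := by
    funext F G H
    simp only [Pi.add_apply, ← Finset.sum_add_distrib]
    exact Finset.sum_congr rfl fun a _ => by abel
  map_smul' r φ := by funext F G H; simp [Finset.smul_sum, smul_sub]

theorem commute_poisson₁₂_poisson₁₃ : Commute (poisson₁₂ (n := n)) poisson₁₃ := by
  refine LinearMap.ext fun φ => ?_
  funext F G H
  simp only [Module.End.mul_apply, poisson₁₂, poisson₁₃, LinearMap.coe_mk, AddHom.coe_mk,
    ← Finset.sum_sub_distrib]
  rw [Finset.sum_comm]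
  refine Finset.sum_congr rfl fun a _ => Finset.sum_congr rfl fun b _ => ?_
  rw [wd_comm (Sum.inl a) (Sum.inl b), wd_comm (Sum.inl a) (Sum.inr b),
    wd_comm (Sum.inr a) (Sum.inl b), wd_comm (Sum.inr a) (Sum.inr b)]
  abel

theorem commute_poisson₁₂_poisson₂₃ : Commute (poisson₁₂ (n := n)) poisson₂₃ := by
  refine LinearMap.ext fun φ => ?_
  funext F G H
  simp only [Module.End.mul_apply, poisson₁₂, poisson₂₃, LinearMap.coe_mk, AddHom.coe_mk,
    ← Finset.sum_sub_distrib]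
  rw [Finset.sum_comm]
  refine Finset.sum_congr rfl fun a _ => Finset.sum_congr rfl fun b _ => ?_
  rw [wd_comm (Sum.inl a) (Sum.inl b), wd_comm (Sum.inl a) (Sum.inr b),
    wd_comm (Sum.inr a) (Sum.inl b), wd_comm (Sum.inr a) (Sum.inr b)]
  abel

theorem commute_poisson₁₃_poisson₂₃ : Commute (poisson₁₃ (n := n)) poisson₂₃ := by
  refine LinearMap.ext fun φ => ?_
  funext F G H
  simp only [Module.End.mul_apply, poisson₁₃, poisson₂₃, LinearMap.coe_mk, AddHom.coe_mk,
    ← Finset.sum_sub_distrib]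
  rw [Finset.sum_comm]
  refine Finset.sum_congr rfl fun a _ => Finset.sum_congr rfl fun b _ => ?_
  rw [wd_comm (Sum.inl a) (Sum.inl b), wd_comm (Sum.inl a) (Sum.inr b),
    wd_comm (Sum.inr a) (Sum.inl b), wd_comm (Sum.inr a) (Sum.inr b)]
  abel

/-- The threefold product. -/
def mul₃ : WeylHat n → WeylHat n → WeylHat n → WeylHat n := fun F G H => F * G * H

theorem poisson₁₂_pow_mul₃ (j : ℕ) (F G H : WeylHat n) :
    (poisson₁₂ ^ j) mul₃ F G H = bidiffL j F G * H := by
  induction j generalizing F G with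
  | zero => simp [mul₃]
  | succ j ih =>
    rw [pow_succ', Module.End.mul_apply, bidiffL_succ, Finset.sum_mul]
    simp only [poisson₁₂, LinearMap.coe_mk, AddHom.coe_mk]
    exact Finset.sum_congr rfl fun a _ => by
      rw [sub_mul]
      exact congrArg₂ _ (ih _ _) (ih _ _)

theorem poisson₂₃_pow_mul₃ (j : ℕ) (F G H : WeylHat n) :
    (poisson₂₃ ^ j) mul₃ F G H = F * bidiffL j G H := by
  induction j generalizing G H with
  | zero => simp [mul₃, mul_assoc]
  | succ j ih =>
    rw [pow_succ', Module.End.mul_apply, bidiffL_succ, Finset.mul_sum]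
    simp only [poisson₂₃, LinearMap.coe_mk, AddHom.coe_mk]
    exact Finset.sum_congr rfl fun a _ => by
      rw [mul_sub]
      exact congrArg₂ _ (ih _ _) (ih _ _)

/-- By the Leibniz rule, a derivative of the inner expression falls on `F` or on `G`, so each outer
contraction with `H` acts as `poisson₁₃ + poisson₂₃`. -/
theorem bidiffL_bidiffL_left (i j : ℕ) (F G H : WeylHat n) :
    bidiffL i (bidiffL j F G) H
      = ((poisson₁₃ + poisson₂₃) ^ i * poisson₁₂ ^ j : Module.End ℝ _) mul₃ F G H := by
  induction i generalizing F G H with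
  | zero => simp [poisson₁₂_pow_mul₃]
  | succ i ih =>
    rw [bidiffL_succ, pow_succ', mul_assoc, Module.End.mul_apply, LinearMap.add_apply]
    simp only [wd_bidiffL, map_add, LinearMap.add_apply, Pi.add_apply, ih]
    simp only [poisson₁₃, poisson₂₃, LinearMap.coe_mk, AddHom.coe_mk, ← Finset.sum_add_distrib]
    exact Finset.sum_congr rfl fun a _ => by abel

theorem bidiffL_bidiffL_right (i j : ℕ) (F G H : WeylHat n) :
    bidiffL i F (bidiffL j G H)
      = ((poisson₁₂ + poisson₁₃) ^ i * poisson₂₃ ^ j : Module.End ℝ _) mul₃ F G H := by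
  induction i generalizing F G H with
  | zero => simp [poisson₂₃_pow_mul₃]
  | succ i ih =>
    rw [bidiffL_succ, pow_succ', mul_assoc, Module.End.mul_apply, LinearMap.add_apply]
    simp only [wd_bidiffL, map_add, Pi.add_apply, ih]
    simp only [poisson₁₂, poisson₁₃, LinearMap.coe_mk, AddHom.coe_mk, ← Finset.sum_add_distrib]
    exact Finset.sum_congr rfl fun a _ => by abel

/-- This is `exp(x/2) exp(y/2) = exp((x+y)/2)` for commuting elements, read off in degree `k`; it is
the binomial theorem. -/
theorem sum_moyalCoeff_smul_mul {A : Type*} [Ring A] [Algebra ℝ A] {x y : A} (h : Commute x y)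
    (k : ℕ) : ∑ z ∈ Finset.HasAntidiagonal.antidiagonal k,
      (moyalCoeff z.1 * moyalCoeff z.2) • (x ^ z.1 * y ^ z.2) = moyalCoeff k • (x + y) ^ k := by
  rw [h.add_pow', Finset.smul_sum]
  refine Finset.sum_congr rfl fun z hz => ?_
  rw [← Nat.cast_smul_eq_nsmul ℝ, smul_smul]
  congr 1
  rw [Finset.HasAntidiagonal.mem_antidiagonal] at hz
  subst hz
  have h := Nat.add_choose_mul_factorial_mul_factorial z.1 z.2
  rw [← Nat.choose_symm_add] at h
  have h' : ((z.1 + z.2).choose z.1 : ℝ) * z.1.factorial * z.2.factorial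
      = (z.1 + z.2).factorial := by exact_mod_cast h
  have h1 : (z.1.factorial : ℝ) ≠ 0 := by positivity
  have h2 : (z.2.factorial : ℝ) ≠ 0 := by positivity
  have h3 : ((z.1 + z.2).factorial : ℝ) ≠ 0 := by positivity
  simp only [moyalCoeff, pow_add]
  field_simp
  linarith

/-- Both sides are the order-`k` term of the exponential of half of `poisson₁₂ + poisson₁₃ +
poisson₂₃`, applied to the threefold product. -/
theorem sum_bidiffL_assoc (k : ℕ) (F G H : WeylHat n) :
    ∑ z ∈ Finset.HasAntidiagonal.antidiagonal k,
        (moyalCoeff z.1 * moyalCoeff z.2) • bidiffL z.1 (bidiffL z.2 F G) H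
      = ∑ z ∈ Finset.HasAntidiagonal.antidiagonal k,
        (moyalCoeff z.1 * moyalCoeff z.2) • bidiffL z.1 F (bidiffL z.2 G H) := by
  have h1 := congrArg (fun T : Module.End ℝ _ => T mul₃ F G H)
    (sum_moyalCoeff_smul_mul (Commute.add_left
      (commute_poisson₁₂_poisson₁₃ (n := n)).symm commute_poisson₁₂_poisson₂₃.symm) k)
  have h2 := congrArg (fun T : Module.End ℝ _ => T mul₃ F G H)
    (sum_moyalCoeff_smul_mul (Commute.add_left
      (commute_poisson₁₂_poisson₂₃ (n := n)) commute_poisson₁₃_poisson₂₃) k)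
  simp only [LinearMap.sum_apply, LinearMap.smul_apply, Finset.sum_apply, Pi.smul_apply] at h1 h2
  simp only [bidiffL_bidiffL_left, bidiffL_bidiffL_right, h1, h2]
  rw [add_comm (poisson₁₃ + poisson₂₃), ← add_assoc]

theorem wd_X_pow_mul (s : Var n) (j : ℕ) (F : WeylHat n) :
    wd s (PowerSeries.X ^ j * F) = PowerSeries.X ^ j * wd s F := by
  ext1 m
  simp only [coeff_wd, PowerSeries.coeff_X_pow_mul']
  split_ifs <;> simp

theorem bidiffL_X_pow_mul_left (i j : ℕ) (F G : WeylHat n) :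
    bidiffL i (PowerSeries.X ^ j * F) G = PowerSeries.X ^ j * bidiffL i F G := by
  induction i generalizing F G with
  | zero => simp [mul_assoc]
  | succ i ih => simp only [bidiffL_succ, wd_X_pow_mul, ih, Finset.mul_sum, mul_sub]

theorem bidiffL_X_pow_mul_right (i j : ℕ) (F G : WeylHat n) :
    bidiffL i F (PowerSeries.X ^ j * G) = PowerSeries.X ^ j * bidiffL i F G := by
  rw [bidiffL_swap, bidiffL_X_pow_mul_left, bidiffL_swap i F G]
  rw [mul_smul_comm, smul_smul, ← mul_pow]
  simp

/-- Truncation modulo `ħ^(r+1)` turns the infinite series into a finite sum, through which the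
merely algebraically bilinear `bidiffL` can be pushed. -/
theorem exists_moyal_eq (r : ℕ) (F G : WeylHat n) : ∃ R : WeylHat n,
    moyal F G = ∑ j ∈ Finset.range (r + 1),
      moyalCoeff j • (PowerSeries.X ^ j * bidiffL j F G) + PowerSeries.X ^ (r + 1) * R := by
  have h : (PowerSeries.X : WeylHat n) ^ (r + 1) ∣ moyal F G - ∑ j ∈ Finset.range (r + 1),
      moyalCoeff j • (PowerSeries.X ^ j * bidiffL j F G) := by
    rw [PowerSeries.X_pow_dvd_iff]
    intro m hm
    rw [map_sub, coeff_moyal, map_sum, sub_eq_zero,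
      Finset.Nat.sum_antidiagonal_eq_sum_range_succ
        (fun i j => moyalCoeff i • PowerSeries.coeff j (bidiffL i F G))]
    have hsub : Finset.range m.succ ⊆ Finset.range (r + 1) := Finset.range_mono hm
    rw [← Finset.sum_subset hsub]
    · refine Finset.sum_congr rfl fun j hj => ?_
      have : j ≤ m := Nat.lt_succ_iff.mp (Finset.mem_range.mp hj)
      simp [PowerSeries.coeff_X_pow_mul', this]
    · intro j _ hj
      have : ¬ j ≤ m := fun h => hj (Finset.mem_range.mpr (Nat.lt_succ_iff.mpr h))
      simp [PowerSeries.coeff_X_pow_mul', this]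
  obtain ⟨R, hR⟩ := h
  exact ⟨R, by rw [← hR]; abel⟩

theorem coeff_sum_X_pow_mul_add (r : ℕ) (T : ℕ → WeylHat n) (R : WeylHat n) :
    PowerSeries.coeff r (∑ j ∈ Finset.range (r + 1), moyalCoeff j • (PowerSeries.X ^ j * T j)
      + PowerSeries.X ^ (r + 1) * R)
      = ∑ x ∈ Finset.HasAntidiagonal.antidiagonal r,
        moyalCoeff x.1 • PowerSeries.coeff x.2 (T x.1) := by
  rw [Finset.Nat.sum_antidiagonal_eq_sum_range_succ
    (fun i j => moyalCoeff i • PowerSeries.coeff j (T i)), map_add, map_sum]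
  rw [PowerSeries.coeff_X_pow_mul' R (r + 1) r]
  simp only [Nat.not_succ_le_self, if_false, add_zero]
  refine Finset.sum_congr rfl fun j hj => ?_
  have : j ≤ r := Nat.lt_succ_iff.mp (Finset.mem_range.mp hj)
  simp [PowerSeries.coeff_X_pow_mul', this]

theorem coeff_bidiffL_moyal_left (i r : ℕ) (F G H : WeylHat n) :
    PowerSeries.coeff r (bidiffL i (moyal F G) H)
      = ∑ x ∈ Finset.HasAntidiagonal.antidiagonal r,
        moyalCoeff x.1 • PowerSeries.coeff x.2 (bidiffL i (bidiffL x.1 F G) H) := by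
  obtain ⟨R, hR⟩ := exists_moyal_eq r F G
  rw [hR, ← coeff_sum_X_pow_mul_add r (fun j => bidiffL i (bidiffL j F G) H) (bidiffL i R H)]
  simp only [map_add, map_sum, LinearMap.add_apply, LinearMap.sum_apply, map_smul,
    LinearMap.smul_apply, bidiffL_X_pow_mul_left]

theorem coeff_bidiffL_moyal_right (i r : ℕ) (F G H : WeylHat n) :
    PowerSeries.coeff r (bidiffL i F (moyal G H))
      = ∑ x ∈ Finset.HasAntidiagonal.antidiagonal r,
        moyalCoeff x.1 • PowerSeries.coeff x.2 (bidiffL i F (bidiffL x.1 G H)) := by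
  obtain ⟨R, hR⟩ := exists_moyal_eq r G H
  rw [hR, ← coeff_sum_X_pow_mul_add r (fun j => bidiffL i F (bidiffL j G H)) (bidiffL i F R)]
  simp only [map_add, map_sum, map_smul, bidiffL_X_pow_mul_right]

theorem sum_antidiagonal_antidiagonal {M : Type*} [AddCommMonoid M] (N : ℕ)
    (f : ℕ → ℕ → ℕ → M) :
    ∑ x ∈ Finset.HasAntidiagonal.antidiagonal N, ∑ y ∈ Finset.HasAntidiagonal.antidiagonal x.2,
        f x.1 y.1 y.2
      = ∑ x ∈ Finset.HasAntidiagonal.antidiagonal N,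
        ∑ y ∈ Finset.HasAntidiagonal.antidiagonal x.1, f y.1 y.2 x.2 := by
  rw [Finset.sum_sigma', Finset.sum_sigma']
  refine Finset.sum_bij' (fun x _ => ⟨(x.1.1 + x.2.1, x.2.2), (x.1.1, x.2.1)⟩)
    (fun x _ => ⟨(x.2.1, x.2.2 + x.1.2), (x.2.2, x.1.2)⟩) ?_ ?_ ?_ ?_ ?_ <;>
  simp +contextual [Finset.mem_sigma, Finset.HasAntidiagonal.mem_antidiagonal] <;> grind

theorem moyal_assoc (F G H : WeylHat n) : moyal (moyal F G) H = moyal F (moyal G H) := by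
  ext1 N
  simp only [coeff_moyal, coeff_bidiffL_moyal_left, coeff_bidiffL_moyal_right, Finset.smul_sum,
    smul_smul]
  rw [sum_antidiagonal_antidiagonal N (fun i j s => (moyalCoeff i * moyalCoeff j) •
      PowerSeries.coeff s (bidiffL i (bidiffL j F G) H)),
    sum_antidiagonal_antidiagonal N (fun i j s => (moyalCoeff i * moyalCoeff j) •
      PowerSeries.coeff s (bidiffL i F (bidiffL j G H)))]
  refine Finset.sum_congr rfl fun x _ => ?_
  have h := congrArg (PowerSeries.coeff x.2) (sum_bidiffL_assoc x.1 F G H)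
  simpa only [map_sum, coeff_real_smul] using h

theorem moyal_sub_left (F F' G : WeylHat n) : moyal (F - F') G = moyal F G - moyal F' G := by
  ext1 m
  simp [coeff_moyal, smul_sub]

theorem moyal_sub_right (F G G' : WeylHat n) : moyal F (G - G') = moyal F G - moyal F G' := by
  ext1 m
  simp [coeff_moyal, smul_sub]

theorem moyal_X_mul_left (F G : WeylHat n) :
    moyal (PowerSeries.X * F) G = PowerSeries.X * moyal F G := by
  ext1 m
  have h (i : ℕ) := bidiffL_X_pow_mul_left i 1 F G
  simp only [pow_one] at h
  cases m with
  | zero => simp [coeff_moyal, h]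
  | succ m =>
    rw [PowerSeries.coeff_succ_X_mul, coeff_moyal, coeff_moyal, Finset.Nat.antidiagonal_succ',
      Finset.sum_cons, Finset.sum_map]
    simp [h, PowerSeries.coeff_succ_X_mul]

theorem moyal_X_mul_right (F G : WeylHat n) :
    moyal F (PowerSeries.X * G) = PowerSeries.X * moyal F G := by
  ext1 m
  have h (i : ℕ) := bidiffL_X_pow_mul_right i 1 F G
  simp only [pow_one] at h
  cases m with
  | zero => simp [coeff_moyal, h]
  | succ m =>
    rw [PowerSeries.coeff_succ_X_mul, coeff_moyal, coeff_moyal, Finset.Nat.antidiagonal_succ',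
      Finset.sum_cons, Finset.sum_map]
    simp [h, PowerSeries.coeff_succ_X_mul]

theorem X_sq_mul_bracket_bracket (F G H : WeylHat n) :
    PowerSeries.X * (PowerSeries.X * bracketL F (bracketL G H))
      = moyal F (moyal G H - moyal H G) - moyal (moyal G H - moyal H G) F := by
  simp only [bracketL_apply]
  rw [hbar_mul_bracket, mul_sub, ← moyal_X_mul_left (bracket G H), ← moyal_X_mul_right F,
    hbar_mul_bracket]

/-- After multiplication by `ħ²` this is the Jacobi identity for commutators of an associative
product, and `ħ` is not a zero divisor. -/
theorem bracketL_jacobi (F G H : WeylHat n) :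
    bracketL F (bracketL G H) = bracketL (bracketL F G) H + bracketL G (bracketL F H) := by
  rw [bracketL_swap H (bracketL F G)]
  apply PowerSeries.X_mul_cancel
  apply PowerSeries.X_mul_cancel
  simp only [mul_add, mul_neg, X_sq_mul_bracket_bracket, moyal_sub_left,
    moyal_sub_right, moyal_assoc]
  abel

end Algebra

/-! ## Filtrations and diagonal operators -/

section Filtration

variable {n : ℕ}

@[simp] theorem yDeg_zero : yDeg (0 : Var n →₀ ℕ) = 0 := by simp [yDeg]

@[simp] theorem pDeg_zero : pDeg (0 : Var n →₀ ℕ) = 0 := by simp [pDeg]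

@[simp] theorem yDeg_add (α β : Var n →₀ ℕ) : yDeg (α + β) = yDeg α + yDeg β := by
  simp [yDeg, Finset.sum_add_distrib]

@[simp] theorem pDeg_add (α β : Var n →₀ ℕ) : pDeg (α + β) = pDeg α + pDeg β := by
  simp [pDeg, Finset.sum_add_distrib]

@[simp] theorem yDeg_single_inl (a : Fin n) (m : ℕ) :
    yDeg (Finsupp.single (Sum.inl a) m : Var n →₀ ℕ) = m := by
  simp [yDeg, Finsupp.single_apply]

@[simp] theorem yDeg_single_inr (a : Fin n) (m : ℕ) :
    yDeg (Finsupp.single (Sum.inr a) m : Var n →₀ ℕ) = 0 := by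
  simp [yDeg]

@[simp] theorem pDeg_single_inl (a : Fin n) (m : ℕ) :
    pDeg (Finsupp.single (Sum.inl a) m : Var n →₀ ℕ) = 0 := by
  simp [pDeg]

@[simp] theorem pDeg_single_inr (a : Fin n) (m : ℕ) :
    pDeg (Finsupp.single (Sum.inr a) m : Var n →₀ ℕ) = m := by
  simp [pDeg, Finsupp.single_apply]

/-- All coefficients of `ħ^k (y,p)^α` with `A deg_y + B deg_p + C k < d` vanish. -/
def OrderGE (A B C d : ℤ) (F : WeylHat n) : Prop :=
  ∀ (α : Var n →₀ ℕ) (k : ℕ), A * yDeg α + B * pDeg α + C * k < d → wcoeff α k F = 0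

namespace OrderGE

variable {A B C d d' : ℤ} {F G : WeylHat n}

theorem zero : OrderGE A B C d (0 : WeylHat n) := fun _ _ _ => wcoeff_zero _ _

theorem mono (h : OrderGE A B C d F) (hd : d' ≤ d) : OrderGE A B C d' F :=
  fun α k hk => h α k (lt_of_lt_of_le hk hd)

theorem add (hF : OrderGE A B C d F) (hG : OrderGE A B C d G) : OrderGE A B C d (F + G) :=
  fun α k hk => by rw [wcoeff_add, hF α k hk, hG α k hk, add_zero]

theorem sub (hF : OrderGE A B C d F) (hG : OrderGE A B C d G) : OrderGE A B C d (F - G) :=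
  fun α k hk => by rw [wcoeff_sub, hF α k hk, hG α k hk, sub_zero]

theorem smul (r : ℝ) (hF : OrderGE A B C d F) : OrderGE A B C d (r • F) :=
  fun α k hk => by rw [wcoeff_smul, hF α k hk, mul_zero]

theorem sum {ι : Type*} {s : Finset ι} {F : ι → WeylHat n}
    (hF : ∀ i ∈ s, OrderGE A B C d (F i)) : OrderGE A B C d (∑ i ∈ s, F i) :=
  fun α k hk => by
    rw [wcoeff_sum]
    exact Finset.sum_eq_zero fun i hi => hF i hi α k hk

theorem mul (hF : OrderGE A B C d F) (hG : OrderGE A B C d' G) :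
    OrderGE A B C (d + d') (F * G) := fun α k hk => by
  rw [wcoeff_mul]
  refine Finset.sum_eq_zero fun x hx => Finset.sum_eq_zero fun y hy => ?_
  rw [Finset.HasAntidiagonal.mem_antidiagonal] at hx hy
  subst hx hy
  by_cases h : A * yDeg y.1 + B * pDeg y.1 + C * x.1 < d
  · rw [hF _ _ h, zero_mul]
  · rw [hG y.2 x.2, mul_zero]
    push_cast [yDeg_add, pDeg_add] at hk
    linarith

theorem wd_inl (a : Fin n) (hF : OrderGE A B C d F) :
    OrderGE A B C (d - A) (wd (Sum.inl a) F) := fun α k hk => by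
  rw [wcoeff_wd, hF, zero_mul]
  push_cast [yDeg_add, pDeg_add, yDeg_single_inl, pDeg_single_inl]
  linarith

theorem wd_inr (a : Fin n) (hF : OrderGE A B C d F) :
    OrderGE A B C (d - B) (wd (Sum.inr a) F) := fun α k hk => by
  rw [wcoeff_wd, hF, zero_mul]
  push_cast [yDeg_add, pDeg_add, yDeg_single_inr, pDeg_single_inr]
  linarith

theorem bidiffL (i : ℕ) (hF : OrderGE A B C d F) (hG : OrderGE A B C d' G) :
    OrderGE A B C (d + d' - i * (A + B)) (bidiffL i F G) := by
  induction i generalizing F G d d' with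
  | zero => simpa using hF.mul hG
  | succ i ih =>
    rw [bidiffL_succ]
    refine OrderGE.sum fun a _ => OrderGE.sub ?_ ?_
    · refine (ih (hF.wd_inl a) (hG.wd_inr a)).mono (le_of_eq ?_)
      push_cast
      ring
    · refine (ih (hF.wd_inr a) (hG.wd_inl a)).mono (le_of_eq ?_)
      push_cast
      ring

/-- The term with `i` contractions loses `i (A + B)` and carries `ħ^(i-1)`, which gains `(i-1) C`.
Under `A + B ≤ C` the worst case is therefore `i = 1`. Signed weights are allowed, so the same lemma
bounds the degree in `p` from above. -/
theorem bracketL (hC : A + B ≤ C) (hF : OrderGE A B C d F) (hG : OrderGE A B C d' G) :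
    OrderGE A B C (d + d' - (A + B)) (bracketL F G) := fun α k hk => by
  rw [bracketL_apply, wcoeff_bracket]
  refine Finset.sum_eq_zero fun x hx => ?_
  rw [Finset.HasAntidiagonal.mem_antidiagonal] at hx
  obtain ⟨i, j⟩ := x
  rcases i with _ | i
  · simp
  · rw [hF.bidiffL (i + 1) hG, mul_zero]
    have hj : (k : ℤ) = i + j := by
      have : k = i + j := by simp only at hx; omega
      exact_mod_cast this
    rw [hj] at hk
    have : (i : ℤ) * (A + B) ≤ i * C := mul_le_mul_of_nonneg_left hC (by positivity)
    push_cast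
    nlinarith

end OrderGE

theorem eq_of_forall_orderGE {F G : WeylHat n} (A B C : ℤ)
    (h : ∀ d, OrderGE A B C d (F - G)) : F = G :=
  weylHat_ext fun α k => sub_eq_zero.mp <| by
    rw [← wcoeff_sub]
    exact h _ α k (lt_add_one _)

/-! ### Operators acting diagonally on monomials -/

/-- The element with prescribed coefficients. -/
def ofCoeff (c : (Var n →₀ ℕ) → ℕ → ℝ) : WeylHat n :=
  PowerSeries.mk fun k => (fun α => c α k : MvPowerSeries (Var n) ℝ)

@[simp] theorem wcoeff_ofCoeff (c : (Var n →₀ ℕ) → ℕ → ℝ) (α : Var n →₀ ℕ) (k : ℕ) :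
    wcoeff α k (ofCoeff c) = c α k := by
  exact congrArg (MvPowerSeries.coeff α) (PowerSeries.coeff_mk k _)

/-- The operator multiplying the coefficient of `ħ^k (y,p)^α` by `φ deg_y deg_p k`. -/
def wdiag (φ : ℕ → ℕ → ℕ → ℝ) : WeylHat n →ₗ[ℝ] WeylHat n where
  toFun F := ofCoeff fun α k => φ (yDeg α) (pDeg α) k * wcoeff α k F
  map_add' F G := weylHat_ext fun α k => by simp [mul_add]
  map_smul' r F := weylHat_ext fun α k => by simp [mul_left_comm]

theorem wcoeff_wdiag (φ : ℕ → ℕ → ℕ → ℝ) (α : Var n →₀ ℕ) (k : ℕ) (F : WeylHat n) :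
    wcoeff α k (wdiag φ F) = φ (yDeg α) (pDeg α) k * wcoeff α k F := by
  simp [wdiag]

theorem OrderGE.wdiag {A B C d : ℤ} {F : WeylHat n} (φ : ℕ → ℕ → ℕ → ℝ)
    (hF : OrderGE A B C d F) : OrderGE A B C d (wdiag φ F) := fun α k hk => by
  rw [wcoeff_wdiag, hF α k hk, mul_zero]

/-! ## Fibre variables -/

/-- A fibre variable, as an element of the completed Weyl algebra. -/
def wvar (s : Var n) : WeylHat n := PowerSeries.C (MvPowerSeries.X s)

theorem wcoeff_C (α : Var n →₀ ℕ) (k : ℕ) (f : MvPowerSeries (Var n) ℝ) :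
    wcoeff α k (PowerSeries.C f : WeylHat n) = if k = 0 then MvPowerSeries.coeff α f else 0 := by
  rw [wcoeff, PowerSeries.coeff_C]
  split_ifs <;> simp

theorem wcoeff_wvar (s : Var n) (α : Var n →₀ ℕ) (k : ℕ) :
    wcoeff α k (wvar s) = if k = 0 ∧ α = Finsupp.single s 1 then 1 else 0 := by
  classical
  rw [wvar, wcoeff_C, MvPowerSeries.coeff_X]
  split_ifs <;> simp_all

theorem wcoeff_one (α : Var n →₀ ℕ) (k : ℕ) :
    wcoeff α k (1 : WeylHat n) = if k = 0 ∧ α = 0 then 1 else 0 := by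
  classical
  rw [← map_one PowerSeries.C, wcoeff_C, MvPowerSeries.coeff_one]
  split_ifs <;> simp_all

@[simp] theorem wd_wvar (s t : Var n) : wd s (wvar t) = if s = t then 1 else 0 := by
  classical
  ext1 k
  rw [coeff_wd, wvar, PowerSeries.coeff_C]
  split_ifs with h1 h2 h2
  · subst h1 h2; simp
  · subst h1
    rw [MvPowerSeries.pderiv_X_of_ne (Ne.symm h2)]; simp
  · subst h2
    simp [PowerSeries.coeff_one, h1]
  · simp

theorem wcoeff_wvar_mul (s : Var n) (α : Var n →₀ ℕ) (k : ℕ) (F : WeylHat n) :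
    wcoeff α k (wvar s * F)
      = if 1 ≤ α s then wcoeff (α - Finsupp.single s 1) k F else 0 := by
  classical
  rw [wvar, wcoeff, PowerSeries.coeff_C_mul, MvPowerSeries.coeff_mul]
  split_ifs with h
  · rw [Finset.sum_eq_single_of_mem (Finsupp.single s 1, α - Finsupp.single s 1)]
    · simp [MvPowerSeries.coeff_X, wcoeff]
    · rw [Finset.HasAntidiagonal.mem_antidiagonal]
      exact add_tsub_cancel_of_le (by simpa using h)
    · rintro ⟨β, γ⟩ hβ hne
      rw [Finset.HasAntidiagonal.mem_antidiagonal] at hβ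
      rw [MvPowerSeries.coeff_X]
      split_ifs with hb
      · exfalso
        refine hne ?_
        simp only at hb hβ
        subst hb
        simp [← hβ]
      · simp
  · refine Finset.sum_eq_zero fun x hx => ?_
    rw [Finset.HasAntidiagonal.mem_antidiagonal] at hx
    rw [MvPowerSeries.coeff_X]
    split_ifs with hb
    · exfalso
      apply h
      rw [← hx, hb]
      simp
    · simp

theorem OrderGE.wvar_inl (A B C : ℤ) (a : Fin n) : OrderGE A B C A (wvar (Sum.inl a)) := by
  intro α k hk
  rw [wcoeff_wvar, if_neg]
  rintro ⟨rfl, rfl⟩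
  simp at hk

theorem OrderGE.wvar_inr (A B C : ℤ) (a : Fin n) : OrderGE A B C B (wvar (Sum.inr a)) := by
  intro α k hk
  rw [wcoeff_wvar, if_neg]
  rintro ⟨rfl, rfl⟩
  simp at hk

/-- The Euler vector field of the variables `y`. -/
def eul : Derivation ℝ (WeylHat n) (WeylHat n) := ∑ a, wvar (Sum.inl a) • wd (Sum.inl a)

theorem eul_apply (F : WeylHat n) : eul F = ∑ a, wvar (Sum.inl a) * wd (Sum.inl a) F := by
  rw [eul, ← Derivation.coeFnAddMonoidHom_apply, map_sum, Finset.sum_apply]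
  rfl

theorem wcoeff_eul (α : Var n →₀ ℕ) (k : ℕ) (F : WeylHat n) :
    wcoeff α k (eul F) = yDeg α * wcoeff α k F := by
  rw [eul_apply, wcoeff_sum, yDeg, Nat.cast_sum, Finset.sum_mul]
  refine Finset.sum_congr rfl fun a _ => ?_
  rw [wcoeff_wvar_mul]
  split_ifs with h
  · rw [wcoeff_wd, tsub_add_cancel_of_le (by simpa using h)]
    have : ((α (Sum.inl a) - 1 : ℕ) : ℝ) = α (Sum.inl a) - 1 := by push_cast [h]; ring
    simp [this, mul_comm]
  · have : α (Sum.inl a) = 0 := by omega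
    simp [this]

/-- For `q` at most quadratic, orders three and higher vanish and orders zero and two cancel by
parity, so only the Poisson bracket remains. -/
theorem bracketL_eq_bidiffL_one {q : WeylHat n} (hq : ∀ r s t, wd r (wd s (wd t q)) = 0)
    (G : WeylHat n) : bracketL q G = bidiffL 1 q G := by
  have h3 (i : ℕ) : bidiffL (i + 3) q G = 0 := by simp [bidiffL_succ, hq]
  refine weylHat_ext fun α m => ?_
  rw [bracketL_apply, wcoeff_bracket, Finset.sum_eq_single_of_mem (1, m)]
  · simp
  · rw [Finset.HasAntidiagonal.mem_antidiagonal]; simp [add_comm]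
  · rintro ⟨i, j⟩ hx hne
    rw [Finset.HasAntidiagonal.mem_antidiagonal] at hx
    match i with
    | 0 => simp
    | 1 => exact absurd (by simp only at hx; simp; omega) hne
    | 2 => simp
    | i + 3 => simp [h3]

theorem bidiffL_one (F G : WeylHat n) : bidiffL 1 F G = ∑ a : Fin n,
    (wd (Sum.inl a) F * wd (Sum.inr a) G - wd (Sum.inr a) F * wd (Sum.inl a) G) := by
  rw [bidiffL_succ]
  rfl

@[simp] theorem bracketL_one (G : WeylHat n) : bracketL 1 G = 0 := by
  rw [bracketL_eq_bidiffL_one (by simp), bidiffL_one]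
  simp

theorem bracketL_wvar_inr (a : Fin n) (G : WeylHat n) :
    bracketL (wvar (Sum.inr a)) G = -wd (Sum.inl a) G := by
  rw [bracketL_eq_bidiffL_one (by intro r s t; rw [wd_wvar]; split_ifs <;> simp), bidiffL_one]
  rw [Finset.sum_eq_single_of_mem a (Finset.mem_univ _)]
  · simp
  · intro b _ hb
    simp [hb]

/-! ### Splitting off the terms of weight less than two -/

/-- The part of Fedosov degree zero and `ħ`-degree zero, together with a linear form in `p`. -/
def lowPart (r : ℝ) (v : Fin n → ℝ) : WeylHat n := r • 1 + ∑ a, v a • wvar (Sum.inr a)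

theorem bracketL_lowPart (r : ℝ) (v : Fin n → ℝ) (G : WeylHat n) :
    bracketL (lowPart r v) G = -∑ a, v a • wd (Sum.inl a) G := by
  simp [lowPart, bracketL_wvar_inr]

/-- The part of weight at least two, where `y`, `p` and `ħ` have weights `2`, `1` and `3`. -/
def highPart : WeylHat n →ₗ[ℝ] WeylHat n :=
  wdiag fun i j k => if 2 ≤ 2 * i + j + 3 * k then 1 else 0

theorem orderGE_highPart (F : WeylHat n) : OrderGE 2 1 3 2 (highPart F) := by
  intro α k hk
  rw [highPart, wcoeff_wdiag, if_neg, zero_mul]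
  omega

theorem eq_single_inr_of_degree {α : Var n →₀ ℕ} (hy : yDeg α = 0) (hp : pDeg α = 1) :
    ∃ a, α = Finsupp.single (Sum.inr a) 1 := by
  have hp' : ∃ a, α (Sum.inr a) ≠ 0 := by
    by_contra! h
    simp [pDeg, h] at hp
  obtain ⟨a, ha⟩ := hp'
  have hle : Finsupp.single (Sum.inr a) 1 ≤ α := by
    rw [Finsupp.single_le_iff]; omega
  obtain ⟨β, rfl⟩ := le_iff_exists_add.mp hle
  simp only [yDeg_add, pDeg_add, yDeg_single_inr, pDeg_single_inr] at hy hp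
  refine ⟨a, ?_⟩
  have : β = 0 := by
    ext s
    have hy' : yDeg β = 0 := by omega
    have hp' : pDeg β = 0 := by omega
    simp only [yDeg, pDeg, Finset.sum_eq_zero_iff, Finset.mem_univ, true_imp_iff] at hy' hp'
    rcases s with s | s <;> simp [hy', hp']
  simp [this]

theorem eq_zero_of_degree {α : Var n →₀ ℕ} (hy : yDeg α = 0) (hp : pDeg α = 0) : α = 0 := by
  ext s
  simp only [yDeg, pDeg, Finset.sum_eq_zero_iff, Finset.mem_univ, true_imp_iff] at hy hp
  rcases s with s | s <;> simp [hy, hp]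

theorem wcoeff_lowPart_zero (r : ℝ) (v : Fin n → ℝ) : wcoeff 0 0 (lowPart r v) = r := by
  simp only [lowPart, wcoeff_add, wcoeff_smul, wcoeff_one, wcoeff_sum, wcoeff_wvar]
  simp [eq_comm (a := (0 : Var n →₀ ℕ))]

theorem wcoeff_lowPart_inr (r : ℝ) (v : Fin n → ℝ) (a : Fin n) :
    wcoeff (Finsupp.single (Sum.inr a) 1) 0 (lowPart r v) = v a := by
  simp only [lowPart, wcoeff_add, wcoeff_smul, wcoeff_one, wcoeff_sum, wcoeff_wvar]
  simp [Finsupp.single_left_inj]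

theorem wcoeff_lowPart_of_two_le (r : ℝ) (v : Fin n → ℝ) {α : Var n →₀ ℕ} {k : ℕ}
    (h : 2 ≤ 2 * yDeg α + pDeg α + 3 * k) : wcoeff α k (lowPart r v) = 0 := by
  simp only [lowPart, wcoeff_add, wcoeff_smul, wcoeff_one, wcoeff_sum, wcoeff_wvar]
  rw [if_neg, Finset.sum_eq_zero]
  · simp
  · intro a _
    rw [if_neg, mul_zero]
    rintro ⟨rfl, rfl⟩
    simp at h
  · rintro ⟨rfl, rfl⟩
    simp at h

/-- Since `y` has weight `2` and `ħ` weight `3`, the only monomials of weight below `2` are `1` and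
the `p_a`. -/
theorem lowPart_add_highPart (F : WeylHat n) :
    lowPart (wcoeff 0 0 F) (fun a => wcoeff (Finsupp.single (Sum.inr a) 1) 0 F) + highPart F
      = F := by
  refine weylHat_ext fun α k => ?_
  rw [wcoeff_add, highPart, wcoeff_wdiag]
  by_cases h : 2 ≤ 2 * yDeg α + pDeg α + 3 * k
  · rw [wcoeff_lowPart_of_two_le _ _ h, if_pos h, one_mul, zero_add]
  · rw [if_neg h, zero_mul, add_zero]
    obtain rfl : k = 0 := by omega
    have hy : yDeg α = 0 := by omega
    rcases (by omega : pDeg α = 0 ∨ pDeg α = 1) with hp | hp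
    · obtain rfl := eq_zero_of_degree hy hp
      exact wcoeff_lowPart_zero _ _
    · obtain ⟨a, rfl⟩ := eq_single_inr_of_degree hy hp
      exact wcoeff_lowPart_inr _ _ _

end Filtration

/-! ## Smooth functions with values in the completed Weyl algebra -/

section Smooth

variable {n : ℕ}

/-- Coefficientwise smoothness. -/
def WSmoothOn (U : Set (E n)) (F : E n → WeylHat n) : Prop :=
  ∀ (α : Var n →₀ ℕ) (k : ℕ), ContDiffOn ℝ ∞ (fun u => wcoeff α k (F u)) U

/-- Coefficientwise differentiability at a point. -/
def WDiffAt (F : E n → WeylHat n) (u : E n) : Prop :=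
  ∀ (α : Var n →₀ ℕ) (k : ℕ), DifferentiableAt ℝ (fun v => wcoeff α k (F v)) u

theorem wcoeff_partialDeriv (μ : Fin n) (F : E n → WeylHat n) (u : E n) (α : Var n →₀ ℕ) (k : ℕ) :
    wcoeff α k (partialDeriv μ F u)
      = fderiv ℝ (fun v => wcoeff α k (F v)) u (EuclideanSpace.single μ 1) := by
  exact congrArg (MvPowerSeries.coeff α) (PowerSeries.coeff_mk k _)

variable {U : Set (E n)} {F G : E n → WeylHat n} {u : E n}

theorem WSmoothOn.wdiffAt (hF : WSmoothOn U F) (hU : IsOpen U) (hu : u ∈ U) : WDiffAt F u :=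
  fun α k => ((hF α k).contDiffAt (hU.mem_nhds hu)).differentiableAt (by simp)

theorem WSmoothOn.mono {V : Set (E n)} (hF : WSmoothOn U F) (h : V ⊆ U) : WSmoothOn V F :=
  fun α k => (hF α k).mono h

theorem wsmoothOn_const (F : WeylHat n) : WSmoothOn U fun _ => F := fun _ _ => contDiffOn_const

theorem WSmoothOn.add (hF : WSmoothOn U F) (hG : WSmoothOn U G) :
    WSmoothOn U fun u => F u + G u := fun α k => by
  simp only [wcoeff_add]; exact (hF α k).add (hG α k)

theorem WSmoothOn.sub (hF : WSmoothOn U F) (hG : WSmoothOn U G) :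
    WSmoothOn U fun u => F u - G u := fun α k => by
  simp only [wcoeff_sub]; exact (hF α k).sub (hG α k)

theorem WSmoothOn.smul {r : E n → ℝ} (hr : ContDiffOn ℝ ∞ r U) (hF : WSmoothOn U F) :
    WSmoothOn U fun u => r u • F u := fun α k => by
  simp only [wcoeff_smul]; exact hr.mul (hF α k)

theorem WSmoothOn.sum {ι : Type*} {s : Finset ι} {F : ι → E n → WeylHat n}
    (hF : ∀ i ∈ s, WSmoothOn U (F i)) : WSmoothOn U fun u => ∑ i ∈ s, F i u := fun α k => by
  simp only [wcoeff_sum]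
  exact ContDiffOn.sum fun i hi => hF i hi α k

theorem WSmoothOn.mul (hF : WSmoothOn U F) (hG : WSmoothOn U G) :
    WSmoothOn U fun u => F u * G u := fun α k => by
  simp only [wcoeff_mul]
  exact ContDiffOn.sum fun x _ => ContDiffOn.sum fun y _ => (hF _ _).mul (hG _ _)

theorem WSmoothOn.wd (s : Var n) (hF : WSmoothOn U F) : WSmoothOn U fun u => wd s (F u) :=
  fun α k => by
    simp only [wcoeff_wd]; exact (hF _ _).mul contDiffOn_const

theorem WSmoothOn.bidiffL (i : ℕ) (hF : WSmoothOn U F) (hG : WSmoothOn U G) :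
    WSmoothOn U fun u => bidiffL i (F u) (G u) := by
  induction i generalizing F G with
  | zero => exact hF.mul hG
  | succ i ih =>
    simp only [bidiffL_succ]
    exact WSmoothOn.sum fun a _ => (ih (hF.wd _) (hG.wd _)).sub (ih (hF.wd _) (hG.wd _))

theorem WSmoothOn.bracketL (hF : WSmoothOn U F) (hG : WSmoothOn U G) :
    WSmoothOn U fun u => bracketL (F u) (G u) := fun α k => by
  simp only [bracketL_apply, wcoeff_bracket]
  exact ContDiffOn.sum fun x _ => contDiffOn_const.mul (hF.bidiffL x.1 hG α x.2)

theorem WSmoothOn.wdiag (φ : ℕ → ℕ → ℕ → ℝ) (hF : WSmoothOn U F) :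
    WSmoothOn U fun u => wdiag φ (F u) := fun α k => by
  simp only [wcoeff_wdiag]; exact contDiffOn_const.mul (hF α k)

theorem WSmoothOn.partialDeriv (hU : IsOpen U) (μ : Fin n) (hF : WSmoothOn U F) :
    WSmoothOn U (partialDeriv μ F) := fun α k => by
  simp only [wcoeff_partialDeriv]
  exact ((hF α k).fderiv_of_isOpen hU (by simp)).clm_apply contDiffOn_const

theorem WDiffAt.wd (s : Var n) (hF : WDiffAt F u) : WDiffAt (fun v => wd s (F v)) u :=
  fun α k => by
    simp only [wcoeff_wd]; exact (hF _ _).mul_const _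

theorem WDiffAt.add (hF : WDiffAt F u) (hG : WDiffAt G u) : WDiffAt (fun v => F v + G v) u :=
  fun α k => by
    simp only [wcoeff_add]; exact (hF _ _).fun_add (hG _ _)

theorem WDiffAt.smul {r : E n → ℝ} (hr : DifferentiableAt ℝ r u) (hF : WDiffAt F u) :
    WDiffAt (fun v => r v • F v) u := fun α k => by
  simp only [wcoeff_smul]; exact hr.fun_mul (hF _ _)

theorem WDiffAt.sum {ι : Type*} {s : Finset ι} {F : ι → E n → WeylHat n}
    (hF : ∀ i ∈ s, WDiffAt (F i) u) : WDiffAt (fun v => ∑ i ∈ s, F i v) u := fun α k => by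
  simp only [wcoeff_sum]
  exact DifferentiableAt.fun_sum fun i hi => hF i hi α k

theorem WDiffAt.mul (hF : WDiffAt F u) (hG : WDiffAt G u) : WDiffAt (fun v => F v * G v) u :=
  fun α k => by
    simp only [wcoeff_mul]
    exact DifferentiableAt.fun_sum fun x _ => DifferentiableAt.fun_sum fun y _ =>
      (hF _ _).fun_mul (hG _ _)

theorem WDiffAt.bidiffL (i : ℕ) (hF : WDiffAt F u) (hG : WDiffAt G u) :
    WDiffAt (fun v => bidiffL i (F v) (G v)) u := by
  induction i generalizing F G with
  | zero => exact hF.mul hG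
  | succ i ih =>
    simp only [bidiffL_succ, sub_eq_add_neg, ← neg_one_smul ℝ (WeylBundle.bidiffL i _ _)]
    exact WDiffAt.sum fun a _ => (ih (hF.wd _) (hG.wd _)).add
      ((ih (hF.wd _) (hG.wd _)).smul (differentiableAt_const _))

theorem partialDeriv_congr {V : Set (E n)} (hV : IsOpen V) (hu : u ∈ V) (μ : Fin n)
    (h : ∀ v ∈ V, F v = G v) : partialDeriv μ F u = partialDeriv μ G u :=
  weylHat_ext fun α k => by
    rw [wcoeff_partialDeriv, wcoeff_partialDeriv]
    congr 1
    exact Filter.EventuallyEq.fderiv_eq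
      (Filter.eventually_of_mem (hV.mem_nhds hu) fun v hv => by simp only [h v hv])

@[simp] theorem partialDeriv_const (μ : Fin n) (F : WeylHat n) :
    partialDeriv μ (fun _ => F) u = 0 :=
  weylHat_ext fun α k => by simp [wcoeff_partialDeriv]

theorem partialDeriv_add (μ : Fin n) (hF : WDiffAt F u) (hG : WDiffAt G u) :
    partialDeriv μ (fun v => F v + G v) u = partialDeriv μ F u + partialDeriv μ G u :=
  weylHat_ext fun α k => by
    simp only [wcoeff_add, wcoeff_partialDeriv]
    rw [fderiv_fun_add (hF α k) (hG α k)]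
    rfl

theorem partialDeriv_sub (μ : Fin n) (hF : WDiffAt F u) (hG : WDiffAt G u) :
    partialDeriv μ (fun v => F v - G v) u = partialDeriv μ F u - partialDeriv μ G u :=
  weylHat_ext fun α k => by
    simp only [wcoeff_sub, wcoeff_partialDeriv]
    rw [fderiv_fun_sub (hF α k) (hG α k)]
    rfl

theorem partialDeriv_sum {ι : Type*} {s : Finset ι} {F : ι → E n → WeylHat n} (μ : Fin n)
    (hF : ∀ i ∈ s, WDiffAt (F i) u) :
    partialDeriv μ (fun v => ∑ i ∈ s, F i v) u = ∑ i ∈ s, partialDeriv μ (F i) u :=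
  weylHat_ext fun α k => by
    simp only [wcoeff_sum, wcoeff_partialDeriv]
    rw [fderiv_fun_sum fun i hi => hF i hi α k]
    simp

theorem partialDeriv_smul {r : E n → ℝ} (μ : Fin n) (hr : DifferentiableAt ℝ r u)
    (hF : WDiffAt F u) : partialDeriv μ (fun v => r v • F v) u
      = fderiv ℝ r u (EuclideanSpace.single μ 1) • F u + r u • partialDeriv μ F u :=
  weylHat_ext fun α k => by
    simp only [wcoeff_smul, wcoeff_add, wcoeff_partialDeriv]
    rw [fderiv_fun_mul hr (hF α k)]
    simp
    ring

theorem partialDeriv_mul (μ : Fin n) (hF : WDiffAt F u) (hG : WDiffAt G u) :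
    partialDeriv μ (fun v => F v * G v) u = partialDeriv μ F u * G u + F u * partialDeriv μ G u :=
  weylHat_ext fun α k => by
    simp only [wcoeff_mul, wcoeff_add, wcoeff_partialDeriv]
    rw [fderiv_fun_sum fun x _ => DifferentiableAt.fun_sum fun y _ => (hF _ _).fun_mul (hG _ _),
      sum_apply, ← Finset.sum_add_distrib]
    refine Finset.sum_congr rfl fun x _ => ?_
    rw [fderiv_fun_sum fun y _ => (hF _ _).fun_mul (hG _ _), sum_apply,
      ← Finset.sum_add_distrib]
    refine Finset.sum_congr rfl fun y _ => ?_
    rw [fderiv_fun_mul (hF _ _) (hG _ _)]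
    simp
    ring

theorem partialDeriv_wd (s : Var n) (μ : Fin n) (hF : WDiffAt F u) :
    partialDeriv μ (fun v => wd s (F v)) u = wd s (partialDeriv μ F u) :=
  weylHat_ext fun α k => by
    simp only [wcoeff_wd, wcoeff_partialDeriv]
    rw [fderiv_mul_const (hF _ _)]
    simp [mul_comm]

theorem partialDeriv_bidiffL (i : ℕ) (μ : Fin n) (hF : WDiffAt F u) (hG : WDiffAt G u) :
    partialDeriv μ (fun v => bidiffL i (F v) (G v)) u
      = bidiffL i (partialDeriv μ F u) (G u) + bidiffL i (F u) (partialDeriv μ G u) := by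
  induction i generalizing F G with
  | zero => exact partialDeriv_mul μ hF hG
  | succ i ih =>
    have hd (s t : Var n) := (hF.wd s).bidiffL i (hG.wd t)
    have hd' (a : Fin n) : WDiffAt (fun v => bidiffL i (wd (Sum.inl a) (F v)) (wd (Sum.inr a) (G v))
        - bidiffL i (wd (Sum.inr a) (F v)) (wd (Sum.inl a) (G v))) u := by
      simp only [sub_eq_add_neg, ← neg_one_smul ℝ (WeylBundle.bidiffL i _ _)]
      exact (hd _ _).add ((hd _ _).smul (differentiableAt_const _))
    simp only [bidiffL_succ]
    rw [partialDeriv_sum μ fun a _ => hd' a, ← Finset.sum_add_distrib]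
    refine Finset.sum_congr rfl fun a _ => ?_
    rw [partialDeriv_sub μ (hd _ _) (hd _ _), ih (hF.wd _) (hG.wd _), ih (hF.wd _) (hG.wd _)]
    simp only [partialDeriv_wd _ μ hF, partialDeriv_wd _ μ hG]
    abel

theorem partialDeriv_bracketL (μ : Fin n) (hF : WDiffAt F u) (hG : WDiffAt G u) :
    partialDeriv μ (fun v => bracketL (F v) (G v)) u
      = bracketL (partialDeriv μ F u) (G u) + bracketL (F u) (partialDeriv μ G u) :=
  weylHat_ext fun α k => by
    have h (x : ℕ × ℕ) := (hF.bidiffL x.1 hG) α x.2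
    simp only [wcoeff_add, bracketL_apply, wcoeff_bracket, wcoeff_partialDeriv]
    rw [fderiv_fun_sum fun x _ => (h x).const_mul _, sum_apply,
      ← Finset.sum_add_distrib]
    refine Finset.sum_congr rfl fun x _ => ?_
    rw [fderiv_const_mul (h x), smul_apply, ← wcoeff_partialDeriv,
      partialDeriv_bidiffL x.1 μ hF hG, wcoeff_add, smul_eq_mul, mul_add]

theorem partialDeriv_comm (hU : IsOpen U) (hu : u ∈ U) (hF : WSmoothOn U F) (μ ν : Fin n) :
    partialDeriv μ (partialDeriv ν F) u = partialDeriv ν (partialDeriv μ F) u :=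
  weylHat_ext fun α k => by
    simp only [wcoeff_partialDeriv]
    have hc : ContDiffAt ℝ ∞ (fun v => wcoeff α k (F v)) u := (hF α k).contDiffAt (hU.mem_nhds hu)
    have hd : DifferentiableAt ℝ (fderiv ℝ fun v => wcoeff α k (F v)) u :=
      (hc.fderiv_right (m := 1) (by norm_cast)).differentiableAt (by simp)
    rw [fderiv_clm_apply hd (differentiableAt_const _),
      fderiv_clm_apply hd (differentiableAt_const _)]
    have := hc.isSymmSndFDerivAt (by simp; exact WithTop.coe_le_coe.mpr le_top)
    simpa using this _ _

theorem OrderGE.partialDeriv {A B C d : ℤ} {V : Set (E n)} (hV : IsOpen V) (μ : Fin n)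
    (h : ∀ v ∈ V, OrderGE A B C d (F v)) (hu : u ∈ V) : OrderGE A B C d (partialDeriv μ F u) :=
  fun α k hk => by
    rw [wcoeff_partialDeriv]
    have : (fun v => wcoeff α k (F v)) =ᶠ[nhds u] fun _ => 0 :=
      Filter.eventually_of_mem (hV.mem_nhds hu) fun v hv => h v hv α k hk
    rw [this.fderiv_eq]
    simp

/-- Congruence of lower coefficients is preserved by partial derivatives. -/
theorem OrderGE.partialDeriv_sub {A B C d : ℤ} {V : Set (E n)} (hV : IsOpen V) (μ : Fin n)
    (h : ∀ v ∈ V, OrderGE A B C d (F v - G v)) (hu : u ∈ V) :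
    OrderGE A B C d (WeylBundle.partialDeriv μ F u - WeylBundle.partialDeriv μ G u) :=
  fun α k hk => by
    rw [wcoeff_sub, wcoeff_partialDeriv, wcoeff_partialDeriv]
    have : (fun v => wcoeff α k (F v)) =ᶠ[nhds u] fun v => wcoeff α k (G v) :=
      Filter.eventually_of_mem (hV.mem_nhds hu) fun v hv => by
        have := h v hv α k hk
        rwa [wcoeff_sub, sub_eq_zero] at this
    rw [this.fderiv_eq, sub_self]

end Smooth

section Local

variable {n : ℕ}

/-! ## Contracting maps for the weight filtration -/

theorem orderGE_of_nonpos {A B C d : ℤ} (hA : 0 ≤ A) (hB : 0 ≤ B) (hC : 0 ≤ C) (hd : d ≤ 0)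
    (F : WeylHat n) : OrderGE A B C d F := fun α k hk => by
  have h1 : 0 ≤ A * yDeg α := by positivity
  have h2 : 0 ≤ B * pDeg α := by positivity
  have h3 : 0 ≤ C * k := by positivity
  linarith

theorem orderGE_weight_zero (F : WeylHat n) : OrderGE 2 1 3 0 F :=
  orderGE_of_nonpos (by norm_num) (by norm_num) (by norm_num) le_rfl F

/-- All weights are nonnegative, so the hypothesis starts for free at `d = 0`. Induction then makes
the difference vanish to every order. -/
theorem eqOn_of_contracting {ι : Type*} {U : Set (E n)} {x y : ι → E n → WeylHat n}
    (h : ∀ d : ℤ, (∀ j, ∀ u ∈ U, OrderGE 2 1 3 d (x j u - y j u)) →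
      ∀ j, ∀ u ∈ U, OrderGE 2 1 3 (d + 1) (x j u - y j u)) :
    ∀ j, ∀ u ∈ U, x j u = y j u := by
  have key (d : ℕ) : ∀ j, ∀ u ∈ U, OrderGE 2 1 3 d (x j u - y j u) := by
    induction d with
    | zero => exact fun j u _ => orderGE_weight_zero _
    | succ d ih => exact_mod_cast h d ih
  intro j u hu
  exact eq_of_forall_orderGE 2 1 3 fun d => (key d.toNat j u hu).mono (Int.self_le_toNat d)

/-- Banach iteration from `0` in the weight topology. The bound `m` leaves room for quadratic maps,
which contract only on elements of high enough weight. The predicate `Q` transfers smoothness and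
degree bounds to the limit: each coefficient of the limit is literally a coefficient of some
iterate. -/
theorem exists_fixedPoint {ι : Type*} {U : Set (E n)} (m : ℤ)
    (Ψ : (ι → E n → WeylHat n) → ι → E n → WeylHat n)
    (hm : ∀ x, ∀ j, ∀ u ∈ U, OrderGE 2 1 3 m (Ψ x j u))
    (hΨ : ∀ x y, (∀ j, ∀ u ∈ U, OrderGE 2 1 3 m (x j u)) →
      (∀ j, ∀ u ∈ U, OrderGE 2 1 3 m (y j u)) → ∀ d : ℤ,
      (∀ j, ∀ u ∈ U, OrderGE 2 1 3 d (x j u - y j u)) →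
      ∀ j, ∀ u ∈ U, OrderGE 2 1 3 (d + 1) (Ψ x j u - Ψ y j u)) :
    ∃ x, (∀ j, ∀ u ∈ U, x j u = Ψ x j u) ∧
      ∀ Q : ι → (Var n →₀ ℕ) → ℕ → (E n → ℝ) → Prop, (∀ j α k, Q j α k fun _ => 0) →
        (∀ x, (∀ j α k, Q j α k fun u => wcoeff α k (x j u)) →
          ∀ j α k, Q j α k fun u => wcoeff α k (Ψ x j u)) →
        ∀ j α k, Q j α k fun u => wcoeff α k (x j u) := by
  set it : ℕ → ι → E n → WeylHat n := fun N => Ψ^[N] fun _ _ => 0 with hit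
  have it_succ (N : ℕ) : it (N + 1) = Ψ (it N) := Function.iterate_succ_apply' _ _ _
  have it_m (N : ℕ) : ∀ j, ∀ u ∈ U, OrderGE 2 1 3 m (it N j u) := by
    cases N with
    | zero => exact fun _ _ _ => OrderGE.zero
    | succ N => rw [it_succ]; exact hm _
  have it_step (N : ℕ) : ∀ j, ∀ u ∈ U, OrderGE 2 1 3 N (it (N + 1) j u - it N j u) := by
    induction N with
    | zero => exact fun j u _ => orderGE_weight_zero _
    | succ N ih =>
      rw [it_succ (N + 1), it_succ N]
      rw [it_succ] at ih
      exact_mod_cast hΨ (Ψ (it N)) (it N) (hm _) (it_m N) N ih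
  have it_le (N M : ℕ) : ∀ j, ∀ u ∈ U, OrderGE 2 1 3 N (it (N + M) j u - it N j u) := by
    induction M with
    | zero => intro j u _; simpa using OrderGE.zero
    | succ M ih =>
      intro j u hu
      have h := ((it_step (N + M) j u hu).mono (by push_cast; linarith)).add (ih j u hu)
      rwa [sub_add_sub_cancel] at h
  -- The `N`-th iterate is stable in weights below `N`, so a coefficient of weight `W` may be read
  -- off at step `W + 1`.
  set x : ι → E n → WeylHat n := fun j u => ofCoeff fun α k =>
    wcoeff α k (it (2 * yDeg α + pDeg α + 3 * k + 1) j u) with hx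
  have x_it (N : ℕ) : ∀ j, ∀ u ∈ U, OrderGE 2 1 3 N (x j u - it N j u) := by
    intro j u hu α k hk
    simp only [hx, wcoeff_sub, wcoeff_ofCoeff]
    obtain ⟨M, rfl⟩ : ∃ M, N = (2 * yDeg α + pDeg α + 3 * k + 1) + M :=
      Nat.exists_eq_add_of_le (by omega)
    have h := it_le (2 * yDeg α + pDeg α + 3 * k + 1) M j u hu α k (by push_cast; linarith)
    rw [wcoeff_sub] at h
    linarith
  have x_m : ∀ j, ∀ u ∈ U, OrderGE 2 1 3 m (x j u) := by
    intro j u hu α k hk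
    simp only [hx, wcoeff_ofCoeff]
    exact it_m _ j u hu α k hk
  refine ⟨x, ?_, ?_⟩
  · intro j u hu
    refine eq_of_forall_orderGE 2 1 3 fun d => ?_
    refine OrderGE.mono (d := ((d.toNat + 1 : ℕ) : ℤ)) ?_ ?_
    · have h1 := x_it (d.toNat + 1) j u hu
      have h2 := hΨ x (it d.toNat) x_m (it_m _) _ (x_it d.toNat) j u hu
      rw [← it_succ] at h2
      have h := h1.sub (h2.mono (by push_cast; linarith))
      rwa [sub_sub_sub_cancel_right] at h
    · have := Int.self_le_toNat d
      push_cast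
      linarith
  · intro Q h0 hQ j α k
    have h (N : ℕ) : ∀ j α k, Q j α k fun u => wcoeff α k (it N j u) := by
      induction N with
      | zero => intro j α k; simpa [hit] using h0 j α k
      | succ N ih => rw [it_succ]; exact hQ _ ih
    simpa only [hx, wcoeff_ofCoeff] using h _ j α k

/-! ## The frame attached to the vielbein -/

/-- The linear functions of `y` which form the frame dual to the vielbein. -/
def frameVec (M : Matrix (Fin n) (Fin n) ℝ) (μ : Fin n) : WeylHat n :=
  ∑ a, M⁻¹ μ a • wvar (Sum.inl a)

/-- The vertical vector field `e^b_ν ∂/∂y^b`. -/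
def vertical (M : Matrix (Fin n) (Fin n) ℝ) (ν : Fin n) : WeylHat n →ₗ[ℝ] WeylHat n :=
  ∑ b, M b ν • (wd (Sum.inl b)).toLinearMap

theorem vertical_apply (M : Matrix (Fin n) (Fin n) ℝ) (ν : Fin n) (F : WeylHat n) :
    vertical M ν F = ∑ b, M b ν • wd (Sum.inl b) F := by
  simp [vertical]

theorem vertical_mul (M : Matrix (Fin n) (Fin n) ℝ) (ν : Fin n) (F G : WeylHat n) :
    vertical M ν (F * G) = F * vertical M ν G + vertical M ν F * G := by
  simp only [vertical_apply, Derivation.leibniz, smul_eq_mul, smul_add, Finset.sum_add_distrib,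
    Finset.mul_sum, Finset.sum_mul, mul_smul_comm, smul_mul_assoc]
  congr 1
  exact Finset.sum_congr rfl fun b _ => by rw [mul_comm]

theorem OrderGE.frameVec (A B C : ℤ) (M : Matrix (Fin n) (Fin n) ℝ) (μ : Fin n) :
    OrderGE A B C A (frameVec M μ) :=
  OrderGE.sum fun a _ => (OrderGE.wvar_inl A B C a).smul _

theorem eul_frameVec (M : Matrix (Fin n) (Fin n) ℝ) (μ : Fin n) :
    eul (frameVec M μ) = frameVec M μ := by
  simp [frameVec, eul_apply]

/-- The vielbein and its inverse cancel, leaving `y^a ∂/∂y^a`. -/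
theorem sum_frameVec_mul_vertical {M : Matrix (Fin n) (Fin n) ℝ} (hM : IsUnit M.det)
    (F : WeylHat n) : ∑ μ, frameVec M μ * vertical M μ F = eul F := by
  have h (a b : Fin n) : ∑ μ, M⁻¹ μ a * M b μ = if b = a then 1 else 0 := by
    have := congrFun (congrFun (Matrix.mul_nonsing_inv M hM) b) a
    rw [Matrix.mul_apply, Matrix.one_apply] at this
    rw [← this]
    exact Finset.sum_congr rfl fun μ _ => mul_comm _ _
  simp only [frameVec, vertical_apply, Finset.sum_mul, Finset.mul_sum, smul_mul_smul_comm,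
    eul_apply]
  rw [Finset.sum_comm' (t' := Finset.univ) (s' := fun _ => Finset.univ) (by simp)]
  refine Finset.sum_congr rfl fun a _ => ?_
  rw [Finset.sum_comm]
  simp only [← Finset.sum_smul, h, ite_smul, one_smul, zero_smul]
  simp

theorem vertical_frameVec {M : Matrix (Fin n) (Fin n) ℝ} (hM : IsUnit M.det) (μ ν : Fin n) :
    vertical M ν (frameVec M μ) = if μ = ν then 1 else 0 := by
  have h : ∑ b, M⁻¹ μ b * M b ν = if μ = ν then 1 else 0 := by
    rw [← Matrix.mul_apply, Matrix.nonsing_inv_mul M hM, Matrix.one_apply]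
  have h' (b : Fin n) : wd (Sum.inl b) (frameVec M μ) = M⁻¹ μ b • 1 := by
    simp [frameVec]
  simp only [vertical_apply, h', smul_smul, ← Finset.sum_smul, mul_comm (M _ _), h, ite_smul,
    one_smul, zero_smul]

/-- Differentiating the relation `hB` along the vertical field `ν` hits either `B` or the frame,
which is dual to the vertical fields. This supplies the shift of the Euler operator by the form
degree. -/
theorem sum_frameVec_mul_vertical_apply {M : Matrix (Fin n) (Fin n) ℝ} (hM : IsUnit M.det)
    (B : Fin n → WeylHat n) (hB : ∑ μ, frameVec M μ * B μ = 0) (ν : Fin n) :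
    ∑ μ, frameVec M μ * vertical M ν (B μ) = -B ν := by
  have h := congrArg (vertical M ν) hB
  simp only [map_sum, vertical_mul, map_zero, Finset.sum_add_distrib, vertical_frameVec hM,
    ite_mul, one_mul, zero_mul, Finset.sum_ite_eq', Finset.mem_univ, if_true] at h
  exact eq_neg_of_add_eq_zero_left h

/-! ### Inverting the Euler operator -/

/-- The inverse of the Euler operator shifted by `c`. -/
def invEul (c : ℕ) : WeylHat n →ₗ[ℝ] WeylHat n := wdiag fun i _ _ => ((i : ℝ) + c)⁻¹

/-- The restriction to `y = 0`. -/
def yZero : WeylHat n →ₗ[ℝ] WeylHat n := wdiag fun i _ _ => if i = 0 then 1 else 0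

theorem eq_invEul_iff {c : ℕ} (hc : c ≠ 0) {F G : WeylHat n} :
    F = invEul c G ↔ eul F + (c : ℝ) • F = G := by
  have h (α : Var n →₀ ℕ) : (yDeg α : ℝ) + c ≠ 0 := by positivity
  constructor
  · rintro rfl
    refine weylHat_ext fun α k => ?_
    rw [wcoeff_add, wcoeff_eul, wcoeff_smul, invEul, wcoeff_wdiag, ← add_mul, mul_inv_cancel_left₀
      (h α)]
  · rintro rfl
    refine weylHat_ext fun α k => ?_
    rw [invEul, wcoeff_wdiag, wcoeff_add, wcoeff_eul, wcoeff_smul, ← add_mul,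
      inv_mul_cancel_left₀ (h α)]

/-- The unshifted Euler operator kills exactly the terms free of `y`. There `invEul 0` has the
factor `0⁻¹ = 0`, so `yZero` restores them without double counting. -/
theorem eq_yZero_add_invEul {F G : WeylHat n} (h : eul F = G) : F = yZero F + invEul 0 G := by
  subst h
  refine weylHat_ext fun α k => ?_
  rw [wcoeff_add, yZero, invEul, wcoeff_wdiag, wcoeff_wdiag, wcoeff_eul]
  by_cases h : yDeg α = 0
  · simp [h]
  · have : (yDeg α : ℝ) ≠ 0 := by exact_mod_cast h
    simp [h]

theorem eul_yZero (F : WeylHat n) : eul (yZero F) = 0 := by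
  refine weylHat_ext fun α k => ?_
  rw [wcoeff_eul, yZero, wcoeff_wdiag]
  by_cases h : yDeg α = 0 <;> simp [h]

theorem yZero_yZero (F : WeylHat n) : yZero (yZero F) = yZero F := by
  refine weylHat_ext fun α k => ?_
  rw [yZero, wcoeff_wdiag, wcoeff_wdiag]
  by_cases h : yDeg α = 0 <;> simp [h]

theorem yZero_invEul_zero (F : WeylHat n) : yZero (invEul 0 F) = 0 := by
  refine weylHat_ext fun α k => ?_
  rw [yZero, invEul, wcoeff_wdiag, wcoeff_wdiag]
  by_cases h : yDeg α = 0 <;> simp [h]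

theorem eul_invEul_zero {F : WeylHat n} (h : OrderGE 1 0 0 1 F) : eul (invEul 0 F) = F := by
  refine weylHat_ext fun α k => ?_
  rw [wcoeff_eul, invEul, wcoeff_wdiag]
  by_cases hα : yDeg α = 0
  · rw [h α k (by simp [hα])]; simp
  · have : (yDeg α : ℝ) ≠ 0 := by exact_mod_cast hα
    simp [this]

theorem eq_zero_of_eul_eq_zero {F : WeylHat n} (h : OrderGE 1 0 0 1 F) (hF : eul F = 0) :
    F = 0 := by
  refine weylHat_ext fun α k => ?_
  by_cases hα : yDeg α = 0
  · rw [h α k (by simp [hα])]; simp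
  · have h1 := wcoeff_eul α k F
    rw [hF, wcoeff_zero] at h1
    have : (yDeg α : ℝ) ≠ 0 := by exact_mod_cast hα
    simpa [this] using h1.symm

theorem orderGE_sum_frameVec_mul (M : Matrix (Fin n) (Fin n) ℝ) (B : Fin n → WeylHat n) :
    OrderGE 1 0 0 1 (∑ μ, frameVec M μ * B μ) :=
  OrderGE.sum fun μ _ => ((OrderGE.frameVec 1 0 0 M μ).mul
    (orderGE_of_nonpos zero_le_one le_rfl le_rfl le_rfl (B μ))).mono (by norm_num)

/-! ## Local connections -/

/-- The coefficients of `p_a` in a connection form. -/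
def localVielbein (Φ : E n → Fin n → WeylHat n) (u : E n) : Matrix (Fin n) (Fin n) ℝ :=
  Matrix.of fun a μ => wcoeff (Finsupp.single (Sum.inr a) 1) 0 (Φ u μ)

/-- The covariant derivative. -/
def nabla (Φ : E n → Fin n → WeylHat n) (μ : Fin n) (F : E n → WeylHat n) (u : E n) : WeylHat n :=
  partialDeriv μ F u + bracketL (Φ u μ) (F u)

/-- The part of the covariant derivative which does not lower the weight by two. -/
def nablaHigh (Φ : E n → Fin n → WeylHat n) (μ : Fin n) (F : E n → WeylHat n) (u : E n) :
    WeylHat n :=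
  partialDeriv μ F u + bracketL (highPart (Φ u μ)) (F u)

/-- The curvature. -/
def curv (Φ : E n → Fin n → WeylHat n) (μ ν : Fin n) (u : E n) : WeylHat n :=
  partialDeriv μ (fun v => Φ v ν) u - partialDeriv ν (fun v => Φ v μ) u
    + bracketL (Φ u μ) (Φ u ν)

/-- Constants are central and `p_a` acts as `-∂/∂y^a`, so the low part of the connection form
contributes exactly minus the vertical field. -/
theorem nabla_eq (Φ : E n → Fin n → WeylHat n) (μ : Fin n) (F : E n → WeylHat n) (u : E n) :
    nabla Φ μ F u = nablaHigh Φ μ F u - vertical (localVielbein Φ u) μ (F u) := by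
  have h : bracketL (Φ u μ) (F u)
      = bracketL (highPart (Φ u μ)) (F u) - vertical (localVielbein Φ u) μ (F u) := by
    conv_lhs => rw [← lowPart_add_highPart (Φ u μ)]
    rw [map_add, LinearMap.add_apply, bracketL_lowPart, vertical_apply]
    simp only [localVielbein, Matrix.of_apply]
    abel
  rw [nabla, nablaHigh, h]
  abel

theorem curv_swap (Φ : E n → Fin n → WeylHat n) (μ ν : Fin n) (u : E n) :
    curv Φ ν μ u = -curv Φ μ ν u := by
  rw [curv, curv, bracketL_swap (Φ u μ) (Φ u ν)]
  abel

variable {U V : Set (E n)} {Φ : E n → Fin n → WeylHat n} {u : E n}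

theorem sum_frameVec_mul_nabla (hM : IsUnit (localVielbein Φ u).det) (F : E n → WeylHat n) :
    ∑ μ, frameVec (localVielbein Φ u) μ * nabla Φ μ F u
      = ∑ μ, frameVec (localVielbein Φ u) μ * nablaHigh Φ μ F u - eul (F u) := by
  simp only [nabla_eq, mul_sub, Finset.sum_sub_distrib, sum_frameVec_mul_vertical hM]

/-- The Koszul homotopy formula on one-forms with vanishing contraction. The second vertical term
contributes the extra `B ν u`, so the Euler operator is shifted by `1`. -/
theorem sum_frameVec_mul_nabla_sub (hM : IsUnit (localVielbein Φ u).det)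
    (B : Fin n → E n → WeylHat n)
    (hB : ∑ μ, frameVec (localVielbein Φ u) μ * B μ u = 0) (ν : Fin n) :
    ∑ μ, frameVec (localVielbein Φ u) μ * (nabla Φ μ (B ν) u - nabla Φ ν (B μ) u)
      = ∑ μ, frameVec (localVielbein Φ u) μ * (nablaHigh Φ μ (B ν) u - nablaHigh Φ ν (B μ) u)
        - (eul (B ν u) + B ν u) := by
  have h1 := sum_frameVec_mul_vertical hM (B ν u)
  have h2 := sum_frameVec_mul_vertical_apply hM (fun μ => B μ u) hB ν
  simp only [nabla_eq, mul_sub, Finset.sum_sub_distrib, h1, h2]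
  abel

theorem WSmoothOn.nablaHigh (hU : IsOpen U) (hΦ : ∀ μ, WSmoothOn U fun u => Φ u μ)
    {F : E n → WeylHat n} (hF : WSmoothOn U F) (μ : Fin n) : WSmoothOn U (nablaHigh Φ μ F) :=
  (hF.partialDeriv hU μ).add (((hΦ μ).wdiag _).bracketL hF)

theorem WSmoothOn.curv (hU : IsOpen U) (hΦ : ∀ μ, WSmoothOn U fun u => Φ u μ) (μ ν : Fin n) :
    WSmoothOn U (curv Φ μ ν) :=
  (((hΦ ν).partialDeriv hU μ).sub ((hΦ μ).partialDeriv hU ν)).add ((hΦ μ).bracketL (hΦ ν))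

/-- Mixed partial derivatives cancel, and the Jacobi identity combines the two nested brackets into
one. -/
theorem nabla_nabla_sub (hU : IsOpen U) (hΦ : ∀ μ, WSmoothOn U fun u => Φ u μ)
    {F : E n → WeylHat n} (hF : WSmoothOn U F) (hu : u ∈ U) (μ ν : Fin n) :
    nabla Φ μ (nabla Φ ν F) u - nabla Φ ν (nabla Φ μ F) u = bracketL (curv Φ μ ν u) (F u) := by
  have h (μ ν : Fin n) : nabla Φ μ (nabla Φ ν F) u
      = partialDeriv μ (partialDeriv ν F) u + (bracketL (partialDeriv μ (fun v => Φ v ν) u) (F u)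
        + bracketL (Φ u ν) (partialDeriv μ F u)) + (bracketL (Φ u μ) (partialDeriv ν F u)
        + bracketL (Φ u μ) (bracketL (Φ u ν) (F u))) := by
    have h1 : partialDeriv μ (nabla Φ ν F) u
        = partialDeriv μ (fun v => partialDeriv ν F v + bracketL (Φ v ν) (F v)) u := rfl
    rw [nabla, h1, partialDeriv_add μ ((hF.partialDeriv hU ν).wdiffAt hU hu)
      (((hΦ ν).bracketL hF).wdiffAt hU hu), partialDeriv_bracketL μ ((hΦ ν).wdiffAt hU hu)
      (hF.wdiffAt hU hu), nabla, map_add]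
  rw [h μ ν, h ν μ, partialDeriv_comm hU hu hF μ ν, curv, map_add, map_sub, LinearMap.add_apply,
    LinearMap.sub_apply, bracketL_jacobi (Φ u μ) (Φ u ν)]
  abel

/-- Second derivatives cancel by symmetry, first-derivative terms by antisymmetry of the bracket,
and the cubic terms by the Jacobi identity. -/
theorem bianchi (hU : IsOpen U) (hΦ : ∀ μ, WSmoothOn U fun u => Φ u μ) (hu : u ∈ U)
    (l μ ν : Fin n) :
    nabla Φ l (curv Φ μ ν) u + nabla Φ μ (curv Φ ν l) u + nabla Φ ν (curv Φ l μ) u = 0 := by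
  have h (l μ ν : Fin n) : nabla Φ l (curv Φ μ ν) u
      = partialDeriv l (partialDeriv μ fun v => Φ v ν) u
        - partialDeriv l (partialDeriv ν fun v => Φ v μ) u
        + (bracketL (partialDeriv l (fun v => Φ v μ) u) (Φ u ν)
          + bracketL (Φ u μ) (partialDeriv l (fun v => Φ v ν) u))
        + (bracketL (Φ u l) (partialDeriv μ (fun v => Φ v ν) u)
          - bracketL (Φ u l) (partialDeriv ν (fun v => Φ v μ) u)
          + bracketL (Φ u l) (bracketL (Φ u μ) (Φ u ν))) := by
    have h1 : partialDeriv l (curv Φ μ ν) u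
        = partialDeriv l (fun w => (partialDeriv μ (fun v => Φ v ν) w
          - partialDeriv ν (fun v => Φ v μ) w) + bracketL (Φ w μ) (Φ w ν)) u := rfl
    have d (μ ν : Fin n) := ((hΦ μ).partialDeriv hU ν).wdiffAt hU hu
    have dΦ (μ : Fin n) := (hΦ μ).wdiffAt hU hu
    rw [nabla, h1, partialDeriv_add l ((((hΦ ν).partialDeriv hU μ).sub
      ((hΦ μ).partialDeriv hU ν)).wdiffAt hU hu) (((hΦ μ).bracketL (hΦ ν)).wdiffAt hU hu),
      partialDeriv_sub l (d _ _) (d _ _), partialDeriv_bracketL l (dΦ μ) (dΦ ν), curv, map_add,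
      map_sub]
  rw [h l μ ν, h μ ν l, h ν l μ, partialDeriv_comm hU hu (hΦ ν) l μ,
    partialDeriv_comm hU hu (hΦ μ) l ν, partialDeriv_comm hU hu (hΦ l) μ ν,
    bracketL_jacobi (Φ u l) (Φ u μ) (Φ u ν),
    bracketL_swap (bracketL (Φ u l) (Φ u μ)) (Φ u ν), bracketL_swap (Φ u l) (Φ u ν),
    bracketL_swap (Φ u ν) (partialDeriv l (fun v => Φ v μ) u),
    bracketL_swap (Φ u l) (partialDeriv μ (fun v => Φ v ν) u),
    bracketL_swap (Φ u μ) (partialDeriv ν (fun v => Φ v l) u)]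
  simp only [map_neg]
  abel

/-- Base derivatives preserve weight, and bracketing with weight at least `2` loses at most `3 - 2 =
1`. The frame, of weight `2`, then turns this loss into a gain of one. -/
theorem orderGE_nablaHigh_sub (hV : IsOpen V) {F G : E n → WeylHat n} {d : ℤ}
    (h : ∀ v ∈ V, OrderGE 2 1 3 d (F v - G v)) (hu : u ∈ V) (μ : Fin n) :
    OrderGE 2 1 3 (d - 1) (nablaHigh Φ μ F u - nablaHigh Φ μ G u) := by
  have h1 := (OrderGE.partialDeriv_sub hV μ h hu).mono (sub_le_self d zero_le_one)
  have h2 := ((orderGE_highPart (Φ u μ)).bracketL (by norm_num) (h u hu)).mono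
    (d' := d - 1) (by linarith)
  have h3 := h1.add h2
  rw [map_sub] at h3
  convert h3 using 1
  rw [nablaHigh, nablaHigh]
  abel

theorem orderGE_sum_frameVec_mul_of_orderGE {d : ℤ} (M : Matrix (Fin n) (Fin n) ℝ)
    {B : Fin n → WeylHat n} (hB : ∀ μ, OrderGE 2 1 3 (d - 1) (B μ)) :
    OrderGE 2 1 3 (d + 1) (∑ μ, frameVec M μ * B μ) :=
  OrderGE.sum fun μ _ => ((OrderGE.frameVec 2 1 3 M μ).mul (hB μ)).mono (by linarith)

theorem contDiffOn_det {ι : Type*} [Fintype ι] [DecidableEq ι] {M : E n → Matrix ι ι ℝ}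
    (hM : ∀ i j, ContDiffOn ℝ ∞ (fun u => M u i j) U) : ContDiffOn ℝ ∞ (fun u => (M u).det) U := by
  simp only [Matrix.det_apply]
  exact ContDiffOn.sum fun σ _ => (contDiffOn_prod fun i _ => hM _ _).const_smul _

theorem contDiffOn_inv {ι : Type*} [Fintype ι] [DecidableEq ι] {M : E n → Matrix ι ι ℝ}
    (hM : ∀ i j, ContDiffOn ℝ ∞ (fun u => M u i j) U) (hdet : ∀ u ∈ U, IsUnit (M u).det)
    (i j : ι) : ContDiffOn ℝ ∞ (fun u => (M u)⁻¹ i j) U := by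
  have h (u : E n) : (M u)⁻¹ i j = ((M u).det)⁻¹ * (M u).adjugate i j := by
    rw [Matrix.inv_def, Ring.inverse_eq_inv', Matrix.smul_apply, smul_eq_mul]
  simp only [h]
  refine ((contDiffOn_det hM).inv fun u hu => (hdet u hu).ne_zero).mul ?_
  simp only [Matrix.adjugate_apply]
  refine contDiffOn_det fun k l => ?_
  simp only [Matrix.updateRow_apply]
  split_ifs
  · exact contDiffOn_const
  · exact hM _ _

theorem WSmoothOn.frameVec (hΦ : ∀ μ, WSmoothOn U fun u => Φ u μ)
    (hM : ∀ u ∈ U, IsUnit (localVielbein Φ u).det) (μ : Fin n) :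
    WSmoothOn U fun u => frameVec (localVielbein Φ u) μ :=
  WSmoothOn.sum fun a _ => WSmoothOn.smul
    (contDiffOn_inv (fun i j => hΦ j (Finsupp.single (Sum.inr i) 1) 0) hM μ a)
    (wsmoothOn_const _)

theorem eq_yZero_add_of_nabla_eq_zero (hM : IsUnit (localVielbein Φ u).det)
    {F : E n → WeylHat n} (hF : ∀ μ, nabla Φ μ F u = 0) :
    F u = yZero (F u)
      + invEul 0 (∑ μ, frameVec (localVielbein Φ u) μ * nablaHigh Φ μ F u) := by
  apply eq_yZero_add_invEul
  have h := sum_frameVec_mul_nabla hM F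
  simp only [hF, mul_zero, Finset.sum_const_zero] at h
  exact (sub_eq_zero.mp h.symm).symm

/-- Covariantly constant functions are determined by their restriction to `y = 0`. -/
theorem eqOn_of_nabla_eq_zero (hV : IsOpen V) (hM : ∀ u ∈ V, IsUnit (localVielbein Φ u).det)
    {F G : E n → WeylHat n} (hF : ∀ u ∈ V, ∀ μ, nabla Φ μ F u = 0)
    (hG : ∀ u ∈ V, ∀ μ, nabla Φ μ G u = 0) (h0 : ∀ u ∈ V, yZero (F u) = yZero (G u)) :
    ∀ u ∈ V, F u = G u := by
  refine eqOn_of_contracting (ι := Unit) (x := fun _ => F) (y := fun _ => G) ?_ ()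
  intro d h _ u hu
  rw [eq_yZero_add_of_nabla_eq_zero (hM u hu) (hF u hu),
    eq_yZero_add_of_nabla_eq_zero (hM u hu) (hG u hu), h0 u hu, add_sub_add_left_eq_sub, ← map_sub,
    ← Finset.sum_sub_distrib]
  simp only [← mul_sub]
  exact (orderGE_sum_frameVec_mul_of_orderGE _ fun μ =>
    orderGE_nablaHigh_sub hV (h ()) hu μ).wdiag _

/-- A closed one-form whose contraction with the frame vanishes is zero. -/
theorem eq_zero_of_nabla_sub_eq_zero (hV : IsOpen V)
    (hM : ∀ u ∈ V, IsUnit (localVielbein Φ u).det) {B : Fin n → E n → WeylHat n}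
    (hB : ∀ u ∈ V, ∀ μ ν, nabla Φ μ (B ν) u - nabla Φ ν (B μ) u = 0)
    (h0 : ∀ u ∈ V, ∑ μ, frameVec (localVielbein Φ u) μ * B μ u = 0) :
    ∀ ν, ∀ u ∈ V, B ν u = 0 := by
  have hB' (ν : Fin n) (u : E n) (hu : u ∈ V) : B ν u = invEul 1
      (∑ μ, frameVec (localVielbein Φ u) μ
        * (nablaHigh Φ μ (B ν) u - nablaHigh Φ ν (B μ) u)) := by
    rw [eq_invEul_iff one_ne_zero, Nat.cast_one, one_smul]
    have h := sum_frameVec_mul_nabla_sub (hM u hu) B (h0 u hu) ν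
    simp only [hB u hu, mul_zero, Finset.sum_const_zero] at h
    exact (sub_eq_zero.mp h.symm).symm
  have hz (μ : Fin n) (u : E n) : nablaHigh Φ μ (fun _ => 0) u = 0 := by simp [nablaHigh]
  refine eqOn_of_contracting (y := fun _ _ => 0) ?_
  intro d h ν u hu
  rw [sub_zero, hB' ν u hu]
  refine (orderGE_sum_frameVec_mul_of_orderGE _ fun μ => ?_).wdiag _
  have h1 := (orderGE_nablaHigh_sub (Φ := Φ) hV (h ν) hu μ).sub
    (orderGE_nablaHigh_sub (Φ := Φ) hV (h μ) hu ν)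
  simpa only [hz, sub_zero] using h1

/-- Existence of covariantly constant functions with given restriction to `y = 0`. -/
theorem exists_nabla_eq_zero (hU : IsOpen U) (hΦ : ∀ μ, WSmoothOn U fun u => Φ u μ)
    (hM : ∀ u ∈ U, IsUnit (localVielbein Φ u).det) (hflat : ∀ u ∈ U, ∀ μ ν, curv Φ μ ν u = 0)
    {f : E n → WeylHat n} (hf : WSmoothOn U f) :
    ∃ F : E n → WeylHat n, WSmoothOn U F ∧ (∀ u ∈ U, ∀ μ, nabla Φ μ F u = 0) ∧
      (∀ u ∈ U, yZero (F u) = yZero (f u)) ∧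
      ∀ V ⊆ U, IsOpen V → ∀ N : ℤ, (∀ u ∈ V, OrderGE 0 (-1) 0 (-N) (f u)) →
        (∀ u ∈ V, ∀ μ, OrderGE 0 (-1) 0 (-1) (Φ u μ)) →
        ∀ u ∈ V, OrderGE 0 (-1) 0 (-N) (F u) := by
  -- The map is affine in `x`, so no lower weight bound beyond `0` is needed.
  obtain ⟨x, hx, hQ⟩ := exists_fixedPoint (ι := Unit) (U := U) 0
    (fun x _ u => yZero (f u)
      + invEul 0 (∑ μ, frameVec (localVielbein Φ u) μ * nablaHigh Φ μ (x ()) u))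
    (fun _ _ _ _ => orderGE_weight_zero _)
    (fun x y _ _ d h _ u hu => by
      rw [add_sub_add_left_eq_sub, ← map_sub, ← Finset.sum_sub_distrib]
      simp only [← mul_sub]
      exact (orderGE_sum_frameVec_mul_of_orderGE _ fun μ =>
        orderGE_nablaHigh_sub hU (h ()) hu μ).wdiag _)
  have hsm : WSmoothOn U (x ()) := by
    refine hQ (fun _ _ _ g => ContDiffOn ℝ ∞ g U) (fun _ _ _ => contDiffOn_const) ?_ ()
    intro y hy _
    have hy' : WSmoothOn U (y ()) := hy ()
    exact (hf.wdiag _).add (WSmoothOn.wdiag _ (WSmoothOn.sum fun μ _ =>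
      (WSmoothOn.frameVec hΦ hM μ).mul (hy'.nablaHigh hU hΦ μ)))
  -- The fixed-point equation only says that the contraction of `∇x` with the frame vanishes.
  -- Flatness is used afterwards to conclude that `∇x` itself is zero.
  have h0 : ∀ u ∈ U, ∑ μ, frameVec (localVielbein Φ u) μ * nabla Φ μ (x ()) u = 0 := by
    intro u hu
    rw [sum_frameVec_mul_nabla (hM u hu), sub_eq_zero]
    conv_rhs => rw [hx () u hu]
    rw [map_add, eul_yZero, zero_add, eul_invEul_zero (orderGE_sum_frameVec_mul _ _)]
  refine ⟨x (), hsm, fun u hu μ => ?_, fun u hu => ?_, ?_⟩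
  · refine eq_zero_of_nabla_sub_eq_zero hU hM (B := fun μ => nabla Φ μ (x ())) ?_ h0 μ u hu
    intro v hv μ ν
    rw [nabla_nabla_sub hU hΦ hsm hv, hflat v hv, map_zero, LinearMap.zero_apply]
  · rw [hx () u hu, map_add, yZero_yZero, yZero_invEul_zero, add_zero]
  -- With weights `0, -1, 0`, order at least `-N` means degree at most `N` in `p`. A connection form
  -- affine in `p` has order `-1`, so its bracket preserves this bound: `-1 - N - (-1) = -N`.
  · intro V hVU hV N hfN hΦN u hu α k hk
    refine hQ (fun _ α k g => 0 * (yDeg α : ℤ) + (-1) * pDeg α + 0 * k < -N → ∀ u ∈ V, g u = 0)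
      (fun _ _ _ _ _ _ => rfl) ?_ () α k hk u hu
    intro y hy _ α k hk u hu
    have hy' : ∀ v ∈ V, OrderGE 0 (-1) 0 (-N) (y () v) := fun v hv α k hk => hy () α k hk v hv
    refine (OrderGE.add ((hfN u hu).wdiag _) (OrderGE.wdiag _ (OrderGE.sum fun μ _ => ?_))) α k hk
    refine ((OrderGE.frameVec 0 (-1) 0 _ μ).mul (OrderGE.add
      (OrderGE.partialDeriv hV μ hy' hu) ?_)).mono (zero_add (-N)).ge
    exact (((hΦN u hu μ).wdiag _).bracketL (by norm_num) (hy' u hu)).mono (by linarith)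

end Local

section Fedosov

variable {n : ℕ} {U V : Set (E n)} {Φ : E n → Fin n → WeylHat n} {u : E n}
  {r s : Fin n → E n → WeylHat n}

/-! ## Flat extensions of a local connection -/

theorem curv_add (hΦ : ∀ μ, WDiffAt (fun u => Φ u μ) u) (hr : ∀ μ, WDiffAt (r μ) u)
    (μ ν : Fin n) : curv (fun u ν => Φ u ν + r ν u) μ ν u = curv Φ μ ν u
      + (nabla Φ μ (r ν) u - nabla Φ ν (r μ) u) + bracketL (r μ u) (r ν u) := by
  simp only [curv, nabla, partialDeriv_add _ (hΦ _) (hr _), map_add, LinearMap.add_apply]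
  rw [bracketL_swap (Φ u ν) (r μ u)]
  abel

/-- The right-hand side of Fedosov's equation for a flat extension. -/
def fedosovSource (Φ : E n → Fin n → WeylHat n) (r : Fin n → E n → WeylHat n) (ν : Fin n)
    (u : E n) : WeylHat n :=
  ∑ μ, frameVec (localVielbein Φ u) μ * (curv Φ μ ν u
    + (nablaHigh Φ μ (r ν) u - nablaHigh Φ ν (r μ) u) + bracketL (r μ u) (r ν u))

theorem sum_frameVec_mul_curv_add (hM : IsUnit (localVielbein Φ u).det)
    (hΦ : ∀ μ, WDiffAt (fun u => Φ u μ) u) (hr : ∀ μ, WDiffAt (r μ) u)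
    (h0 : ∑ μ, frameVec (localVielbein Φ u) μ * r μ u = 0) (ν : Fin n) :
    ∑ μ, frameVec (localVielbein Φ u) μ * curv (fun u ν => Φ u ν + r ν u) μ ν u
      = fedosovSource Φ r ν u - (eul (r ν u) + r ν u) := by
  have h := sum_frameVec_mul_nabla_sub hM r h0 ν
  simp only [curv_add hΦ hr, fedosovSource, mul_add _ (_ + _), mul_add _ (curv _ _ _ _),
    Finset.sum_add_distrib, h]
  abel

/-- The quadratic term contracts because one factor of each bracket has weight at least `2`; the
curvature of `Φ` cancels in the difference. -/
theorem orderGE_fedosovSource_sub (hV : IsOpen V)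
    (hr : ∀ j, ∀ u ∈ V, OrderGE 2 1 3 2 (r j u)) (hs : ∀ j, ∀ u ∈ V, OrderGE 2 1 3 2 (s j u))
    {d : ℤ} (h : ∀ j, ∀ u ∈ V, OrderGE 2 1 3 d (r j u - s j u)) (ν : Fin n) (hu : u ∈ V) :
    OrderGE 2 1 3 (d + 1) (fedosovSource Φ r ν u - fedosovSource Φ s ν u) := by
  rw [fedosovSource, fedosovSource, ← Finset.sum_sub_distrib]
  simp only [← mul_sub]
  refine orderGE_sum_frameVec_mul_of_orderGE _ fun μ => ?_
  have h1 := (orderGE_nablaHigh_sub (Φ := Φ) hV (h ν) hu μ).sub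
    (orderGE_nablaHigh_sub (Φ := Φ) hV (h μ) hu ν)
  have h2 : OrderGE 2 1 3 (d - 1) (bracketL (r μ u - s μ u) (r ν u)) :=
    ((h μ u hu).bracketL (by norm_num) (hr ν u hu)).mono (by linarith)
  have h3 : OrderGE 2 1 3 (d - 1) (bracketL (s μ u) (r ν u - s ν u)) :=
    ((hs μ u hu).bracketL (by norm_num) (h ν u hu)).mono (by linarith)
  have h4 := h1.add (h2.add h3)
  simp only [map_sub, LinearMap.sub_apply] at h4
  convert h4 using 1
  abel

/-- An antisymmetric array is contracted twice with the same commuting frame, so the sum equals its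
own negative. -/
theorem sum_frameVec_mul_fedosovSource (r : Fin n → E n → WeylHat n) (u : E n) :
    ∑ ν, frameVec (localVielbein Φ u) ν * fedosovSource Φ r ν u = 0 := by
  have hanti (μ ν : Fin n) : curv Φ ν μ u
      + (nablaHigh Φ ν (r μ) u - nablaHigh Φ μ (r ν) u) + bracketL (r ν u) (r μ u)
      = -(curv Φ μ ν u + (nablaHigh Φ μ (r ν) u - nablaHigh Φ ν (r μ) u)
        + bracketL (r μ u) (r ν u)) := by
    rw [curv_swap Φ μ ν, bracketL_swap (r μ u) (r ν u)]
    abel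
  have h : ∑ ν, frameVec (localVielbein Φ u) ν * fedosovSource Φ r ν u
      = -∑ ν, frameVec (localVielbein Φ u) ν * fedosovSource Φ r ν u := by
    conv_lhs => simp only [fedosovSource, Finset.mul_sum]
    rw [Finset.sum_comm]
    simp only [fedosovSource, Finset.mul_sum, ← Finset.sum_neg_distrib]
    refine Finset.sum_congr rfl fun μ _ => Finset.sum_congr rfl fun ν _ => ?_
    rw [hanti ν μ]
    ring
  refine weylHat_ext fun α k => ?_
  have h' := congrArg (wcoeff α k) h
  rw [wcoeff_neg] at h'
  rw [wcoeff_zero]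
  linarith

/-- A flat connection is determined by its part of weight less than two and a normalization. -/
theorem eqOn_of_curv_add_eq_zero (hV : IsOpen V) (hM : ∀ u ∈ V, IsUnit (localVielbein Φ u).det)
    (hΦ : ∀ μ, WSmoothOn V fun u => Φ u μ)
    (hrs : ∀ μ, WSmoothOn V (r μ)) (hss : ∀ μ, WSmoothOn V (s μ))
    (hr : ∀ j, ∀ u ∈ V, OrderGE 2 1 3 2 (r j u)) (hs : ∀ j, ∀ u ∈ V, OrderGE 2 1 3 2 (s j u))
    (hr0 : ∀ u ∈ V, ∑ μ, frameVec (localVielbein Φ u) μ * r μ u = 0)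
    (hs0 : ∀ u ∈ V, ∑ μ, frameVec (localVielbein Φ u) μ * s μ u = 0)
    (hrf : ∀ u ∈ V, ∀ μ ν, curv (fun u ν => Φ u ν + r ν u) μ ν u = 0)
    (hsf : ∀ u ∈ V, ∀ μ ν, curv (fun u ν => Φ u ν + s ν u) μ ν u = 0) :
    ∀ ν, ∀ u ∈ V, r ν u = s ν u := by
  have key (t : Fin n → E n → WeylHat n) (hts : ∀ μ, WSmoothOn V (t μ))
      (ht0 : ∀ u ∈ V, ∑ μ, frameVec (localVielbein Φ u) μ * t μ u = 0)
      (htf : ∀ u ∈ V, ∀ μ ν, curv (fun u ν => Φ u ν + t ν u) μ ν u = 0) (ν : Fin n) (u : E n)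
      (hu : u ∈ V) : t ν u = invEul 1 (fedosovSource Φ t ν u) := by
    rw [eq_invEul_iff one_ne_zero, Nat.cast_one, one_smul]
    have h := sum_frameVec_mul_curv_add (hM u hu) (fun μ => (hΦ μ).wdiffAt hV hu)
      (fun μ => (hts μ).wdiffAt hV hu) (ht0 u hu) ν
    simp only [htf u hu, mul_zero, Finset.sum_const_zero] at h
    exact (sub_eq_zero.mp h.symm).symm
  refine eqOn_of_contracting fun d h ν u hu => ?_
  rw [key r hrs hr0 hrf ν u hu, key s hss hs0 hsf ν u hu, ← map_sub]
  exact (orderGE_fedosovSource_sub hV hr hs h ν hu).wdiag _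

/-- A closed antisymmetric two-form whose contraction with the frame vanishes is zero. -/
theorem eq_zero_of_nabla_cyclic_eq_zero (hV : IsOpen V)
    (hM : ∀ u ∈ V, IsUnit (localVielbein Φ u).det) {K : Fin n → Fin n → E n → WeylHat n}
    (hanti : ∀ μ ν u, K ν μ u = -K μ ν u)
    (hK : ∀ u ∈ V, ∀ l μ ν, nabla Φ l (K μ ν) u + nabla Φ μ (K ν l) u + nabla Φ ν (K l μ) u = 0)
    (h0 : ∀ u ∈ V, ∀ ν, ∑ μ, frameVec (localVielbein Φ u) μ * K μ ν u = 0) :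
    ∀ μ ν, ∀ u ∈ V, K μ ν u = 0 := by
  have h0' (u : E n) (hu : u ∈ V) (ν : Fin n) :
      ∑ μ, frameVec (localVielbein Φ u) μ * K ν μ u = 0 := by
    simp only [hanti _ ν, mul_neg, Finset.sum_neg_distrib, h0 u hu, neg_zero]
  have hK' (μ ν : Fin n) (u : E n) (hu : u ∈ V) : K μ ν u = invEul 2
      (∑ l, frameVec (localVielbein Φ u) l
        * (nablaHigh Φ l (K μ ν) u + nablaHigh Φ μ (K ν l) u + nablaHigh Φ ν (K l μ) u)) := by
    rw [eq_invEul_iff two_ne_zero]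
    have h1 := sum_frameVec_mul_vertical (hM u hu) (K μ ν u)
    have h2 := sum_frameVec_mul_vertical_apply (hM u hu) (fun l => K ν l u) (h0' u hu ν) μ
    have h3 := sum_frameVec_mul_vertical_apply (hM u hu) (fun l => K l μ u) (h0 u hu μ) ν
    have h4 : ∑ l, frameVec (localVielbein Φ u) l
        * (nabla Φ l (K μ ν) u + nabla Φ μ (K ν l) u + nabla Φ ν (K l μ) u) = 0 :=
      Finset.sum_eq_zero fun l _ => by rw [hK u hu, mul_zero]
    simp only [nabla_eq, mul_add, mul_sub, Finset.sum_add_distrib, Finset.sum_sub_distrib, h1, h2,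
      h3, hanti μ ν] at h4
    simp only [mul_add, Finset.sum_add_distrib]
    rw [Nat.cast_ofNat, two_smul, ← sub_eq_zero, ← neg_eq_zero]
    rw [← h4]
    abel
  -- Comparison with the zero two-form: the homogeneous fixed-point equation `hK'` has only the
  -- trivial solution.
  have hz (μ : Fin n) (u : E n) : nablaHigh Φ μ (fun _ => 0) u = 0 := by simp [nablaHigh]
  have := eqOn_of_contracting (ι := Fin n × Fin n) (U := V) (x := fun j => K j.1 j.2)
    (y := fun _ _ => 0) ?_
  · exact fun μ ν => this (μ, ν)
  · rintro d h ⟨μ, ν⟩ u hu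
    rw [sub_zero, hK' μ ν u hu]
    refine (orderGE_sum_frameVec_mul_of_orderGE _ fun l => ?_).wdiag _
    have h1 := ((orderGE_nablaHigh_sub (Φ := Φ) hV (h (μ, ν)) hu l).add
      (orderGE_nablaHigh_sub (Φ := Φ) hV (h (ν, l)) hu μ)).add
      (orderGE_nablaHigh_sub (Φ := Φ) hV (h (l, μ)) hu ν)
    simpa only [hz, sub_zero] using h1

theorem WSmoothOn.fedosovSource (hU : IsOpen U) (hΦ : ∀ μ, WSmoothOn U fun u => Φ u μ)
    (hM : ∀ u ∈ U, IsUnit (localVielbein Φ u).det) (hr : ∀ μ, WSmoothOn U (r μ)) (ν : Fin n) :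
    WSmoothOn U (fedosovSource Φ r ν) :=
  WSmoothOn.sum fun μ _ => (WSmoothOn.frameVec hΦ hM μ).mul
    (((WSmoothOn.curv hU hΦ μ ν).add (((hr ν).nablaHigh hU hΦ μ).sub
      ((hr μ).nablaHigh hU hΦ ν))).add ((hr μ).bracketL (hr ν)))

theorem localVielbein_add_of_orderGE (hr : ∀ j, OrderGE 2 1 3 2 (r j u)) :
    localVielbein (fun u ν => Φ u ν + r ν u) u = localVielbein Φ u := by
  ext a μ
  simp [localVielbein, hr μ (Finsupp.single (Sum.inr a) 1) 0 (by simp)]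

/-- Fedosov's construction of a flat connection with a given part of low weight. -/
theorem exists_curv_add_eq_zero (hU : IsOpen U) (hΦ : ∀ μ, WSmoothOn U fun u => Φ u μ)
    (hM : ∀ u ∈ U, IsUnit (localVielbein Φ u).det) :
    ∃ r : Fin n → E n → WeylHat n, (∀ μ, WSmoothOn U (r μ)) ∧
      (∀ μ, ∀ u ∈ U, OrderGE 2 1 3 2 (r μ u)) ∧
      (∀ u ∈ U, ∑ μ, frameVec (localVielbein Φ u) μ * r μ u = 0) ∧
      (∀ u ∈ U, ∀ μ ν, curv (fun u ν => Φ u ν + r ν u) μ ν u = 0) ∧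
      ∀ B C d : ℤ, B ≤ C → B ≤ d → (∀ u ∈ U, ∀ μ, OrderGE 0 B C d (Φ u μ)) →
        ∀ μ, ∀ u ∈ U, OrderGE 0 B C d (r μ u) := by
  obtain ⟨r, hr, hQ⟩ := exists_fixedPoint (ι := Fin n) (U := U) 2
    (fun r ν u => invEul 1 (fedosovSource Φ r ν u))
    (fun x ν u hu => OrderGE.wdiag _ <| OrderGE.sum fun μ _ =>
      ((OrderGE.frameVec 2 1 3 _ μ).mul (orderGE_weight_zero _)).mono (by norm_num))
    (fun x y hx hy d h ν u hu => by
      rw [← map_sub]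
      exact (orderGE_fedosovSource_sub hU hx hy h ν hu).wdiag _)
  have hsm : ∀ μ, WSmoothOn U (r μ) := by
    refine hQ (fun _ _ _ g => ContDiffOn ℝ ∞ g U) (fun _ _ _ => contDiffOn_const) ?_
    intro y hy ν
    exact WSmoothOn.wdiag _ (WSmoothOn.fedosovSource hU hΦ hM hy ν)
  have hr2 : ∀ μ, ∀ u ∈ U, OrderGE 2 1 3 2 (r μ u) := by
    intro ν u hu
    rw [hr ν u hu]
    exact OrderGE.wdiag _ <| OrderGE.sum fun μ _ =>
      ((OrderGE.frameVec 2 1 3 _ μ).mul (orderGE_weight_zero _)).mono (by norm_num)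
  have heul : ∀ ν, ∀ u ∈ U, eul (r ν u) + r ν u = fedosovSource Φ r ν u := by
    intro ν u hu
    have h := (eq_invEul_iff one_ne_zero).mp (hr ν u hu)
    rwa [Nat.cast_one, one_smul] at h
  -- The normalization is automatic. The frame has Euler degree one, so the Euler operator turns
  -- this contraction into that of the source, which is zero; and the contraction has no term free
  -- of `y`.
  have h0 : ∀ u ∈ U, ∑ μ, frameVec (localVielbein Φ u) μ * r μ u = 0 := by
    intro u hu
    refine eq_zero_of_eul_eq_zero (orderGE_sum_frameVec_mul _ _) ?_
    rw [← sum_frameVec_mul_fedosovSource r u, map_sum]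
    refine Finset.sum_congr rfl fun ν _ => ?_
    rw [Derivation.leibniz, eul_frameVec, ← heul ν u hu, smul_eq_mul, smul_eq_mul]
    ring
  have h1 : ∀ u ∈ U, ∀ ν, ∑ μ, frameVec (localVielbein Φ u) μ
      * curv (fun u ν => Φ u ν + r ν u) μ ν u = 0 := by
    intro u hu ν
    rw [sum_frameVec_mul_curv_add (hM u hu) (fun μ => (hΦ μ).wdiffAt hU hu)
      (fun μ => (hsm μ).wdiffAt hU hu) (h0 u hu), heul ν u hu, sub_self]
  have hV : ∀ u ∈ U, localVielbein (fun u ν => Φ u ν + r ν u) u = localVielbein Φ u :=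
    fun u hu => localVielbein_add_of_orderGE fun μ => hr2 μ u hu
  refine ⟨r, hsm, hr2, h0, fun u hu μ ν => ?_, ?_⟩
  -- The remaining curvature is closed by Bianchi for the full connection, whose vielbein is that of
  -- `Φ` because `r` has weight at least `2`.
  · refine eq_zero_of_nabla_cyclic_eq_zero (Φ := fun u ν => Φ u ν + r ν u) hU
      (fun v hv => by rw [hV v hv]; exact hM v hv) (fun μ ν v => curv_swap _ μ ν v)
      (fun v hv l μ ν => bianchi hU (fun μ => (hΦ μ).add (hsm μ)) hv l μ ν)
      (fun v hv ν => by rw [hV v hv]; exact h1 v hv ν) μ ν u hu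
  -- The bracket costs `B` when `y` has weight `0`, so `B ≤ d` makes this order bound stable under
  -- brackets; the frame costs nothing.
  · intro B C d hBC hBd hd μ u hu α k hk
    refine hQ (fun _ α k g => 0 * (yDeg α : ℤ) + B * pDeg α + C * k < d → ∀ u ∈ U, g u = 0)
      (fun _ _ _ _ _ _ => rfl) ?_ μ α k hk u hu
    intro y hy ν α k hk u hu
    have hy' : ∀ μ, ∀ v ∈ U, OrderGE 0 B C d (y μ v) := fun μ v hv α k hk => hy μ α k hk v hv
    have hbr {F G : WeylHat n} (hF : OrderGE 0 B C d F) (hG : OrderGE 0 B C d G) :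
        OrderGE 0 B C d (bracketL F G) := (hF.bracketL (by linarith) hG).mono (by linarith)
    have hnab (μ ν : Fin n) : OrderGE 0 B C d (nablaHigh Φ μ (y ν) u) :=
      (OrderGE.partialDeriv hU μ (hy' ν) hu).add (hbr ((hd u hu μ).wdiag _) (hy' ν u hu))
    have hcurv (μ ν : Fin n) : OrderGE 0 B C d (curv Φ μ ν u) :=
      ((OrderGE.partialDeriv hU μ (fun v hv => hd v hv ν) hu).sub
        (OrderGE.partialDeriv hU ν (fun v hv => hd v hv μ) hu)).add (hbr (hd u hu μ) (hd u hu ν))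
    refine (OrderGE.wdiag _ (OrderGE.sum fun μ _ => ?_)) α k hk
    exact ((OrderGE.frameVec 0 B C _ μ).mul (((hcurv μ ν).add
      ((hnab μ ν).sub (hnab ν μ))).add (hbr (hy' μ u hu) (hy' ν u hu)))).mono (zero_add d).ge

end Fedosov

section FibreChange

variable {n : ℕ} (J K : Matrix (Fin n) (Fin n) ℝ)

/-! ## Linear changes of the fibre variables -/

/-- The linear change of variables as a homomorphism for the commutative product. -/
def fibreHom : WeylHat n →ₐ[ℝ] WeylHat n where
  toFun := fibreChange J K
  map_one' := by
    ext1 k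
    rw [fibreChange, PowerSeries.coeff_mk, ← MvPowerSeries.substAlgHom_apply
      (hasSubst_linearSubst J K), PowerSeries.coeff_one]
    split_ifs
    · exact map_one _
    · exact map_zero _
  map_mul' F G := by
    ext1 k
    simp only [fibreChange, PowerSeries.coeff_mk, PowerSeries.coeff_mul,
      ← MvPowerSeries.substAlgHom_apply (hasSubst_linearSubst J K), map_sum, map_mul]
  map_zero' := by
    ext1 k
    rw [fibreChange, PowerSeries.coeff_mk, ← MvPowerSeries.substAlgHom_apply
      (hasSubst_linearSubst J K), map_zero, map_zero]
  map_add' := fibreChange_add J K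
  commutes' r := by
    ext1 k
    rw [fibreChange, PowerSeries.coeff_mk, ← MvPowerSeries.substAlgHom_apply
      (hasSubst_linearSubst J K), Algebra.algebraMap_eq_smul_one, coeff_real_smul, map_smul,
      PowerSeries.coeff_one]
    split_ifs
    · rw [map_one]
    · rw [map_zero]

theorem fibreHom_apply (F : WeylHat n) : fibreHom J K F = fibreChange J K F := rfl

theorem coeff_fibreHom (k : ℕ) (F : WeylHat n) : PowerSeries.coeff k (fibreHom J K F)
    = MvPowerSeries.substAlgHom (hasSubst_linearSubst J K) (PowerSeries.coeff k F) := by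
  rw [MvPowerSeries.substAlgHom_apply, fibreHom_apply, fibreChange, PowerSeries.coeff_mk]

/-- The images of the fibre variables under the linear change. -/
def linVar : Var n → WeylHat n
  | Sum.inl a => ∑ b, J a b • wvar (Sum.inl b)
  | Sum.inr a => ∑ b, K b a • wvar (Sum.inr b)

theorem C_linearSubst (s : Var n) : PowerSeries.C (linearSubst J K s) = linVar J K s := by
  have h (r : ℝ) (f : MvPowerSeries (Var n) ℝ) :
      (PowerSeries.C (r • f) : WeylHat n) = r • PowerSeries.C f := by
    ext1 k
    rw [coeff_real_smul, PowerSeries.coeff_C, PowerSeries.coeff_C]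
    split_ifs <;> simp
  rcases s with a | a <;> simp [linearSubst, linVar, wvar, h]

@[simp] theorem fibreHom_wvar (s : Var n) : fibreHom J K (wvar s) = linVar J K s := by
  rw [← C_linearSubst]
  ext1 k
  rw [coeff_fibreHom, wvar, PowerSeries.coeff_C, PowerSeries.coeff_C]
  split_ifs
  · exact MvPowerSeries.substAlgHom_X _ s
  · exact map_zero _

/-- The image of a monomial under the linear change. -/
def linMono (β : Var n →₀ ℕ) : WeylHat n := ∏ s, linVar J K s ^ β s

/-- The set of monomials of a given degree in the fibre variables. -/
def degSet (N : ℕ) : Finset (Var n →₀ ℕ) := Finset.finsuppAntidiag Finset.univ N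

theorem mem_degSet {N : ℕ} {β : Var n →₀ ℕ} : β ∈ degSet N ↔ yDeg β + pDeg β = N := by
  simp [degSet, yDeg, pDeg]

theorem OrderGE.one {A B C : ℤ} : OrderGE A B C 0 (1 : WeylHat n) := fun α k hk => by
  rw [wcoeff_one, if_neg]
  rintro ⟨rfl, rfl⟩
  simp at hk

theorem OrderGE.pow {A B C d : ℤ} {F : WeylHat n} (hF : OrderGE A B C d F) (m : ℕ) :
    OrderGE A B C (m * d) (F ^ m) := by
  induction m with
  | zero => simpa using OrderGE.one
  | succ m ih =>
    rw [pow_succ]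
    refine (ih.mul hF).mono (le_of_eq ?_)
    push_cast
    ring

theorem OrderGE.prod {ι : Type*} {A B C : ℤ} {s : Finset ι} {d : ι → ℤ} {F : ι → WeylHat n}
    (hF : ∀ i, OrderGE A B C (d i) (F i)) : OrderGE A B C (∑ i ∈ s, d i) (∏ i ∈ s, F i) := by
  classical
  induction s using Finset.induction_on with
  | empty => simpa using OrderGE.one
  | insert i s hi ih =>
    rw [Finset.sum_insert hi, Finset.prod_insert hi]
    exact (hF i).mul ih

theorem orderGE_linMono (A B C : ℤ) (β : Var n →₀ ℕ) :
    OrderGE A B C (A * yDeg β + B * pDeg β) (linMono J K β) := by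
  have h (s : Var n) : OrderGE A B C (Sum.elim (fun _ => A) (fun _ => B) s) (linVar J K s) := by
    rcases s with a | a
    · exact OrderGE.sum fun b _ => (OrderGE.wvar_inl A B C b).smul _
    · exact OrderGE.sum fun b _ => (OrderGE.wvar_inr A B C b).smul _
  refine (OrderGE.prod fun s => (h s).pow (β s)).mono (le_of_eq ?_)
  simp [yDeg, pDeg, Finset.mul_sum, mul_comm]

/-- The substitution is homogeneous in `y` and in `p` separately: weights `1` and `-1` bound each
degree from both sides. Consequently each coefficient of `fibreHom` is a finite sum, and diagonal
operators commute with it. -/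
theorem degree_eq_of_wcoeff_linMono_ne_zero {α β : Var n →₀ ℕ} {k : ℕ}
    (h : wcoeff α k (linMono J K β) ≠ 0) : yDeg β = yDeg α ∧ pDeg β = pDeg α := by
  have h1 := mt (orderGE_linMono J K 1 0 0 β α k) h
  have h2 := mt (orderGE_linMono J K (-1) 0 0 β α k) h
  have h3 := mt (orderGE_linMono J K 0 1 0 β α k) h
  have h4 := mt (orderGE_linMono J K 0 (-1) 0 β α k) h
  omega

theorem wcoeff_fibreHom (α : Var n →₀ ℕ) (k : ℕ) (F : WeylHat n) :
    wcoeff α k (fibreHom J K F) = ∑ β ∈ degSet (yDeg α + pDeg α),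
      wcoeff β k F * wcoeff α 0 (linMono J K β) := by
  have hm (β : Var n →₀ ℕ) : MvPowerSeries.coeff α
      (β.prod fun s e => linearSubst J K s ^ e) = wcoeff α 0 (linMono J K β) := by
    rw [Finsupp.prod_fintype _ _ (by simp), linMono]
    simp only [← C_linearSubst, ← map_pow, ← map_prod]
    rw [wcoeff_C, if_pos rfl]
  rw [wcoeff, coeff_fibreHom, MvPowerSeries.substAlgHom_apply,
    MvPowerSeries.coeff_subst (hasSubst_linearSubst J K)]
  simp only [hm, smul_eq_mul]
  refine finsum_eq_sum_of_support_subset _ fun β hβ => ?_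
  have h := degree_eq_of_wcoeff_linMono_ne_zero J K (right_ne_zero_of_mul hβ)
  rw [Finset.mem_coe, mem_degSet, h.1, h.2]

variable {J K}

theorem wcoeff_fibreHom_congr {α : Var n →₀ ℕ} {k l : ℕ} {F G : WeylHat n}
    (h : ∀ β, yDeg β + pDeg β = yDeg α + pDeg α → wcoeff β k F = wcoeff β l G) :
    wcoeff α k (fibreHom J K F) = wcoeff α l (fibreHom J K G) := by
  rw [wcoeff_fibreHom, wcoeff_fibreHom]
  exact Finset.sum_congr rfl fun β hβ => by rw [h β (mem_degSet.mp hβ)]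

theorem wcoeff_fibreHom_eq_zero {α : Var n →₀ ℕ} {k : ℕ} {F : WeylHat n}
    (h : ∀ β, yDeg β = yDeg α → pDeg β = pDeg α → wcoeff β k F = 0) :
    wcoeff α k (fibreHom J K F) = 0 := by
  rw [wcoeff_fibreHom]
  refine Finset.sum_eq_zero fun β _ => ?_
  by_cases hβ : wcoeff α 0 (linMono J K β) = 0
  · rw [hβ, mul_zero]
  · have := degree_eq_of_wcoeff_linMono_ne_zero J K hβ
    rw [h β this.1 this.2, zero_mul]

theorem OrderGE.fibreHom {A B C d : ℤ} {F : WeylHat n} (hF : OrderGE A B C d F) :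
    OrderGE A B C d (fibreHom J K F) := fun α k hk =>
  wcoeff_fibreHom_eq_zero fun β hy hp => hF β k (by rwa [hy, hp])

theorem fibreHom_wdiag (φ : ℕ → ℕ → ℕ → ℝ) (F : WeylHat n) :
    fibreHom J K (wdiag φ F) = wdiag φ (fibreHom J K F) := by
  refine weylHat_ext fun α k => ?_
  rw [wcoeff_wdiag, wcoeff_fibreHom, wcoeff_fibreHom, Finset.mul_sum]
  refine Finset.sum_congr rfl fun β _ => ?_
  by_cases hβ : wcoeff α 0 (linMono J K β) = 0
  · simp [hβ]
  · have := degree_eq_of_wcoeff_linMono_ne_zero J K hβ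
    rw [wcoeff_wdiag, this.1, this.2, mul_assoc]

/-! ### Polynomials -/

theorem aeval_wvar (p : MvPolynomial (Var n) ℝ) :
    MvPolynomial.aeval wvar p = (PowerSeries.C (p : MvPowerSeries (Var n) ℝ) : WeylHat n) := by
  induction p using MvPolynomial.induction_on with
  | C a =>
    rw [MvPolynomial.aeval_C, MvPolynomial.coe_C, Algebra.algebraMap_eq_smul_one]
    ext1 k
    rw [coeff_real_smul, PowerSeries.coeff_C, PowerSeries.coeff_one]
    split_ifs <;> simp [MvPowerSeries.smul_eq_C_mul]
  | add p q hp hq => rw [map_add, hp, hq, MvPolynomial.coe_add, map_add]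
  | mul_X p s hp =>
    rw [map_mul, hp, MvPolynomial.aeval_X, MvPolynomial.coe_mul, map_mul, MvPolynomial.coe_X, wvar]

theorem wcoeff_aeval_wvar (α : Var n →₀ ℕ) (p : MvPolynomial (Var n) ℝ) :
    wcoeff α 0 (MvPolynomial.aeval wvar p) = p.coeff α := by
  rw [aeval_wvar, wcoeff_C, if_pos rfl, MvPolynomial.coeff_coe]

/-- A polynomial with the same coefficients in one degree. -/
theorem exists_polynomial_wcoeff_eq (N k : ℕ) (F : WeylHat n) : ∃ p : MvPolynomial (Var n) ℝ,
    ∀ β, yDeg β + pDeg β = N → wcoeff β k F = wcoeff β 0 (MvPolynomial.aeval wvar p) := by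
  classical
  refine ⟨∑ β ∈ degSet N, MvPolynomial.monomial β (wcoeff β k F), fun β hβ => ?_⟩
  rw [wcoeff_aeval_wvar, MvPolynomial.coeff_sum]
  simp only [MvPolynomial.coeff_monomial]
  rw [Finset.sum_ite_eq', if_pos (mem_degSet.mpr hβ)]

@[simp] theorem wd_linVar (s t : Var n) : wd s (linVar J K t) = match s, t with
    | Sum.inl b, Sum.inl a => J a b • 1
    | Sum.inr b, Sum.inr a => K b a • 1
    | _, _ => 0 := by
  rcases s with b | b <;> rcases t with a | a <;> simp [linVar]

theorem wd_fibreHom_aeval (s : Var n) (p : MvPolynomial (Var n) ℝ) :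
    wd s (fibreHom J K (MvPolynomial.aeval wvar p))
      = ∑ t, wd s (linVar J K t) * fibreHom J K (wd t (MvPolynomial.aeval wvar p)) := by
  induction p using MvPolynomial.induction_on with
  | C a => simp
  | add p q hp hq => simp only [map_add, hp, hq, mul_add, Finset.sum_add_distrib]
  | mul_X p r hp =>
    simp only [map_mul, MvPolynomial.aeval_X, Derivation.leibniz, map_add, smul_eq_mul,
      fibreHom_wvar, hp, mul_add, Finset.sum_add_distrib, wd_wvar]
    congr 1
    · rw [Finset.sum_eq_single_of_mem r (Finset.mem_univ _)]
      · simp only [if_true, map_one, mul_one]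
        ring
      · intro t _ ht
        simp [ht]
    · rw [Finset.mul_sum]
      exact Finset.sum_congr rfl fun t _ => by ring

theorem wcoeff_wd_congr {s : Var n} {α : Var n →₀ ℕ} {k l : ℕ} {F G : WeylHat n}
    (h : ∀ β, yDeg β + pDeg β = yDeg α + pDeg α + 1 → wcoeff β k F = wcoeff β l G) :
    wcoeff α k (wd s F) = wcoeff α l (wd s G) := by
  rw [wcoeff_wd, wcoeff_wd, h]
  rcases s with a | a <;> simp <;> ring

/-- The chain rule for a linear change of variables. -/
theorem wd_inl_fibreHom (b : Fin n) (F : WeylHat n) : wd (Sum.inl b) (fibreHom J K F)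
    = ∑ a, J a b • fibreHom J K (wd (Sum.inl a) F) := by
  refine weylHat_ext fun α k => ?_
  -- A coefficient of the derivative sees only one homogeneous part of `F`, one degree higher. So
  -- `F` may be replaced by a polynomial, for which the chain rule follows by induction.
  obtain ⟨p, hp⟩ := exists_polynomial_wcoeff_eq (yDeg α + pDeg α + 1) k F
  have h := congrArg (wcoeff α 0) (wd_fibreHom_aeval (J := J) (K := K) (Sum.inl b) p)
  simp only [wd_linVar, Fintype.sum_sum_type, zero_mul, Finset.sum_const_zero, add_zero,
    smul_mul_assoc, one_mul] at h
  rw [wcoeff_wd_congr (l := 0) fun β hβ => wcoeff_fibreHom_congr fun γ hγ => hp γ (by omega), h]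
  simp only [wcoeff_sum, wcoeff_smul]
  refine Finset.sum_congr rfl fun a _ => ?_
  rw [wcoeff_fibreHom_congr (k := k) (l := 0) fun β hβ => wcoeff_wd_congr fun γ hγ =>
    hp γ (by omega)]

theorem wd_inr_fibreHom (b : Fin n) (F : WeylHat n) : wd (Sum.inr b) (fibreHom J K F)
    = ∑ a, K b a • fibreHom J K (wd (Sum.inr a) F) := by
  refine weylHat_ext fun α k => ?_
  obtain ⟨p, hp⟩ := exists_polynomial_wcoeff_eq (yDeg α + pDeg α + 1) k F
  have h := congrArg (wcoeff α 0) (wd_fibreHom_aeval (J := J) (K := K) (Sum.inr b) p)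
  simp only [wd_linVar, Fintype.sum_sum_type, zero_mul, Finset.sum_const_zero, zero_add,
    smul_mul_assoc, one_mul] at h
  rw [wcoeff_wd_congr (l := 0) fun β hβ => wcoeff_fibreHom_congr fun γ hγ => hp γ (by omega), h]
  simp only [wcoeff_sum, wcoeff_smul]
  refine Finset.sum_congr rfl fun a _ => ?_
  rw [wcoeff_fibreHom_congr (k := k) (l := 0) fun β hβ => wcoeff_wd_congr fun γ hγ =>
    hp γ (by omega)]

/-- Transforming `y` by `J` and `p` by its inverse is symplectic, so the Poisson tensor is
preserved. -/
theorem bidiffL_fibreHom (hJK : J * K = 1) (i : ℕ) (F G : WeylHat n) :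
    bidiffL i (fibreHom J K F) (fibreHom J K G) = fibreHom J K (bidiffL i F G) := by
  have hs (a c : Fin n) : ∑ b, J a b * K b c = if a = c then 1 else 0 := by
    rw [← Matrix.mul_apply, hJK, Matrix.one_apply]
  have hc (P : Fin n → Fin n → WeylHat n) :
      ∑ b, ∑ a, ∑ c, (J a b * K b c) • P a c = ∑ a, P a a := by
    rw [Finset.sum_comm]
    refine Finset.sum_congr rfl fun a _ => ?_
    rw [Finset.sum_comm]
    simp only [← Finset.sum_smul, hs, ite_smul, one_smul, zero_smul]
    simp
  induction i generalizing F G with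
  | zero => simp
  | succ i ih =>
    simp only [bidiffL_succ, map_sum, map_sub, wd_inl_fibreHom, wd_inr_fibreHom, map_smul,
      LinearMap.sum_apply, LinearMap.smul_apply, ih, Finset.sum_sub_distrib, Finset.smul_sum,
      smul_smul]
    congr 1
    · exact (Finset.sum_congr rfl fun b _ => Finset.sum_comm).trans
        (Finset.sum_congr rfl fun b _ => Finset.sum_congr rfl fun a _ =>
          Finset.sum_congr rfl fun c _ => by rw [mul_comm]) |>.trans (hc fun a c =>
            fibreHom J K (bidiffL i (wd (Sum.inl a) F) (wd (Sum.inr c) G)))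
    · exact (hc fun a c => fibreHom J K (bidiffL i (wd (Sum.inr c) F) (wd (Sum.inl a) G)))

theorem bracketL_fibreHom (hJK : J * K = 1) (F G : WeylHat n) :
    bracketL (fibreHom J K F) (fibreHom J K G) = fibreHom J K (bracketL F G) := by
  ext1 m
  simp only [coeff_fibreHom, bracketL_apply, coeff_bracket, map_sum, map_smul,
    bidiffL_fibreHom hJK]

end FibreChange

section Transport

variable {n : ℕ}

/-! ## The inhomogeneous term -/

theorem glElement_eq (M : Matrix (Fin n) (Fin n) ℝ) :
    glElement M = ∑ d, ∑ b, M d b • (wvar (Sum.inl b) * wvar (Sum.inr d)) := by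
  have h (r : ℝ) (f : MvPowerSeries (Var n) ℝ) :
      (PowerSeries.C (r • f) : WeylHat n) = r • PowerSeries.C f := by
    ext1 k
    rw [coeff_real_smul, PowerSeries.coeff_C, PowerSeries.coeff_C]
    split_ifs <;> simp
  simp only [glElement, map_sum, h, map_mul, wvar]

theorem glElement_add (M N : Matrix (Fin n) (Fin n) ℝ) :
    glElement (M + N) = glElement M + glElement N := by
  simp only [glElement_eq, Matrix.add_apply, add_smul, Finset.sum_add_distrib]

theorem glElement_neg (M : Matrix (Fin n) (Fin n) ℝ) : glElement (-M) = -glElement M := by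
  simp only [glElement_eq, Matrix.neg_apply, neg_smul, Finset.sum_neg_distrib]

theorem orderGE_glElement (A B C : ℤ) (M : Matrix (Fin n) (Fin n) ℝ) :
    OrderGE A B C (A + B) (glElement M) := by
  rw [glElement_eq]
  exact OrderGE.sum fun d _ => OrderGE.sum fun b _ =>
    ((OrderGE.wvar_inl A B C b).mul (OrderGE.wvar_inr A B C d)).smul _

theorem wd_inl_glElement (M : Matrix (Fin n) (Fin n) ℝ) (a : Fin n) :
    wd (Sum.inl a) (glElement M) = ∑ d, M d a • wvar (Sum.inr d) := by
  simp [glElement_eq]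

theorem wd_inr_glElement (M : Matrix (Fin n) (Fin n) ℝ) (a : Fin n) :
    wd (Sum.inr a) (glElement M) = ∑ b, M a b • wvar (Sum.inl b) := by
  simp only [glElement_eq, map_sum, Derivation.map_smul, Derivation.leibniz, wd_wvar]
  simp

theorem bracketL_glElement (M : Matrix (Fin n) (Fin n) ℝ) (G : WeylHat n) :
    bracketL (glElement M) G = ∑ d, ∑ b, M d b • (wvar (Sum.inr d) * wd (Sum.inr b) G
      - wvar (Sum.inl b) * wd (Sum.inl d) G) := by
  have h (s t r : Var n) : wd r (wd s (wd t (glElement M))) = 0 := by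
    have h1 (s r : Var n) (x : Var n) : wd r (wd s (wvar x)) = 0 := by
      rw [wd_wvar]; split_ifs <;> simp
    rcases t with a | a
    · simp [wd_inl_glElement, h1, -wd_wvar]
    · simp [wd_inr_glElement, h1, -wd_wvar]
  rw [bracketL_eq_bidiffL_one (fun r s t => h s t r), bidiffL_one]
  simp only [wd_inl_glElement, wd_inr_glElement, smul_sub, Finset.sum_sub_distrib, Finset.sum_mul,
    smul_mul_assoc]
  rw [Finset.sum_comm]

theorem bracketL_glElement_mul (M : Matrix (Fin n) (Fin n) ℝ) (F G : WeylHat n) :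
    bracketL (glElement M) (F * G)
      = bracketL (glElement M) F * G + F * bracketL (glElement M) G := by
  simp only [bracketL_glElement, Finset.sum_mul, Finset.mul_sum, ← Finset.sum_add_distrib]
  refine Finset.sum_congr rfl fun d _ => Finset.sum_congr rfl fun b _ => ?_
  rw [smul_mul_assoc, mul_smul_comm, ← smul_add]
  congr 1
  simp only [Derivation.leibniz, smul_eq_mul]
  ring

@[simp] theorem bracketL_glElement_one (M : Matrix (Fin n) (Fin n) ℝ) :
    bracketL (glElement M) 1 = 0 := by
  simp [bracketL_glElement]

/-- The bracket with a quadratic element is a linear vector field and preserves total degree. This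
allows identities checked on polynomials to pass to power series. -/
theorem wcoeff_bracketL_glElement_congr (M : Matrix (Fin n) (Fin n) ℝ) {α : Var n →₀ ℕ}
    {k l : ℕ} {F G : WeylHat n}
    (h : ∀ β, yDeg β + pDeg β = yDeg α + pDeg α → wcoeff β k F = wcoeff β l G) :
    wcoeff α k (bracketL (glElement M) F) = wcoeff α l (bracketL (glElement M) G) := by
  have key (s t : Var n) : wcoeff α k (wvar s * wd t F) = wcoeff α l (wvar s * wd t G) := by
    rw [wcoeff_wvar_mul, wcoeff_wvar_mul]
    split_ifs with hs
    · refine wcoeff_wd_congr fun β hβ => h β ?_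
      rw [hβ]
      have hα : α = (α - Finsupp.single s 1) + Finsupp.single s 1 :=
        (tsub_add_cancel_of_le (by simpa using hs)).symm
      conv_rhs => rw [hα]
      rcases s with a | a <;> simp <;> ring
    · rfl
  simp only [bracketL_glElement, wcoeff_sum, wcoeff_smul, wcoeff_sub, key]

theorem bracketL_glElement_linVar_inl (M J K : Matrix (Fin n) (Fin n) ℝ) (a : Fin n) :
    bracketL (glElement M) (linVar J K (Sum.inl a))
      = -∑ b, (J * M) a b • wvar (Sum.inl b) := by
  simp only [bracketL_glElement, wd_linVar, mul_zero, zero_sub, mul_smul_comm, mul_one, smul_neg,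
    Finset.sum_neg_distrib, smul_smul, Matrix.mul_apply, Finset.sum_smul]
  rw [Finset.sum_comm]
  simp only [mul_comm]

theorem bracketL_glElement_linVar_inr (M J K : Matrix (Fin n) (Fin n) ℝ) (a : Fin n) :
    bracketL (glElement M) (linVar J K (Sum.inr a))
      = ∑ d, (M * K) d a • wvar (Sum.inr d) := by
  simp only [bracketL_glElement, wd_linVar, mul_zero, sub_zero, mul_smul_comm, mul_one,
    smul_smul, Matrix.mul_apply, Finset.sum_smul]

theorem bracketL_glElement_glElement (M N : Matrix (Fin n) (Fin n) ℝ) :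
    bracketL (glElement M) (glElement N) = glElement (M * N - N * M) := by
  rw [sub_eq_add_neg, glElement_add, glElement_neg, bracketL_glElement]
  simp only [wd_inl_glElement, wd_inr_glElement, smul_sub, Finset.sum_sub_distrib]
  rw [sub_eq_add_neg]
  congr 1
  · rw [glElement_eq]
    refine Finset.sum_congr rfl fun d _ => ?_
    simp only [Finset.mul_sum, Finset.smul_sum, Matrix.mul_apply, Finset.sum_smul, mul_smul_comm,
      smul_smul]
    rw [Finset.sum_comm]
    exact Finset.sum_congr rfl fun f _ => Finset.sum_congr rfl fun b _ => by
      rw [mul_comm (wvar _)]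
  · rw [glElement_eq]
    congr 1
    simp only [Finset.mul_sum, Finset.smul_sum, Matrix.mul_apply, Finset.sum_smul, mul_smul_comm,
      smul_smul]
    rw [Finset.sum_comm' (t' := Finset.univ) (s' := fun _ => Finset.univ) (by simp)]
    rw [Finset.sum_congr rfl fun b _ => Finset.sum_comm, Finset.sum_comm]
    exact Finset.sum_congr rfl fun e _ => Finset.sum_congr rfl fun b _ =>
      Finset.sum_congr rfl fun d _ => by rw [mul_comm (N _ _)]

/-! ## Derivatives of matrix-valued functions -/

/-- The entrywise partial derivative of a matrix-valued function. -/
def matrixDeriv (μ : Fin n) (M : E n → Matrix (Fin n) (Fin n) ℝ) (u : E n) :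
    Matrix (Fin n) (Fin n) ℝ :=
  Matrix.of fun i j => fderiv ℝ (fun v => M v i j) u (EuclideanSpace.single μ 1)

variable {V : Set (E n)} {u : E n} {M N : E n → Matrix (Fin n) (Fin n) ℝ}

theorem matrixDeriv_mul (μ : Fin n) (hM : ∀ i j, DifferentiableAt ℝ (fun v => M v i j) u)
    (hN : ∀ i j, DifferentiableAt ℝ (fun v => N v i j) u) :
    matrixDeriv μ (fun v => M v * N v) u = matrixDeriv μ M u * N u + M u * matrixDeriv μ N u := by
  ext i j
  simp only [matrixDeriv, Matrix.of_apply, Matrix.add_apply, Matrix.mul_apply]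
  rw [fderiv_fun_sum fun k _ => (hM i k).fun_mul (hN k j), sum_apply, ← Finset.sum_add_distrib]
  refine Finset.sum_congr rfl fun k _ => ?_
  rw [fderiv_fun_mul (hM i k) (hN k j)]
  simp
  ring

theorem partialDeriv_glElement (μ : Fin n) (hM : ∀ i j, DifferentiableAt ℝ (fun v => M v i j) u) :
    partialDeriv μ (fun v => glElement (M v)) u = glElement (matrixDeriv μ M u) := by
  have hc (F : WeylHat n) : WDiffAt (fun _ => F) u := fun _ _ => differentiableAt_const _
  simp only [glElement_eq]
  rw [partialDeriv_sum μ fun d _ => WDiffAt.sum fun b _ => (hc _).smul (hM _ _)]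
  refine Finset.sum_congr rfl fun d _ => ?_
  rw [partialDeriv_sum μ fun b _ => (hc _).smul (hM _ _)]
  refine Finset.sum_congr rfl fun b _ => ?_
  rw [partialDeriv_smul μ (hM _ _) (hc _), partialDeriv_const, smul_zero, add_zero]
  rfl

/-! ## Coordinate changes -/

/-- A coordinate change `t` on an open set, with Jacobian `J` and inverse Jacobian `K`. -/
structure IsFrameChange (V : Set (E n)) (t : E n → E n) (J K : E n → Matrix (Fin n) (Fin n) ℝ) :
    Prop where
  isOpen : IsOpen V
  contDiffOn : ContDiffOn ℝ ∞ t V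
  eq_jacobian : ∀ u ∈ V, J u = jacobian t u
  contDiffOn_inv : ∀ i j, ContDiffOn ℝ ∞ (fun u => K u i j) V
  mul_eq_one : ∀ u ∈ V, J u * K u = 1

/-- The matrix-valued form `J⁻¹ dJ`. -/
def maurerCartan (J K : E n → Matrix (Fin n) (Fin n) ℝ) (u : E n) (μ : Fin n) :
    Matrix (Fin n) (Fin n) ℝ :=
  K u * matrixDeriv μ J u

namespace IsFrameChange

variable {t : E n → E n} {J K : E n → Matrix (Fin n) (Fin n) ℝ}

theorem contDiffOn_jac (h : IsFrameChange V t J K) (i j : Fin n) :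
    ContDiffOn ℝ ∞ (fun u => J u i j) V := by
  have h1 : ContDiffOn ℝ ∞ (fun u => fderiv ℝ t u (EuclideanSpace.single j 1)) V :=
    (h.contDiffOn.fderiv_of_isOpen h.isOpen (by simp)).clm_apply contDiffOn_const
  have h2 : ContDiffOn ℝ ∞ (fun u => fderiv ℝ t u (EuclideanSpace.single j 1) i) V :=
    (EuclideanSpace.proj (𝕜 := ℝ) i).contDiff.comp_contDiffOn h1
  exact h2.congr fun u hu => by rw [h.eq_jacobian u hu]; rfl

theorem differentiableAt_jac (h : IsFrameChange V t J K) (hu : u ∈ V) (i j : Fin n) :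
    DifferentiableAt ℝ (fun u => J u i j) u :=
  ((h.contDiffOn_jac i j).contDiffAt (h.isOpen.mem_nhds hu)).differentiableAt (by simp)

theorem differentiableAt_inv (h : IsFrameChange V t J K) (hu : u ∈ V) (i j : Fin n) :
    DifferentiableAt ℝ (fun u => K u i j) u :=
  ((h.contDiffOn_inv i j).contDiffAt (h.isOpen.mem_nhds hu)).differentiableAt (by simp)

theorem differentiableAt (h : IsFrameChange V t J K) (hu : u ∈ V) : DifferentiableAt ℝ t u :=
  (h.contDiffOn.contDiffAt (h.isOpen.mem_nhds hu)).differentiableAt (by simp)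

theorem mul_eq_one' (h : IsFrameChange V t J K) (hu : u ∈ V) : K u * J u = 1 :=
  mul_eq_one_comm.mp (h.mul_eq_one u hu)

theorem fderiv_apply_single (h : IsFrameChange V t J K) (hu : u ∈ V) (μ : Fin n) :
    fderiv ℝ t u (EuclideanSpace.single μ 1)
      = ∑ ν, J u ν μ • EuclideanSpace.single ν (1 : ℝ) := by
  rw [h.eq_jacobian u hu]
  conv_lhs => rw [← (EuclideanSpace.basisFun (Fin n) ℝ).sum_repr
    (fderiv ℝ t u (EuclideanSpace.single μ 1))]
  simp [jacobian]

/-- Symmetry of the second derivatives of `t`. It removes the terms with derivatives of the Jacobian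
from the transformation law of the curvature. -/
theorem matrixDeriv_jac_comm (h : IsFrameChange V t J K) (hu : u ∈ V) (μ ν σ : Fin n) :
    fderiv ℝ (fun v => J v σ ν) u (EuclideanSpace.single μ 1)
      = fderiv ℝ (fun v => J v σ μ) u (EuclideanSpace.single ν 1) := by
  have hc : ContDiffAt ℝ ∞ (fun v => t v σ) u :=
    ((EuclideanSpace.proj (𝕜 := ℝ) σ).contDiff.comp_contDiffOn h.contDiffOn).contDiffAt
      (h.isOpen.mem_nhds hu)
  have hd : DifferentiableAt ℝ (fderiv ℝ fun v => t v σ) u :=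
    (hc.fderiv_right (m := 1) (by norm_cast)).differentiableAt (by simp)
  have hJ (ν : Fin n) : (fun v => J v σ ν) =ᶠ[nhds u]
      fun v => fderiv ℝ (fun v => t v σ) v (EuclideanSpace.single ν 1) := by
    refine Filter.eventually_of_mem (h.isOpen.mem_nhds hu) fun v hv => ?_
    have h1 : HasFDerivAt (fun v => t v σ)
        ((EuclideanSpace.proj (𝕜 := ℝ) σ).comp (fderiv ℝ t v)) v :=
      (EuclideanSpace.proj (𝕜 := ℝ) σ).hasFDerivAt.comp v (h.differentiableAt hv).hasFDerivAt
    simp only [h.eq_jacobian v hv, h1.fderiv]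
    rfl
  rw [(hJ ν).fderiv_eq, (hJ μ).fderiv_eq, fderiv_clm_apply hd (differentiableAt_const _),
    fderiv_clm_apply hd (differentiableAt_const _)]
  have := hc.isSymmSndFDerivAt (by simp; exact WithTop.coe_le_coe.mpr le_top)
  simpa using this _ _

theorem matrixDeriv_inv (h : IsFrameChange V t J K) (hu : u ∈ V) (μ : Fin n) :
    matrixDeriv μ K u = -(maurerCartan J K u μ * K u) := by
  have h1 := matrixDeriv_mul μ (h.differentiableAt_inv hu) (h.differentiableAt_jac hu)
  have h2 : matrixDeriv μ (fun v => K v * J v) u = 0 := by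
    ext i j
    have : (fun v => (K v * J v) i j) =ᶠ[nhds u] fun _ => (1 : Matrix (Fin n) (Fin n) ℝ) i j :=
      Filter.eventually_of_mem (h.isOpen.mem_nhds hu) fun v hv => by
        simp only [h.mul_eq_one' hv]
    simp [matrixDeriv, this.fderiv_eq]
  rw [h2] at h1
  have h3 := congrArg (· * K u) h1
  simp only [zero_mul, add_mul, mul_assoc, h.mul_eq_one u hu, mul_one] at h3
  rw [maurerCartan, mul_assoc]
  exact eq_neg_of_add_eq_zero_left h3.symm

theorem contDiffOn_maurerCartan (h : IsFrameChange V t J K) (μ i j : Fin n) :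
    ContDiffOn ℝ ∞ (fun u => maurerCartan J K u μ i j) V := by
  simp only [maurerCartan, Matrix.mul_apply]
  refine ContDiffOn.sum fun k _ => (h.contDiffOn_inv i k).mul ?_
  exact ((h.contDiffOn_jac k j).fderiv_of_isOpen h.isOpen (by simp)).clm_apply contDiffOn_const

theorem wsmoothOn_glElement (h : IsFrameChange V t J K) (μ : Fin n) :
    WSmoothOn V fun u => glElement (maurerCartan J K u μ) := by
  simp only [glElement_eq]
  exact WSmoothOn.sum fun d _ => WSmoothOn.sum fun b _ =>
    (wsmoothOn_const _).smul (h.contDiffOn_maurerCartan μ d b)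

/-- The Maurer--Cartan equation. -/
theorem curv_glElement (h : IsFrameChange V t J K) (hu : u ∈ V) (μ ν : Fin n) :
    curv (fun v ν => glElement (maurerCartan J K v ν)) μ ν u = 0 := by
  have hd (μ i j : Fin n) : DifferentiableAt ℝ (fun v => maurerCartan J K v μ i j) u :=
    ((h.contDiffOn_maurerCartan μ i j).contDiffAt (h.isOpen.mem_nhds hu)).differentiableAt
      (by simp)
  have hJ (ν i j : Fin n) : DifferentiableAt ℝ (fun v => matrixDeriv ν J v i j) u :=
    ((((h.contDiffOn_jac i j).fderiv_of_isOpen h.isOpen (m := ∞) (by simp)).clm_apply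
      contDiffOn_const).contDiffAt (h.isOpen.mem_nhds hu)).differentiableAt (by simp)
  have hM (μ ν : Fin n) : matrixDeriv μ (fun v => maurerCartan J K v ν) u
      = -(maurerCartan J K u μ * maurerCartan J K u ν)
        + K u * matrixDeriv μ (matrixDeriv ν J) u := by
    have h1 := matrixDeriv_mul μ (h.differentiableAt_inv hu) (hJ ν)
    rw [h.matrixDeriv_inv hu, neg_mul, mul_assoc] at h1
    exact h1
  have hcomm : matrixDeriv μ (matrixDeriv ν J) u = matrixDeriv ν (matrixDeriv μ J) u := by
    ext i j
    have hc := (h.contDiffOn_jac i j).contDiffAt (h.isOpen.mem_nhds hu)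
    have hd : DifferentiableAt ℝ (fderiv ℝ fun v => J v i j) u :=
      (hc.fderiv_right (m := 1) (by norm_cast)).differentiableAt (by simp)
    simp only [matrixDeriv, Matrix.of_apply]
    rw [fderiv_clm_apply hd (differentiableAt_const _),
      fderiv_clm_apply hd (differentiableAt_const _)]
    have := hc.isSymmSndFDerivAt (by simp; exact WithTop.coe_le_coe.mpr le_top)
    simpa using this _ _
  rw [curv, partialDeriv_glElement μ (hd ν), partialDeriv_glElement ν (hd μ),
    bracketL_glElement_glElement, hM, hM, hcomm]
  simp only [sub_eq_add_neg, glElement_add, glElement_neg]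
  abel

/-! ### Transport of functions -/

theorem partialDeriv_linVar (h : IsFrameChange V t J K) (hu : u ∈ V) (μ : Fin n) (s : Var n) :
    partialDeriv μ (fun v => linVar (J v) (K v) s) u
      = -bracketL (glElement (maurerCartan J K u μ)) (linVar (J u) (K u) s) := by
  have hc (F : WeylHat n) : WDiffAt (fun _ => F) u := fun _ _ => differentiableAt_const _
  rcases s with a | a
  · rw [bracketL_glElement_linVar_inl, maurerCartan, ← mul_assoc, h.mul_eq_one u hu, one_mul,
      neg_neg]
    simp only [linVar]
    rw [partialDeriv_sum μ fun b _ => (hc _).smul (h.differentiableAt_jac hu a b)]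
    refine Finset.sum_congr rfl fun b _ => ?_
    rw [partialDeriv_smul μ (h.differentiableAt_jac hu a b) (hc _), partialDeriv_const, smul_zero,
      add_zero]
    rfl
  · rw [bracketL_glElement_linVar_inr, ← neg_neg (maurerCartan J K u μ * K u),
      ← h.matrixDeriv_inv hu μ]
    simp only [linVar, Matrix.neg_apply, neg_smul, Finset.sum_neg_distrib, neg_neg]
    rw [partialDeriv_sum μ fun b _ => (hc _).smul (h.differentiableAt_inv hu b a)]
    refine Finset.sum_congr rfl fun b _ => ?_
    rw [partialDeriv_smul μ (h.differentiableAt_inv hu b a) (hc _), partialDeriv_const, smul_zero,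
      add_zero]
    rfl

theorem wsmoothOn_linMono (h : IsFrameChange V t J K) (β : Var n →₀ ℕ) :
    WSmoothOn V fun u => linMono (J u) (K u) β := by
  have hv (s : Var n) : WSmoothOn V fun u => linVar (J u) (K u) s := by
    rcases s with a | a
    · exact WSmoothOn.sum fun b _ => (wsmoothOn_const _).smul (h.contDiffOn_jac a b)
    · exact WSmoothOn.sum fun b _ => (wsmoothOn_const _).smul (h.contDiffOn_inv b a)
  have hp (s : Var n) (m : ℕ) : WSmoothOn V fun u => linVar (J u) (K u) s ^ m := by
    induction m with
    | zero => simpa using wsmoothOn_const _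
    | succ m ih => simp only [pow_succ]; exact ih.mul (hv s)
  simp only [linMono]
  generalize (Finset.univ : Finset (Var n)) = S
  induction S using Finset.induction_on with
  | empty => simpa using wsmoothOn_const _
  | insert i s hi ih =>
    simp only [Finset.prod_insert hi]
    exact (hp i _).mul ih

theorem wsmoothOn_fibreHom (h : IsFrameChange V t J K) {F : E n → WeylHat n}
    (hF : WSmoothOn V F) : WSmoothOn V fun u => fibreHom (J u) (K u) (F u) := fun α k => by
  simp only [wcoeff_fibreHom]
  exact ContDiffOn.sum fun β _ => (hF β k).mul (h.wsmoothOn_linMono β α 0)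

theorem partialDeriv_fibreHom_aeval (h : IsFrameChange V t J K) (hu : u ∈ V) (μ : Fin n)
    (p : MvPolynomial (Var n) ℝ) :
    partialDeriv μ (fun v => fibreHom (J v) (K v) (MvPolynomial.aeval wvar p)) u
      = -bracketL (glElement (maurerCartan J K u μ))
        (fibreHom (J u) (K u) (MvPolynomial.aeval wvar p)) := by
  have hs (F : WeylHat n) : WDiffAt (fun v => fibreHom (J v) (K v) F) u :=
    (h.wsmoothOn_fibreHom (wsmoothOn_const F)).wdiffAt h.isOpen hu
  induction p using MvPolynomial.induction_on with
  | C a => simp [Algebra.algebraMap_eq_smul_one]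
  | add p q hp hq =>
    simp only [map_add]
    rw [partialDeriv_add μ (hs _) (hs _), hp, hq]
    abel
  | mul_X p s hp =>
    have hw : WDiffAt (fun v => linVar (J v) (K v) s) u := by simpa using hs (wvar s)
    simp only [map_mul, MvPolynomial.aeval_X, fibreHom_wvar]
    rw [partialDeriv_mul μ (hs _) hw, hp, h.partialDeriv_linVar hu, bracketL_glElement_mul]
    ring

/-- Moving the frame acts infinitesimally through `J⁻¹ dJ`. This holds on the generators, extends to
polynomials because both sides obey the Leibniz rule, and to series one homogeneous degree at a
time. -/
theorem partialDeriv_fibreHom_const (h : IsFrameChange V t J K) (hu : u ∈ V) (μ : Fin n)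
    (F : WeylHat n) : partialDeriv μ (fun v => fibreHom (J v) (K v) F) u
      = -bracketL (glElement (maurerCartan J K u μ)) (fibreHom (J u) (K u) F) := by
  refine weylHat_ext fun α k => ?_
  obtain ⟨p, hp⟩ := exists_polynomial_wcoeff_eq (yDeg α + pDeg α) k F
  have h1 := congrArg (wcoeff α 0) (h.partialDeriv_fibreHom_aeval hu μ p)
  rw [wcoeff_neg] at h1 ⊢
  rw [wcoeff_bracketL_glElement_congr (l := 0) _ fun β hβ =>
    wcoeff_fibreHom_congr fun γ hγ => hp γ (hγ.trans hβ), ← h1, wcoeff_partialDeriv,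
    wcoeff_partialDeriv]
  congr 2
  funext v
  exact wcoeff_fibreHom_congr hp

theorem partialDeriv_fibreHom (h : IsFrameChange V t J K) (hu : u ∈ V) (μ : Fin n)
    {H : E n → WeylHat n} (hH : WDiffAt H u) :
    partialDeriv μ (fun v => fibreHom (J v) (K v) (H v)) u
      = fibreHom (J u) (K u) (partialDeriv μ H u)
        - bracketL (glElement (maurerCartan J K u μ)) (fibreHom (J u) (K u) (H u)) := by
  rw [sub_eq_add_neg, ← h.partialDeriv_fibreHom_const hu]
  refine weylHat_ext fun α k => ?_
  have hL (β : Var n →₀ ℕ) := (h.wsmoothOn_linMono β).wdiffAt h.isOpen hu α 0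
  simp only [wcoeff_add, wcoeff_partialDeriv, wcoeff_fibreHom]
  rw [fderiv_fun_sum fun β _ => (hH β k).fun_mul (hL β),
    fderiv_fun_sum fun β _ => (hL β).const_mul _, sum_apply, sum_apply,
    ← Finset.sum_add_distrib]
  refine Finset.sum_congr rfl fun β _ => ?_
  rw [fderiv_fun_mul (hH β k) (hL β), fderiv_const_mul (hL β)]
  simp
  ring

theorem partialDeriv_comp (h : IsFrameChange V t J K) (hu : u ∈ V) (μ : Fin n)
    {F : E n → WeylHat n} (hF : WDiffAt F (t u)) :
    partialDeriv μ (fun v => F (t v)) u = ∑ ν, J u ν μ • partialDeriv ν F (t u) := by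
  refine weylHat_ext fun α k => ?_
  simp only [wcoeff_sum, wcoeff_smul, wcoeff_partialDeriv]
  have h1 : fderiv ℝ (fun v => wcoeff α k (F (t v))) u
      = (fderiv ℝ (fun v => wcoeff α k (F v)) (t u)).comp (fderiv ℝ t u) :=
    ((hF α k).hasFDerivAt.comp u (h.differentiableAt hu).hasFDerivAt).fderiv
  rw [h1, ContinuousLinearMap.comp_apply, h.fderiv_apply_single hu, map_sum]
  simp

theorem wdiffAt_comp (h : IsFrameChange V t J K) (hu : u ∈ V)
    {F : E n → WeylHat n} (hF : WDiffAt F (t u)) : WDiffAt (fun v => F (t v)) u :=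
  fun α k => (hF α k).comp u (h.differentiableAt hu)

/-- Transport intertwines the flat connection `d + J⁻¹ dJ` with the trivial connection. -/
theorem nabla_glElement_fibreHom (h : IsFrameChange V t J K) (hu : u ∈ V) (μ : Fin n)
    {F : E n → WeylHat n} (hF : WDiffAt F (t u)) :
    nabla (fun v ν => glElement (maurerCartan J K v ν)) μ
        (fun v => fibreHom (J v) (K v) (F (t v))) u
      = ∑ ν, J u ν μ • fibreHom (J u) (K u) (partialDeriv ν F (t u)) := by
  rw [nabla, h.partialDeriv_fibreHom hu μ (h.wdiffAt_comp hu hF), h.partialDeriv_comp hu μ hF]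
  simp only [map_sum, map_smul]
  abel

/-- The homogeneous part of the transport of a connection form. -/
def transportForm (t : E n → E n) (J K : E n → Matrix (Fin n) (Fin n) ℝ)
    (Φ : E n → Fin n → WeylHat n) (ν : Fin n) (u : E n) : WeylHat n :=
  ∑ σ, J u σ ν • fibreHom (J u) (K u) (Φ (t u) σ)

variable {Φ : E n → Fin n → WeylHat n}

theorem nabla_transport (h : IsFrameChange V t J K) (hu : u ∈ V) (μ : Fin n)
    {F : E n → WeylHat n} (hF : WDiffAt F (t u)) :
    nabla (fun v ν => glElement (maurerCartan J K v ν) + transportForm t J K Φ ν v) μ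
        (fun v => fibreHom (J v) (K v) (F (t v))) u
      = ∑ ν, J u ν μ • fibreHom (J u) (K u) (nabla Φ ν F (t u)) := by
  have h1 := h.nabla_glElement_fibreHom hu μ hF
  rw [nabla] at h1 ⊢
  rw [map_add, LinearMap.add_apply, ← add_assoc, h1]
  simp only [transportForm, nabla, map_add, map_sum, map_smul, LinearMap.sum_apply,
    LinearMap.smul_apply, bracketL_fibreHom (h.mul_eq_one u hu), smul_add, Finset.sum_add_distrib]

/-- The transported form is an extension of the flat form `J⁻¹ dJ`, so `curv_add` leaves only its
covariant derivative and its bracket. -/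
theorem curv_transport (h : IsFrameChange V t J K) (hu : u ∈ V)
    (hΦ : ∀ μ, WDiffAt (fun v => Φ v μ) (t u)) (μ ν : Fin n) :
    curv (fun v ν => glElement (maurerCartan J K v ν) + transportForm t J K Φ ν v) μ ν u
      = ∑ ρ, ∑ σ, (J u ρ μ * J u σ ν) • fibreHom (J u) (K u) (curv Φ ρ σ (t u)) := by
  have hT (σ : Fin n) : WDiffAt (fun v => fibreHom (J v) (K v) (Φ (t v) σ)) u := fun α k => by
    simp only [wcoeff_fibreHom]
    exact DifferentiableAt.fun_sum fun β _ => (h.wdiffAt_comp hu (hΦ σ) β k).fun_mul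
      ((h.wsmoothOn_linMono β).wdiffAt h.isOpen hu α 0)
  have hd (ν : Fin n) : WDiffAt (transportForm t J K Φ ν) u :=
    WDiffAt.sum fun σ _ => (hT σ).smul (h.differentiableAt_jac hu σ ν)
  have hn (μ ν : Fin n) : nabla (fun v ν => glElement (maurerCartan J K v ν)) μ
      (transportForm t J K Φ ν) u
      = ∑ σ, fderiv ℝ (fun v => J v σ ν) u (EuclideanSpace.single μ 1)
          • fibreHom (J u) (K u) (Φ (t u) σ)
        + ∑ ρ, ∑ σ, (J u ρ μ * J u σ ν)
          • fibreHom (J u) (K u) (partialDeriv ρ (fun v => Φ v σ) (t u)) := by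
    have h1 (σ : Fin n) := h.nabla_glElement_fibreHom hu μ (hΦ σ)
    simp only [nabla] at h1 ⊢
    have h2 : partialDeriv μ (transportForm t J K Φ ν) u
        = partialDeriv μ (fun v => ∑ σ, J v σ ν • fibreHom (J v) (K v) (Φ (t v) σ)) u := rfl
    rw [h2, partialDeriv_sum μ fun σ _ => (hT σ).smul (h.differentiableAt_jac hu σ ν),
      transportForm, map_sum, ← Finset.sum_add_distrib, Finset.sum_comm, ← Finset.sum_add_distrib]
    refine Finset.sum_congr rfl fun σ _ => ?_
    rw [partialDeriv_smul μ (h.differentiableAt_jac hu σ ν) (hT σ), map_smul, add_assoc,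
      ← smul_add, h1, Finset.smul_sum]
    simp only [smul_smul, mul_comm]
  rw [curv_add (fun μ => (h.wsmoothOn_glElement μ).wdiffAt h.isOpen hu) hd,
    h.curv_glElement hu, zero_add, hn, hn]
  simp only [h.matrixDeriv_jac_comm hu μ ν, add_sub_add_left_eq_sub]
  have hb : bracketL (transportForm t J K Φ μ u) (transportForm t J K Φ ν u)
      = ∑ ρ, ∑ σ, (J u ρ μ * J u σ ν)
        • fibreHom (J u) (K u) (bracketL (Φ (t u) ρ) (Φ (t u) σ)) := by
    simp only [transportForm, map_sum, map_smul, LinearMap.sum_apply, LinearMap.smul_apply,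
      bracketL_fibreHom (h.mul_eq_one u hu), Finset.smul_sum, smul_smul]
    rw [Finset.sum_comm]
    exact Finset.sum_congr rfl fun ρ _ => Finset.sum_congr rfl fun σ _ => by rw [mul_comm]
  rw [hb]
  conv_lhs => enter [1, 2]; rw [Finset.sum_comm]
  simp only [curv, map_add, map_sub, smul_add, smul_sub, Finset.sum_add_distrib,
    Finset.sum_sub_distrib]
  congr 2
  exact Finset.sum_congr rfl fun ρ _ => Finset.sum_congr rfl fun σ _ => by rw [mul_comm]

end IsFrameChange

end Transport

section Frame

variable {n : ℕ} {V : Set (E n)} {u : E n} {t : E n → E n}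
  {J K : E n → Matrix (Fin n) (Fin n) ℝ} {Φ Φ' : E n → Fin n → WeylHat n}

/-! ## Transport of the vielbein -/

theorem WSmoothOn.comp {U : Set (E n)} {F : E n → WeylHat n} (hF : WSmoothOn U F)
    (ht : ContDiffOn ℝ ∞ t V) (hV : Set.MapsTo t V U) : WSmoothOn V fun u => F (t u) :=
  fun α k => (hF α k).comp ht hV

theorem curv_congr (hV : IsOpen V) (hu : u ∈ V) (h : ∀ v ∈ V, ∀ μ, Φ v μ = Φ' v μ) (μ ν : Fin n) :
    curv Φ μ ν u = curv Φ' μ ν u := by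
  rw [curv, curv, partialDeriv_congr hV hu μ fun v hv => h v hv ν,
    partialDeriv_congr hV hu ν fun v hv => h v hv μ, h u hu, h u hu]

theorem wcoeff_single_inr_fibreHom (J K : Matrix (Fin n) (Fin n) ℝ) (a : Fin n) (F : WeylHat n) :
    wcoeff (Finsupp.single (Sum.inr a) 1) 0 (fibreHom J K F)
      = ∑ c, K a c * wcoeff (Finsupp.single (Sum.inr c) 1) 0 F := by
  have h (r : ℝ) (v : Fin n → ℝ) :
      fibreHom J K (lowPart r v) = lowPart r fun a => ∑ c, K a c * v c := by
    simp only [lowPart, map_add, map_smul, map_one, map_sum, fibreHom_wvar, linVar,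
      Finset.smul_sum, smul_smul, Finset.sum_smul]
    congr 1
    rw [Finset.sum_comm]
    simp only [mul_comm]
  conv_lhs => rw [← lowPart_add_highPart F]
  rw [map_add, h, wcoeff_add, wcoeff_lowPart_inr,
    (orderGE_highPart F).fibreHom (Finsupp.single (Sum.inr a) 1) 0 (by simp), add_zero]

/-- The inhomogeneous term is bilinear in `y` and `p`, so it does not reach the coefficients of
`p_a`. -/
theorem localVielbein_transport (hΦ : ∀ μ, Φ u μ
      = glElement (maurerCartan J K u μ) + IsFrameChange.transportForm t J K Φ' μ u) :
    localVielbein Φ u = K u * localVielbein Φ' (t u) * J u := by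
  ext a μ
  simp only [localVielbein, Matrix.of_apply, hΦ, wcoeff_add, IsFrameChange.transportForm,
    wcoeff_sum, wcoeff_smul, wcoeff_single_inr_fibreHom, Matrix.mul_apply]
  rw [orderGE_glElement 2 1 3 _ (Finsupp.single (Sum.inr a) 1) 0 (by simp), zero_add]
  exact Finset.sum_congr rfl fun σ _ => mul_comm _ _

theorem frameVec_transport {J K M : Matrix (Fin n) (Fin n) ℝ} (hJK : J * K = 1)
    (hM : IsUnit M.det) (μ : Fin n) :
    frameVec (K * M * J) μ = ∑ ν, K μ ν • fibreHom J K (frameVec M ν) := by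
  have hinv : (K * M * J)⁻¹ = K * (M⁻¹ * J) := by
    refine Matrix.inv_eq_right_inv ?_
    calc K * M * J * (K * (M⁻¹ * J)) = K * (M * ((J * K) * (M⁻¹ * J))) := by
          simp only [mul_assoc]
      _ = K * ((M * M⁻¹) * J) := by rw [hJK, one_mul, mul_assoc]
      _ = 1 := by rw [Matrix.mul_nonsing_inv M hM, one_mul, mul_eq_one_comm.mp hJK]
  have h (ν : Fin n) : fibreHom J K (frameVec M ν) = ∑ b, (M⁻¹ * J) ν b • wvar (Sum.inl b) := by
    simp only [frameVec, map_sum, map_smul, fibreHom_wvar, linVar, Finset.smul_sum, smul_smul,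
      Matrix.mul_apply, Finset.sum_smul]
    exact Finset.sum_comm
  simp only [h, Finset.smul_sum, smul_smul]
  rw [frameVec, hinv, Finset.sum_comm]
  exact Finset.sum_congr rfl fun b _ => by rw [Matrix.mul_apply, Finset.sum_smul]

/-- Covariance of the normalization that singles out Fedosov's correction; it is what makes the
local corrections glue. -/
theorem sum_frameVec_mul_transportForm (hJK : J u * K u = 1) {M : Matrix (Fin n) (Fin n) ℝ}
    (hM : IsUnit M.det) :
    ∑ μ, frameVec (K u * M * J u) μ * IsFrameChange.transportForm t J K Φ μ u
      = fibreHom (J u) (K u) (∑ ν, frameVec M ν * Φ (t u) ν) := by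
  have hs (σ ν : Fin n) : ∑ μ, J u σ μ * K u μ ν = if σ = ν then 1 else 0 := by
    rw [← Matrix.mul_apply, hJK, Matrix.one_apply]
  simp only [frameVec_transport hJK hM, IsFrameChange.transportForm, Finset.sum_mul,
    Finset.mul_sum, smul_mul_smul_comm, map_sum, map_mul]
  rw [Finset.sum_comm]
  refine Finset.sum_congr rfl fun ν _ => ?_
  rw [Finset.sum_comm]
  simp only [mul_comm (K u _ _), ← Finset.sum_smul, hs, ite_smul, one_smul, zero_smul]
  simp

theorem wdiag_glElement {φ : ℕ → ℕ → ℕ → ℝ} (hφ : ∀ k, φ 1 1 k = 1)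
    (M : Matrix (Fin n) (Fin n) ℝ) : wdiag φ (glElement M) = glElement M := by
  refine weylHat_ext fun α k => ?_
  rw [wcoeff_wdiag]
  by_cases h : wcoeff α k (glElement M) = 0
  · rw [h, mul_zero]
  · have h1 := mt (orderGE_glElement 1 0 0 M α k) h
    have h2 := mt (orderGE_glElement (-1) 0 0 M α k) h
    have h3 := mt (orderGE_glElement 0 1 0 M α k) h
    have h4 := mt (orderGE_glElement 0 (-1) 0 M α k) h
    have hy : yDeg α = 1 := by omega
    have hp : pDeg α = 1 := by omega
    rw [hy, hp, hφ, one_mul]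

theorem wdiag_transportForm (φ : ℕ → ℕ → ℕ → ℝ) (μ : Fin n) :
    wdiag φ (IsFrameChange.transportForm t J K Φ μ u)
      = IsFrameChange.transportForm t J K (fun v ν => wdiag φ (Φ v ν)) μ u := by
  simp only [IsFrameChange.transportForm, map_sum, map_smul, fibreHom_wdiag]

theorem transportForm_add (μ : Fin n) :
    IsFrameChange.transportForm t J K (fun v ν => Φ v ν + Φ' v ν) μ u
      = IsFrameChange.transportForm t J K Φ μ u + IsFrameChange.transportForm t J K Φ' μ u := by
  simp only [IsFrameChange.transportForm, map_add, smul_add, Finset.sum_add_distrib]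

theorem transportForm_sub (μ : Fin n) :
    IsFrameChange.transportForm t J K (fun v ν => Φ v ν - Φ' v ν) μ u
      = IsFrameChange.transportForm t J K Φ μ u - IsFrameChange.transportForm t J K Φ' μ u := by
  simp only [IsFrameChange.transportForm, map_sub, smul_sub, Finset.sum_sub_distrib]

theorem eq_single_inl_of_degree {α : Var n →₀ ℕ} (hy : yDeg α = 1) (hp : pDeg α = 0) :
    ∃ a, α = Finsupp.single (Sum.inl a) 1 := by
  have hy' : ∃ a, α (Sum.inl a) ≠ 0 := by
    by_contra! h
    simp [yDeg, h] at hy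
  obtain ⟨a, ha⟩ := hy'
  have hle : Finsupp.single (Sum.inl a) 1 ≤ α := by
    rw [Finsupp.single_le_iff]; omega
  obtain ⟨β, rfl⟩ := le_iff_exists_add.mp hle
  simp only [yDeg_add, pDeg_add, yDeg_single_inl, pDeg_single_inl] at hy hp
  have hβ : β = 0 := eq_zero_of_degree (by omega) (by omega)
  exact ⟨a, by simp [hβ]⟩

end Frame

/-! ## Charts -/

section Charts

variable {n : ℕ} {X : Type*} [TopologicalSpace X] [ChartedSpace (E n) X]

theorem isFrameChange_transition [IsManifold (𝓡 n) ∞ X] (c c' : atlas (E n) X) :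
    IsFrameChange (transition c c').source (transition c c') (transJac c c')
      (transJacInv c c') := by
  have hs (c c' : atlas (E n) X) : ContDiffOn ℝ ∞ (transition c c') (transition c c').source :=
    contMDiffOn_iff_contDiffOn.mp (contMDiffOn_of_mem_contDiffGroupoid
      (HasGroupoid.compatible (G := contDiffGroupoid ∞ (𝓡 n)) c.2 c'.2))
  have hmaps : Set.MapsTo (transition c c') (transition c c').source
      (transition c' c).source := by
    intro u hu
    simp only [transition, OpenPartialHomeomorph.trans_source, OpenPartialHomeomorph.symm_source,
      Set.mem_inter_iff, Set.mem_preimage, OpenPartialHomeomorph.coe_trans,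
      Function.comp_apply] at hu ⊢
    exact ⟨c'.1.map_source hu.2, by
      rw [c'.1.left_inv hu.2]; exact c.1.map_target hu.1⟩
  have hinv (c c' : atlas (E n) X) : ∀ u ∈ (transition c c').source,
      transition c' c (transition c c' u) = u := by
    intro u hu
    simp only [transition, OpenPartialHomeomorph.trans_source, OpenPartialHomeomorph.symm_source,
      Set.mem_inter_iff, Set.mem_preimage, OpenPartialHomeomorph.coe_trans,
      Function.comp_apply] at hu ⊢
    rw [c'.1.left_inv hu.2, c.1.right_inv hu.1]
  have hd (c c' : atlas (E n) X) {u : E n} (hu : u ∈ (transition c c').source) :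
      DifferentiableAt ℝ (transition c c') u :=
    ((hs c c').contDiffAt ((transition c c').open_source.mem_nhds hu)).differentiableAt (by simp)
  refine ⟨(transition c c').open_source, hs c c', fun _ _ => rfl, fun i j => ?_, fun u hu => ?_⟩
  · have h1 : ContDiffOn ℝ ∞ (fun u => fderiv ℝ (transition c' c) u (EuclideanSpace.single j 1))
        (transition c' c).source :=
      ((hs c' c).fderiv_of_isOpen (transition c' c).open_source (by simp)).clm_apply
        contDiffOn_const
    exact ((EuclideanSpace.proj (𝕜 := ℝ) i).contDiff.comp_contDiffOn h1).comp (hs c c') hmaps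
  · have hu' := hmaps hu
    -- The composite is the identity near the image point, where the inverse Jacobian is evaluated.
    -- The chain rule then gives `J * K = 1`.
    have h1 : fderiv ℝ (fun v => transition c c' (transition c' c v)) (transition c c' u)
        = ContinuousLinearMap.id ℝ (E n) := by
      have : (fun v => transition c c' (transition c' c v)) =ᶠ[nhds (transition c c' u)] id :=
        Filter.eventually_of_mem ((transition c' c).open_source.mem_nhds hu') (hinv c' c)
      rw [this.fderiv_eq, fderiv_id]
    have hu'' : transition c' c (transition c c' u) ∈ (transition c c').source := by
      rwa [hinv c c' u hu]
    have h2 : fderiv ℝ (fun v => transition c c' (transition c' c v)) (transition c c' u)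
        = (fderiv ℝ (transition c c') u).comp
          (fderiv ℝ (transition c' c) (transition c c' u)) := by
      have := fderiv_comp (𝕜 := ℝ) (transition c c' u) (hd c c' hu'') (hd c' c hu')
      rw [hinv c c' u hu] at this
      exact this
    ext a b
    have h3 := congrArg (fun L : E n →L[ℝ] E n => L (EuclideanSpace.single b 1) a)
      (h2.symm.trans h1)
    simp only [ContinuousLinearMap.comp_apply, ContinuousLinearMap.id_apply] at h3
    rw [← (EuclideanSpace.basisFun (Fin n) ℝ).sum_repr (fderiv ℝ (transition c' c)
      (transition c c' u) (EuclideanSpace.single b 1)), map_sum] at h3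
    simp only [map_smul, EuclideanSpace.basisFun_repr, EuclideanSpace.basisFun_apply,
      WithLp.ofLp_sum, Finset.sum_apply, PiLp.smul_apply, smul_eq_mul] at h3
    rw [Matrix.mul_apply, Matrix.one_apply]
    refine Eq.trans (Finset.sum_congr rfl fun d _ => mul_comm _ _) (h3.trans ?_)
    simp

theorem source_transition_subset (c c' : atlas (E n) X) : (transition c c').source ⊆ c.1.target :=
  fun _ hu => hu.1

theorem mapsTo_transition (c c' : atlas (E n) X) :
    Set.MapsTo (transition c c') (transition c c').source c'.1.target :=
  fun _ hu => c'.1.map_source hu.2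

theorem WeylConnection.toFun_eq (D : WeylConnection n X) (c c' : atlas (E n) X) {u : E n}
    (hu : u ∈ (transition c c').source) (μ : Fin n) :
    D.toFun c u μ = glElement (maurerCartan (transJac c c') (transJacInv c c') u μ)
      + IsFrameChange.transportForm (transition c c') (transJac c c') (transJacInv c c')
        (D.toFun c') μ u := by
  rw [add_comm]
  exact D.compat c c' u hu μ

theorem eqAtYZero_iff (F f : WeylSection n X) : F.EqAtYZero f ↔
    ∀ c : atlas (E n) X, ∀ u ∈ c.1.target, yZero (F.toFun c u) = yZero (f.toFun c u) := by
  refine forall_congr' fun c => forall₂_congr fun u _ => ⟨fun h => weylHat_ext fun α k => ?_,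
    fun h α k hα => ?_⟩
  · rw [yZero, wcoeff_wdiag, wcoeff_wdiag]
    split_ifs with hα
    · rw [h α k hα]
    · simp
  · have := congrArg (wcoeff α k) h
    simpa [yZero, wcoeff_wdiag, hα] using this

theorem WeylConnection.isFlat_iff (D : WeylConnection n X) :
    D.IsFlat ↔ ∀ c : atlas (E n) X, ∀ u ∈ c.1.target, ∀ μ ν,
      curv (D.toFun c) μ ν u = 0 := Iff.rfl

theorem WeylConnection.eq_of_isConstant (D : WeylConnection n X)
    (hM : ∀ c : atlas (E n) X, ∀ u ∈ c.1.target, IsUnit (localVielbein (D.toFun c) u).det)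
    {F G f : WeylSection n X} (hF : D.IsConstant F) (hG : D.IsConstant G) (hFf : F.EqAtYZero f)
    (hGf : G.EqAtYZero f) : F = G := by
  rw [eqAtYZero_iff] at hFf hGf
  refine WeylSection.ext (funext fun c => funext fun u => ?_)
  by_cases hu : u ∈ c.1.target
  · exact eqOn_of_nabla_eq_zero c.1.open_target (hM c) (hF c) (hG c)
      (fun v hv => (hFf c v hv).trans (hGf c v hv).symm) u hu
  · rw [F.zero_off c u hu, G.zero_off c u hu]

theorem WeylConnection.exists_isConstant [IsManifold (𝓡 n) ∞ X] (D : WeylConnection n X)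
    (hM : ∀ c : atlas (E n) X, ∀ u ∈ c.1.target, IsUnit (localVielbein (D.toFun c) u).det)
    (hflat : D.IsFlat) (f : WeylSection n X) :
    ∃ F : WeylSection n X, D.IsConstant F ∧ F.EqAtYZero f ∧
      ((∀ c : atlas (E n) X, ∀ u ∈ c.1.target, ∀ μ, OrderGE 0 (-1) 0 (-1) (D.toFun c u μ)) →
        f.IsPolynomial → F.IsPolynomial) := by
  classical
  have hex (c : atlas (E n) X) := exists_nabla_eq_zero c.1.open_target
    (fun μ α k => D.smooth c μ α k) (hM c) (hflat c) (fun α k => f.smooth c α k)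
  choose G hGs hGc hGf hGp using hex
  -- Over an overlap, the local solution and its transport from the other chart are both covariantly
  -- constant with the same value at `y = 0`, hence equal.
  have hT (c c' : atlas (E n) X) : ∀ u ∈ (transition c c').source,
      G c u = fibreHom (transJac c c' u) (transJacInv c c' u) (G c' (transition c c' u)) := by
    have hf := isFrameChange_transition (n := n) c c'
    refine eqOn_of_nabla_eq_zero (Φ := D.toFun c) hf.isOpen
      (fun u hu => hM c u (source_transition_subset c c' hu))
      (fun u hu => hGc c u (source_transition_subset c c' hu)) (fun u hu μ => ?_)
      (fun u hu => ?_)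
    · have h := hf.nabla_transport hu μ (Φ := D.toFun c')
        ((hGs c').wdiffAt c'.1.open_target (mapsTo_transition c c' hu))
      simp only [hGc c' _ (mapsTo_transition c c' hu), map_zero, smul_zero,
        Finset.sum_const_zero] at h
      rw [nabla] at h ⊢
      rw [D.toFun_eq c c' hu μ]
      exact h
    · rw [hGf c u (source_transition_subset c c' hu), yZero, ← fibreHom_wdiag, ← yZero,
        hGf c' _ (mapsTo_transition c c' hu), yZero, fibreHom_wdiag, f.compat c c' u hu]
      rfl
  refine ⟨⟨fun c u => if u ∈ c.1.target then G c u else 0, fun c α k => ?_,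
    fun c c' u hu => ?_, fun c u hu => if_neg hu⟩, fun c u hu μ => ?_, ?_, fun hD hf => ?_⟩
  · exact (hGs c α k).congr fun u hu => by simp only [if_pos hu]
  · simp only [if_pos (source_transition_subset c c' hu), if_pos (mapsTo_transition c c' hu)]
    exact hT c c' u hu
  -- Extension by zero does not affect derivatives, because the chart target is open.
  · have h := hGc c u hu μ
    rw [nabla, ← partialDeriv_congr c.1.open_target hu μ (F := fun u => if u ∈ c.1.target then
      G c u else 0) fun v hv => if_pos hv] at h
    rw [WeylConnection.covDeriv]
    simp only [if_pos hu]
    exact h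
  · rw [eqAtYZero_iff]
    intro c u hu
    simp only [if_pos hu]
    exact hGf c u hu
  · intro c u hu
    obtain ⟨N, hN⟩ := hf c u hu
    obtain ⟨W, hW, hWo, huW⟩ := eventually_nhds_iff.mp hN
    refine ⟨N, Filter.eventually_of_mem ((hWo.inter c.1.open_target).mem_nhds ⟨huW, hu⟩)
      fun v hv α k hα => ?_⟩
    simp only [if_pos hv.2]
    refine hGp c (W ∩ c.1.target) Set.inter_subset_right (hWo.inter c.1.open_target) N
      (fun w hw β l hβ => hW w hw.1 β l (by omega)) (fun w hw => hD c w hw.2) v hv α k ?_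
    omega

/-! ### A global flat extension of the truncated connection -/

/-- The part of a connection form used as the starting point of Fedosov's construction: the terms
linear in `p` and the terms independent of `y` and `p`. -/
def affinePart : WeylHat n →ₗ[ℝ] WeylHat n :=
  wdiag fun i j _ => if j = 1 ∨ (i = 0 ∧ j = 0) then 1 else 0

theorem localVielbein_affinePart (Φ : E n → Fin n → WeylHat n) (u : E n) :
    localVielbein (fun u μ => affinePart (Φ u μ)) u = localVielbein Φ u := by
  ext a μ
  simp [localVielbein, affinePart, wcoeff_wdiag]

/-- Truncation depends only on the degrees in `y` and `p`, which linear changes respect, and it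
keeps bidegree `(1,1)`. The truncated form is thus again a connection form. -/
theorem WeylConnection.affinePart_toFun_eq (D : WeylConnection n X) (c c' : atlas (E n) X) {u : E n}
    (hu : u ∈ (transition c c').source) (μ : Fin n) : affinePart (D.toFun c u μ)
      = glElement (maurerCartan (transJac c c') (transJacInv c c') u μ)
      + IsFrameChange.transportForm (transition c c') (transJac c c') (transJacInv c c')
        (fun v ν => affinePart (D.toFun c' v ν)) μ u := by
  rw [D.toFun_eq c c' hu, affinePart, map_add, wdiag_glElement (by simp), wdiag_transportForm]

theorem WeylConnection.exists_flat [IsManifold (𝓡 n) ∞ X] (D : WeylConnection n X)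
    (hM : ∀ c : atlas (E n) X, ∀ u ∈ c.1.target, IsUnit (localVielbein (D.toFun c) u).det) :
    ∃ r : atlas (E n) X → Fin n → E n → WeylHat n,
      (∀ c μ, WSmoothOn c.1.target (r c μ)) ∧
      (∀ c μ, ∀ u ∈ c.1.target, OrderGE 2 1 3 2 (r c μ u)) ∧
      (∀ c, ∀ u ∈ c.1.target, ∀ μ ν,
        curv (fun u ν => affinePart (D.toFun c u ν) + r c ν u) μ ν u = 0) ∧
      (∀ c, ∀ B C d : ℤ, B ≤ C → B ≤ d →
        (∀ u ∈ c.1.target, ∀ μ, OrderGE 0 B C d (affinePart (D.toFun c u μ))) →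
        ∀ μ, ∀ u ∈ c.1.target, OrderGE 0 B C d (r c μ u)) ∧
      ∀ c c', ∀ u ∈ (transition c c').source, ∀ μ, r c μ u
        = IsFrameChange.transportForm (transition c c') (transJac c c') (transJacInv c c')
          (fun v ν => r c' ν v) μ u := by
  have hs (c : atlas (E n) X) (μ : Fin n) :
      WSmoothOn c.1.target fun u => affinePart (D.toFun c u μ) :=
    WSmoothOn.wdiag _ fun α k => D.smooth c μ α k
  have hM' (c : atlas (E n) X) : ∀ u ∈ c.1.target,
      IsUnit (localVielbein (fun u μ => affinePart (D.toFun c u μ)) u).det := fun u hu => by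
    rw [localVielbein_affinePart]
    exact hM c u hu
  have hex (c : atlas (E n) X) := exists_curv_add_eq_zero c.1.open_target (hs c) (hM' c)
  choose r hrs hr2 hr0 hrf hrd using hex
  refine ⟨r, hrs, hr2, hrf, hrd, fun c c' u hu μ => ?_⟩
  have hf := isFrameChange_transition (n := n) c c'
  have hsub := source_transition_subset c c'
  have hmaps := mapsTo_transition c c'
  -- The transported correction is also flat, normalized and of weight at least `2`, so uniqueness
  -- identifies it with the one built in this chart.
  refine eqOn_of_curv_add_eq_zero (Φ := fun u μ => affinePart (D.toFun c u μ)) hf.isOpen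
    (fun u hu => hM' c u (hsub hu)) (fun μ => (hs c μ).mono hsub) (fun μ => (hrs c μ).mono hsub)
    (s := IsFrameChange.transportForm (transition c c') (transJac c c') (transJacInv c c')
      fun v ν => r c' ν v) (fun μ => ?_) (fun μ u hu => hr2 c μ u (hsub hu)) (fun μ u hu => ?_)
    (fun u hu => hr0 c u (hsub hu)) (fun u hu => ?_) (fun u hu => hrf c u (hsub hu))
    (fun u hu μ ν => ?_) μ u hu
  · exact WSmoothOn.sum fun σ _ => WSmoothOn.smul (hf.contDiffOn_jac σ μ)
      (hf.wsmoothOn_fibreHom ((hrs c' σ).comp hf.contDiffOn hmaps))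
  · exact OrderGE.sum fun σ _ => ((hr2 c' σ _ (hmaps hu)).fibreHom).smul _
  · rw [localVielbein_transport fun μ => D.affinePart_toFun_eq c c' hu μ,
      sum_frameVec_mul_transportForm (hf.mul_eq_one u hu) (hM' c' _ (hmaps hu)),
      hr0 c' _ (hmaps hu), map_zero]
  · rw [curv_congr hf.isOpen hu (Φ' := fun v ν => glElement (maurerCartan (transJac c c')
      (transJacInv c c') v ν) + IsFrameChange.transportForm (transition c c') (transJac c c')
        (transJacInv c c') (fun v ν => affinePart (D.toFun c' v ν) + r c' ν v) ν v)
      (fun v hv ν => by rw [D.affinePart_toFun_eq c c' hv, transportForm_add, add_assoc]),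
      hf.curv_transport hu fun μ => ((hs c' μ).add (hrs c' μ)).wdiffAt c'.1.open_target (hmaps hu)]
    simp only [hrf c' _ (hmaps hu), map_zero, smul_zero, Finset.sum_const_zero]

end Charts

end WeylBundle

end

/-! ### The main theorem -/

theorem proposition1 {n : ℕ} {X : Type*} [TopologicalSpace X] [T2Space X]
    [SecondCountableTopology X] [ChartedSpace (EuclideanSpace ℝ (Fin n)) X]
    [IsManifold (𝓡 n) ∞ X]
    (D : WeylBundle.WeylConnection n X)
    (hpoly : D.IsPolynomial)
    (hviel : D.HasInvertibleVielbein) :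
    (∃ w : WeylBundle.WeylOneForm n X,
      w.FedosovGE 1 ∧ w.DegOnePFree ∧ (D.DegZeroVanishes → w.FedosovGE 2) ∧
      (D.addForm w).IsFlat ∧
      ∀ f : WeylBundle.WeylSection n X, f.IsSymbol →
        ∃! F : WeylBundle.WeylSection n X,
          F.IsPolynomial ∧ (D.addForm w).IsConstant F ∧ F.EqAtYZero f) ∧
    (∀ w : WeylBundle.WeylOneForm n X,
      w.FedosovGE 1 → w.DegOnePFree → (D.addForm w).IsFlat →
      ∀ f : WeylBundle.WeylSection n X, f.IsSymbol →
        ∃! F : WeylBundle.WeylSection n X,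
          (D.addForm w).IsConstant F ∧ F.EqAtYZero f) := by
  open WeylBundle in
  have hM (c : atlas (E n) X) (u : E n) (hu : u ∈ c.1.target) :
      IsUnit (localVielbein (D.toFun c) u).det := (hviel c u hu).2
  have hMw (w : WeylOneForm n X) (hw : w.DegOnePFree) (c : atlas (E n) X) (u : E n)
      (hu : u ∈ c.1.target) : IsUnit (localVielbein ((D.addForm w).toFun c) u).det := by
    have : localVielbein ((D.addForm w).toFun c) u = localVielbein (D.toFun c) u := by
      ext a μ
      simp [localVielbein, WeylConnection.addForm, hw c u hu μ a]
    rw [this]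
    exact hM c u hu
  refine ⟨?_, fun w _ hw hflat f _ => ?_⟩
  · obtain ⟨r, hrs, hr2, hrf, hrd, hrt⟩ := D.exists_flat hM
    have hA (c : atlas (E n) X) (μ : Fin n) :
        WSmoothOn c.1.target fun u => affinePart (D.toFun c u μ) :=
      WSmoothOn.wdiag _ fun α k => D.smooth c μ α k
    -- The resulting connection form is the truncation of `ϖ` plus Fedosov's correction. As a
    -- difference of two connection forms, `w` has no inhomogeneous term.
    let w : WeylOneForm n X :=
      { toFun := fun c u μ => affinePart (D.toFun c u μ) + r c μ u - D.toFun c u μ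
        smooth := fun c μ => ((hA c μ).add (hrs c μ)).sub fun α k => D.smooth c μ α k
        compat := fun c c' u hu μ => by
          rw [D.affinePart_toFun_eq c c' hu, hrt c c' u hu, D.toFun_eq c c' hu, add_assoc,
            ← transportForm_add, add_sub_add_left_eq_sub, ← transportForm_sub]
          rfl }
    have hadd (c : atlas (E n) X) : (D.addForm w).toFun c
        = fun u μ => affinePart (D.toFun c u μ) + r c μ u := by
      funext u μ
      exact add_sub_cancel _ _
    have h00 (c : atlas (E n) X) (u : E n) (hu : u ∈ c.1.target) (μ : Fin n) :
        wcoeff 0 0 (w.toFun c u μ) = 0 := by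
      -- The truncation keeps the constants and `r` has weight at least `2`, so `w` has no constant
      -- term; the same reasoning shows that `w` has no term linear in `p`.
      have := hr2 c μ u hu 0 0 (by simp)
      simp [w, affinePart, wcoeff_wdiag, this]
    have h01 : w.DegOnePFree := by
      intro c u hu μ a
      have := hr2 c μ u hu (Finsupp.single (Sum.inr a) 1) 0 (by simp)
      simp [w, affinePart, wcoeff_wdiag, this]
    have hflat : (D.addForm w).IsFlat := by
      rw [WeylConnection.isFlat_iff]
      intro c
      rw [hadd]
      exact hrf c
    have hp (c : atlas (E n) X) (u : E n) (hu : u ∈ c.1.target) (μ : Fin n) :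
        OrderGE 0 (-1) 0 (-1) ((D.addForm w).toFun c u μ) := by
      -- Order `-1` for these weights means degree at most one in `p`, a condition that Fedosov's
      -- iteration preserves.
      have hAp : ∀ u ∈ c.1.target, ∀ μ, OrderGE 0 (-1) 0 (-1) (affinePart (D.toFun c u μ)) := by
        intro u _ μ α k hk
        rw [affinePart, wcoeff_wdiag, if_neg (by omega), zero_mul]
      rw [hadd]
      exact (hAp u hu μ).add (hrd c (-1) 0 (-1) (by norm_num) le_rfl hAp μ u hu)
    refine ⟨w, ?_, h01, ?_, hflat, fun f hf => ?_⟩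
    · intro c u hu μ α k hk
      rw [fedosovDeg] at hk
      obtain rfl : k = 0 := by omega
      obtain rfl : α = 0 := eq_zero_of_degree (by omega) (by omega)
      exact h00 c u hu μ
    · intro hD c u hu μ α k hk
      rw [fedosovDeg] at hk
      obtain rfl : k = 0 := by omega
      by_cases hy : yDeg α = 0
      · rcases (by omega : pDeg α = 0 ∨ pDeg α = 1) with hp | hp
        · obtain rfl := eq_zero_of_degree hy hp
          exact h00 c u hu μ
        · obtain ⟨a, rfl⟩ := eq_single_inr_of_degree hy hp
          exact h01 c u hu μ a
      · obtain ⟨a, rfl⟩ := eq_single_inl_of_degree (α := α) (by omega) (by omega)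
        -- Every term carries a `p` or an `ħ`: the truncation discards the terms in `y` without `p`,
        -- and the constant vanishes by `hD`. The iteration preserves this, so `r` has no term
        -- `y^a`. Together with the hypothesis on the degree-one part of `ϖ`, this removes the last
        -- possible term of degree one in `w`.
        have hAp : ∀ u ∈ c.1.target, ∀ μ, OrderGE 0 1 1 1 (affinePart (D.toFun c u μ)) := by
          intro u hu μ α k hk
          rw [affinePart, wcoeff_wdiag]
          obtain rfl : k = 0 := by omega
          by_cases hy : yDeg α = 0
          · obtain rfl : α = 0 := eq_zero_of_degree hy (by omega)
            rw [hD c u hu μ, mul_zero]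
          · rw [if_neg (by omega), zero_mul]
        have h1 := hrd c 1 1 1 le_rfl le_rfl hAp μ u hu (Finsupp.single (Sum.inl a) 1) 0 (by simp)
        have h2 := (hviel c u hu).1 μ a
        simp [w, affinePart, wcoeff_wdiag, h1, h2]
    -- Uniqueness already holds among all formal sections; polynomiality matters only for existence.
    · obtain ⟨F, hFc, hFf, hFp⟩ := (D.addForm w).exists_isConstant (hMw w h01) hflat f
      exact ⟨F, ⟨hFp hp hf.1, hFc, hFf⟩, fun G hG =>
        (D.addForm w).eq_of_isConstant (hMw w h01) hG.2.1 hFc hG.2.2 hFf⟩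
  · obtain ⟨F, hFc, hFf, -⟩ := (D.addForm w).exists_isConstant (hMw w hw) hflat f
    exact ⟨F, ⟨hFc, hFf⟩, fun G hG =>
      (D.addForm w).eq_of_isConstant (hMw w hw) hG.1 hFc hG.2 hFf⟩
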